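/- **Setting.** Let $n\ge 2$, let $f_1,\dots,f_n:\mathbb R^m\to\mathbb R$ be convex and differentiable, and suppose $f=\frac1n\sum_i f_i$ is $\mu$-strongly convex and $L$-smooth ($\mu,L>0$), with minimizer $x^*$ and $f^*=f(x^*)$. The $n$ nodes communicate over a random network: $(s_k)_{k\ge0}$ is a stationary time-homogeneous Markov chain with invariant law $\pi$ and kernel $Q$; a state $s$ carries a graph $\mathcal G_s$ on the nodes and a matrix $W_s\in\mathbb R^{n\times n}$, measurable in $s$. A *gossip matrix* of a graph is a matrix whose off-diagonal entries vanish off the edges and whose kernel is exactly $\mathrm{span}\{(1,\dots,1)\}$. Assume: 1. for some integer $\tau\ge1$ and all integers $k\ge 0$, $\sup_{s,s'}\frac12\|Q^k(s,\cdot)-Q^k(s',\cdot)\|_{TV}\le(1/4)^{\lfloor k/\tau\rfloor}$; 2. each $W_s$ is a gossip matrix of $\mathcal G_s$ with zero column sums, and $\mathbb E_\pi[W_s]=\tilde W$; 3. $\tilde W$ is symmetric positive semidefinite and is a gossip matrix of some connected graph; 4. $\|W_s-\tilde W\|\le\rho$ for every $s$ (spectral norm). Let $\lambda_{\max},\lambda_{\min}$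 be the largest and the smallest positive eigenvalue of $\tilde W$, and $\chi=\lambda_{\max}/\lambda_{\min}$. Write $W_k=W_{s_k}$. **Algorithm 1 (consensus).** Given $c>0$, put $\gamma_1=c\min\{1/\lambda_{\max},\lambda_{\min}^3/\rho^4\}$ (with $\lambda_{\min}^3/\rho^4=\infty$ if $\rho=0$), $p=\frac14$, $\beta=\sqrt{4p^2\lambda_{\min}\gamma_1/3}$, $\eta_1=3\beta/(p\lambda_{\min}\gamma_1)$, $\theta=\frac{p\eta_1^{-1}-1}{\beta p\eta_1^{-1}-1}$, $M=\max\{2,\sqrt{\frac14(1+\frac2\beta)}\}$, $B=\lceil\tau\log_2M\rceil$. Start from $x^0=x_f^0\in(\mathbb R^m)^n$ at the current network time $t_0$. Iteration $k$ sets $x_g^k=\theta x_f^k+(1-\theta)x^k$ and draws $J_k$ with $\mathbb P(J_k=j)=2^{-j}$, $j\ge1$ (all draws independent of each other and of the network). With $g_j^k=2^{-j}B^{-1}\sum_{i=1}^{2^jB}W_{t_k+i}x_g^k$ it puts $g^k=g_0^k+2^{J_k}(g^k_{J_k}-g^k_{J_k-1})$ if $2^{J_k}\le M$ and $g^k=g_0^k$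 otherwise, then $$x_f^{k+1}=x_g^k-p\gamma_1g^k,\qquad x^{k+1}=\eta_1x_f^{k+1}+(p-\eta_1)x_f^k+(1-p)(1-\beta)x^k+(1-p)\beta x_g^k .$$ The iteration uses $2^{J_k}B$ communication rounds if $2^{J_k}\le M$ and $B$ rounds otherwise, and $t_{k+1}$ is $t_k$ plus that number. Its output after $T$ iterations is $x^T$. **Algorithm 2.** Start from $x_i^0=y_i^0=x^0\in\mathbb R^m$ at network time $0$. For $k=0,\dots,N-1$: compute $\nabla f_i(y_i^k)$ at each node $i$; run $T$ iterations of Algorithm 1 from $\{\nabla f_i(y_i^k)\}_{i}$ (network time and draws $J$ continuing from one run to the next) to obtain $\{v_i^k\}_i$; set $x_i^{k+1}=y_i^k-\frac1Lv_i^k$ and $y_i^{k+1}=x_i^{k+1}+\frac{\sqrt L-\sqrt\mu}{\sqrt L+\sqrt\mu}(x_i^{k+1}-x_i^k)$. **Claim.** Put $$\Psi=\log\Big(e+n+\chi+\frac{\rho^2}{\lambda_{\min}^2}+\frac L\mu\Big),\qquad \Lambda=\log\Big(e+\frac1\varepsilon\Big[f(x^0)-f^*+\frac1{n\mu}\sum_i\|\nabla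 f_i(x^*)\|^2\Big]\Big).$$ There are absolute constants $c,C>0$ and $q\in\mathbb N$ such that for all data as above and every $\varepsilon>0$ there are deterministic numbers $N$ and $$T\le C\,\tau\Big[\sqrt\chi+\frac{\rho^2}{\lambda_{\min}^2}\Big]\Psi^q\Lambda$$ for which the output of Algorithm 2 satisfies $\mathbb E[f(x_i^N)-f^*]\le\varepsilon$ at every node $i$, the expected total number of communication rounds is at most $$C\,\tau\Big[\sqrt\chi+\frac{\rho^2}{\lambda_{\min}^2}\Big]\sqrt{\frac L\mu}\;\Psi^q\Lambda^2 ,$$ and each node computes at most $C\sqrt{L/\mu}\,\log\big(e+\frac{f(x^0)-f^*}\varepsilon\big)$ local gradients. (The integrals involved are finite.) -/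

import Mathlib

open MeasureTheory ProbabilityTheory
open scoped Matrix

noncomputable section

namespace MarkovGossip

/-! ### Objective functions -/

/-- The space `ℝᵐ` with its Euclidean norm. -/
abbrev Vec (m : ℕ) := EuclideanSpace ℝ (Fin m)

/-- The global objective `f = (1/n) ∑ᵢ fᵢ`. -/
def globalObjective {n m : ℕ} (f : Fin n → Vec m → ℝ) (x : Vec m) : ℝ :=
  (1 / (n : ℝ)) * ∑ i, f i x

/-- `μ`-strong convexity of a differentiable function, through gradients. -/
def IsStronglyConvex {m : ℕ} (μ : ℝ) (h : Vec m → ℝ) : Prop :=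
  Differentiable ℝ h ∧
    ∀ x y, h x + inner ℝ (gradient h x) (y - x) + μ / 2 * ‖y - x‖ ^ 2 ≤ h y

/-- `L`-smoothness: differentiability with an `L`-Lipschitz gradient. -/
def IsSmooth {m : ℕ} (L : ℝ) (h : Vec m → ℝ) : Prop :=
  Differentiable ℝ h ∧ ∀ x y, ‖gradient h y - gradient h x‖ ≤ L * ‖y - x‖

/-! ### Gossip matrices and their spectral characteristics -/

/-- `W` is a gossip matrix of the graph `G`: it is supported on the diagonal and the edges of `G`,
and its kernel consists exactly of the vectors with equal coordinates. -/
def IsGossipMatrix {n : ℕ} (G : SimpleGraph (Fin n)) (W : Matrix (Fin n) (Fin n) ℝ) : Prop :=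
  (∀ i j, i ≠ j → ¬ G.Adj i j → W i j = 0) ∧
    ∀ x : Fin n → ℝ, W *ᵥ x = 0 ↔ ∃ a : ℝ, x = fun _ => a

/-- The largest eigenvalue (used for symmetric matrices). -/
def lambdaMax {n : ℕ} (A : Matrix (Fin n) (Fin n) ℝ) : ℝ := sSup (spectrum ℝ A)

/-- The smallest positive eigenvalue. -/
def lambdaMinPos {n : ℕ} (A : Matrix (Fin n) (Fin n) ℝ) : ℝ :=
  sInf {l : ℝ | l ∈ spectrum ℝ A ∧ 0 < l}

/-- The condition number `χ = λ_max / λ_min⁺`. -/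
def condNumber {n : ℕ} (A : Matrix (Fin n) (Fin n) ℝ) : ℝ := lambdaMax A / lambdaMinPos A

/-! ### The Markovian network -/

/-- Total variation distance `(1/2) ‖P - Q‖_TV = sup_A |P(A) - Q(A)|` of probability measures. -/
def tvDist {S : Type*} [MeasurableSpace S] (P Q : Measure S) : ℝ :=
  ⨆ A : {A : Set S // MeasurableSet A}, |P.real A - Q.real A|

/-- Assumptions on the network. The points of `S` are the possible network states: the state `s`
carries the graph `G s` and the gossip matrix `W s`. (One may take for `S` the set of possible
gossip matrices and for `W` the inclusion.) `Q` is the transition kernel, `π` the stationary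
distribution, `τ` the mixing time, `Wt` the mean gossip matrix. -/
structure NetworkAssumptions {n : ℕ} {S : Type*} [MeasurableSpace S]
    (Q : Kernel S S) (π : Measure S) (τ : ℕ) (G : S → SimpleGraph (Fin n))
    (W : S → Matrix (Fin n) (Fin n) ℝ) (Wt : Matrix (Fin n) (Fin n) ℝ) (ρ : ℝ) : Prop where
  one_le_tau : 1 ≤ τ
  invariant : Q.Invariant π
  mixing : ∀ (k : ℕ) (s s' : S), tvDist ((Q ^ k) s) ((Q ^ k) s') ≤ (1 / 4 : ℝ) ^ (k / τ)
  measurable : ∀ i j, Measurable fun s => W s i j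
  gossip : ∀ s, IsGossipMatrix (G s) (W s)
  colSum : ∀ s j, ∑ i, W s i j = 0
  mean : ∀ i j, ∫ s, W s i j ∂π = Wt i j
  mean_gossip : ∃ Gt : SimpleGraph (Fin n), Gt.Connected ∧ IsGossipMatrix Gt Wt
  mean_posSemidef : Wt.PosSemidef
  deviation : ∀ s, ‖Matrix.toEuclideanCLM (n := Fin n) (𝕜 := ℝ) (W s - Wt)‖ ≤ ρ

/-- `X` is a stationary time-homogeneous Markov chain with kernel `Q` and initial law `π`. -/
structure IsStationaryMarkovChain {S Ω : Type*} [mS : MeasurableSpace S] [MeasurableSpace Ω]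
    (P : Measure Ω) (Q : Kernel S S) (π : Measure S) (X : ℕ → Ω → S) : Prop where
  measurable : ∀ k, Measurable (X k)
  initial : P.map (X 0) = π
  markov : ∀ (k : ℕ) (A : Set S), MeasurableSet A →
    P[(X (k + 1) ⁻¹' A).indicator (fun _ => (1 : ℝ)) |
        ⨆ j : Fin (k + 1), MeasurableSpace.comap (X j) mS]
      =ᵐ[P] fun ω => (Q (X k ω)).real A

/-- The `J k` are independent geometric variables with parameter `1/2` on `{1, 2, …}`. -/
structure IsIIDGeometric {Ω : Type*} [MeasurableSpace Ω] (P : Measure Ω) (J : ℕ → Ω → ℕ) :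
    Prop where
  measurable : ∀ k, Measurable (J k)
  law : ∀ k j, 1 ≤ j → P.real {ω | J k ω = j} = (1 / 2 : ℝ) ^ j
  indep : iIndepFun J P

/-! ### Accelerated consensus with randomized batches -/

/-- Parameters of the consensus algorithm. -/
structure ConsensusParams where
  γ : ℝ
  θ : ℝ
  η : ℝ
  β : ℝ
  p : ℝ
  M : ℝ
  B : ℕ

/-- The parameters, with stepsize `γ = c · min {1 / λ_max, λ_min³ / ρ⁴}` (the second entry being
`+∞` when `ρ = 0`) and `b = τ`. -/
def consensusParams (c lmax lmin ρ : ℝ) (τ : ℕ) : ConsensusParams :=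
  let γ : ℝ := c * (max lmax (ρ ^ 4 / lmin ^ 3))⁻¹
  let p : ℝ := 1 / 4
  let β : ℝ := √(4 * p ^ 2 * lmin * γ / 3)
  let η : ℝ := 3 * β / (p * lmin * γ)
  let M : ℝ := max 2 (√(1 / 4 * (1 + 2 / β)))
  { γ := γ
    θ := (p * η⁻¹ - 1) / (β * p * η⁻¹ - 1)
    η := η
    β := β
    p := p
    M := M
    B := ⌈(τ : ℝ) * Real.logb 2 M⌉₊ }

/-- One communication round: node `i` receives the vectors of its neighbours and forms
`∑ⱼ Wᵢⱼ xⱼ`. -/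
def gossip {n m : ℕ} (W : Matrix (Fin n) (Fin n) ℝ) (x : Fin n → Vec m) : Fin n → Vec m :=
  fun i => ∑ j, W i j • x j

/-- `g_j = 2^{-j} B⁻¹ ∑_{i=1}^{2^j B} W(𝒢_{t+i}) x`. -/
def batchMean {n m : ℕ} (W : ℕ → Matrix (Fin n) (Fin n) ℝ) (B t j : ℕ) (x : Fin n → Vec m) :
    Fin n → Vec m :=
  ((2 : ℝ) ^ j * B)⁻¹ • ∑ i ∈ Finset.Icc 1 (2 ^ j * B), gossip (W (t + i)) x

/-- The estimate `g = g_0 + 2^J (g_J - g_{J-1})` if `2^J ≤ M`, and `g = g_0` otherwise. -/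
def gradEstimate {n m : ℕ} (a : ConsensusParams) (W : ℕ → Matrix (Fin n) (Fin n) ℝ) (t J : ℕ)
    (x : Fin n → Vec m) : Fin n → Vec m :=
  batchMean W a.B t 0 x +
    if (2 : ℝ) ^ J ≤ a.M then
      (2 : ℝ) ^ J • (batchMean W a.B t J x - batchMean W a.B t (J - 1) x)
    else 0

/-- Number of communication rounds needed to compute `gradEstimate`. -/
def batchRounds (a : ConsensusParams) (J : ℕ) : ℕ :=
  if (2 : ℝ) ^ J ≤ a.M then 2 ^ J * a.B else a.B

/-- State of the consensus algorithm; `time` is the number of communication rounds elapsed. -/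
structure ConsensusState (n m : ℕ) where
  x : Fin n → Vec m
  xf : Fin n → Vec m
  time : ℕ

/-- One iteration of accelerated consensus. -/
def consensusStep {n m : ℕ} (a : ConsensusParams) (W : ℕ → Matrix (Fin n) (Fin n) ℝ) (J : ℕ)
    (s : ConsensusState n m) : ConsensusState n m :=
  let xg : Fin n → Vec m := a.θ • s.xf + (1 - a.θ) • s.x
  let g : Fin n → Vec m := gradEstimate a W s.time J xg
  let xf' : Fin n → Vec m := xg - (a.p * a.γ) • g
  { x := a.η • xf' + (a.p - a.η) • s.xf + ((1 - a.p) * (1 - a.β)) • s.x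
      + ((1 - a.p) * a.β) • xg
    xf := xf'
    time := s.time + batchRounds a J }

/-- `T` iterations of accelerated consensus from `v`, starting at network time `t`. -/
def consensusRun {n m : ℕ} (a : ConsensusParams) (W : ℕ → Matrix (Fin n) (Fin n) ℝ) (J : ℕ → ℕ)
    (v : Fin n → Vec m) (t : ℕ) : ℕ → ConsensusState n m
  | 0 => { x := v, xf := v, time := t }
  | k + 1 => consensusStep a W (J k) (consensusRun a W J v t k)

/-! ### Decentralized accelerated gradient method -/

/-- State of the decentralized method: node variables, number of communication rounds used so far,
number of gradient computations made so far by each node. -/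
structure AGDState (n m : ℕ) where
  x : Fin n → Vec m
  y : Fin n → Vec m
  rounds : ℕ
  grads : ℕ

/-- Nesterov's method in which, at every iteration, the local gradients are averaged by `T`
iterations of accelerated consensus. The network keeps evolving along `W`, and fresh variables `J`
are used, from one consensus run to the next. -/
def agdRun {n m : ℕ} (a : ConsensusParams) (γ η : ℝ) (f : Fin n → Vec m → ℝ) (x₀ : Vec m) (T : ℕ)
    (W : ℕ → Matrix (Fin n) (Fin n) ℝ) (J : ℕ → ℕ) : ℕ → AGDState n m
  | 0 => { x := fun _ => x₀, y := fun _ => x₀, rounds := 0, grads := 0 }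
  | k + 1 =>
    let s := agdRun a γ η f x₀ T W J k
    let out := consensusRun a W (fun t => J (k * T + t)) (fun i => gradient (f i) (s.y i))
      s.rounds T
    let x' : Fin n → Vec m := s.y - γ • out.x
    { x := x'
      y := x' + η • (x' - s.x)
      rounds := out.time
      grads := s.grads + 1 }

end MarkovGossip

end

set_option linter.unusedSectionVars false

/-! The outer loop is Nesterov's method for the node averages, run with an inexact gradient. Gossip
matrices have zero column sums, so consensus keeps the mean of its input, and the averages move
along the mean of the local gradients. That mean differs from the gradient of the global objective
only through the disagreement of the nodes, and disagreement is created only by imperfect consensus.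
`inexact_nesterov_step` turns the gradient error into an additive term; `nesterovLyapunov_agd_le`
sums these terms along a trajectory.

Accelerated consensus is Nesterov's method for the quadratic form of the mean matrix on zero-sum
vectors. With exact averages its Lyapunov function contracts by `1 - β / 4`
(`consensusLyapunov_step_le`). Noise adds a linear and a quadratic term. The linear term sees only
the bias of the estimator: the weighted levels telescope, so on average over the draw the estimator
is a batch of about `M * B` rounds, and the mixing of the chain bounds its bias. The quadratic term
sees the second moment, which is bounded because each level has a variance inversely proportional to
its probability and the base batch `B` absorbs the number of levels. The stepsize makes both effects
small fractions of `β`, which leaves the contraction `1 - β / 8`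
(`NetworkAssumptions.sum_integral_lyapunov_step_le`).

The network times are random, but only through the draws, which are independent of the network and
matter only after truncation to finitely many values. Every expectation is therefore a finite
weighted sum over frozen draws (`IsIIDGeometric.integral_randomized`). With frozen draws all times
are deterministic, so the ordinary Markov property suffices and stopping times never appear.

The two loops are coupled: consensus errors depend on the size of the local gradients, and these on
earlier consensus errors. A discrete Gronwall argument (`le_of_le_add_sum`) closes the loop as soon
as the contraction over `T` consensus iterations beats a polynomial in the problem data. This costs
only logarithmic factors in `T`, because `1 / β` is of order `√χ + ρ² / λ_min²`. A consensus
iteration costs on average at most `(K + 1) * B` rounds, where `K` is the largest draw that is not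
truncated. -/

noncomputable section

namespace MarkovGossip

/-! ### Convexity and smoothness inequalities. -/

section Calculus

variable {m : ℕ}

theorem hasDerivAt_along_line {h : Vec m → ℝ} (hd : Differentiable ℝ h) (y v : Vec m) (t : ℝ) :
    HasDerivAt (fun t : ℝ => h (y + t • v)) (inner ℝ (gradient h (y + t • v)) v) t := by
  have h1 : HasDerivAt (fun t : ℝ => y + t • v) v t := by
    simpa using ((hasDerivAt_id t).smul_const v).const_add y
  have h2 := (hd (y + t • v)).hasFDerivAt.comp_hasDerivAt t h1
  rw [inner_gradient_left]
  exact h2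

theorem IsSmooth.le_quadratic {L : ℝ} {h : Vec m → ℝ} (hs : IsSmooth L h) (x y : Vec m) :
    h x ≤ h y + inner ℝ (gradient h y) (x - y) + L / 2 * ‖x - y‖ ^ 2 := by
  set v := x - y with hv
  let ψ : ℝ → ℝ := fun t => h (y + t • v) - (t * inner ℝ (gradient h y) v + L / 2 * t ^ 2 * ‖v‖ ^ 2)
  have hder : ∀ t, HasDerivAt ψ (inner ℝ (gradient h (y + t • v)) v -
      (inner ℝ (gradient h y) v + L * t * ‖v‖ ^ 2)) t := by
    intro t
    refine (hasDerivAt_along_line hs.1 y v t).sub ?_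
    have h1 := (hasDerivAt_id t).mul_const (inner ℝ (gradient h y) v)
    have h2 := (((hasDerivAt_id t).pow 2).const_mul (L / 2)).mul_const (‖v‖ ^ 2)
    exact (h1.add h2).congr_deriv (by simp only [id]; push_cast; ring)
  have hanti : AntitoneOn ψ (Set.Icc 0 1) := by
    refine antitoneOn_of_deriv_nonpos (convex_Icc 0 1)
      (fun t _ => (hder t).continuousAt.continuousWithinAt)
      (fun t _ => (hder t).differentiableAt.differentiableWithinAt) fun t ht => ?_
    rw [interior_Icc] at ht
    rw [(hder t).deriv]
    have h1 : inner ℝ (gradient h (y + t • v) - gradient h y) v ≤ L * t * ‖v‖ ^ 2 := by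
      refine (real_inner_le_norm _ _).trans ?_
      have h2 := hs.2 y (y + t • v)
      rw [add_sub_cancel_left, norm_smul, Real.norm_of_nonneg ht.1.le] at h2
      nlinarith [norm_nonneg v]
    rw [inner_sub_left] at h1
    linarith
  have h3 := hanti (Set.left_mem_Icc.2 zero_le_one) (Set.right_mem_Icc.2 zero_le_one) zero_le_one
  simp only [ψ, one_smul, zero_smul, add_zero, hv, add_sub_cancel] at h3
  rw [← hv] at h3
  linarith

theorem convexOn_gradient_le {h : Vec m → ℝ} (hc : ConvexOn ℝ Set.univ h)
    (hd : Differentiable ℝ h) (x y : Vec m) :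
    h y + inner ℝ (gradient h y) (x - y) ≤ h x := by
  have hg : ConvexOn ℝ Set.univ (fun t : ℝ => h (y + t • (x - y))) := by
    refine ⟨convex_univ, fun a _ b _ p q hp hq hpq => ?_⟩
    have := hc.2 (Set.mem_univ (y + a • (x - y))) (Set.mem_univ (y + b • (x - y))) hp hq hpq
    convert this using 2
    have hy : y = p • y + q • y := by rw [← add_smul, hpq, one_smul]
    nth_rewrite 1 [hy]
    simp only [smul_eq_mul, smul_add, smul_smul, add_smul]
    abel
  have h0 := hg.le_slope_of_hasDerivAt (Set.mem_univ 0) (Set.mem_univ 1) zero_lt_one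
    (hasDerivAt_along_line hd y (x - y) 0)
  simp only [zero_smul, add_zero, slope_def_field, one_smul, add_sub_cancel, sub_zero, div_one]
    at h0
  linarith

/-- At the gradient-type point `x - K⁻¹ • d` the upper model at `x` must lie above the lower model
at `y`; together with the upper bound for `h x` this gives `K⁻¹ / 2 * ‖d‖ ^ 2 ≤ K / 2 * ‖x - y‖ ^
2`. -/
theorem gradient_lipschitz_of_bregman_le {K : ℝ} (hK : 0 < K) {h : Vec m → ℝ}
    (hlow : ∀ x y, h y + inner ℝ (gradient h y) (x - y) ≤ h x)
    (hup : ∀ x y, h x ≤ h y + inner ℝ (gradient h y) (x - y) + K / 2 * ‖x - y‖ ^ 2)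
    (x y : Vec m) : ‖gradient h x - gradient h y‖ ≤ K * ‖x - y‖ := by
  set d := gradient h x - gradient h y with hd
  have h1 := hup (x - K⁻¹ • d) x
  have h2 := hlow (x - K⁻¹ • d) y
  have h3 := hup x y
  have e1 : x - K⁻¹ • d - x = -(K⁻¹ • d) := by abel
  have e2 : x - K⁻¹ • d - y = (x - y) - K⁻¹ • d := by abel
  rw [e1, norm_neg, norm_smul, inner_neg_right, inner_smul_right, Real.norm_of_nonneg
    (inv_nonneg.2 hK.le)] at h1
  rw [e2, inner_sub_right, inner_smul_right] at h2
  have e3 : inner ℝ (gradient h x) d - inner ℝ (gradient h y) d = ‖d‖ ^ 2 := by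
    rw [← inner_sub_left, ← hd, real_inner_self_eq_norm_sq]
  have h4 : K⁻¹ * ‖d‖ ^ 2 - K / 2 * (K⁻¹ * ‖d‖) ^ 2 ≤ K / 2 * ‖x - y‖ ^ 2 := by
    rw [← e3]; nlinarith
  have e5 : K⁻¹ * ‖d‖ ^ 2 - K / 2 * (K⁻¹ * ‖d‖) ^ 2 = K⁻¹ / 2 * ‖d‖ ^ 2 := by
    field_simp; ring
  rw [e5] at h4
  have h6 : ‖d‖ ^ 2 ≤ (K * ‖x - y‖) ^ 2 := by
    have := mul_le_mul_of_nonneg_left h4 (by positivity : 0 ≤ 2 * K)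
    field_simp at this
    nlinarith
  exact le_of_sq_le_sq h6 (by positivity)

theorem gradient_globalObjective {n : ℕ} {f : Fin n → Vec m → ℝ}
    (hd : ∀ i, Differentiable ℝ (f i)) (x : Vec m) :
    gradient (globalObjective f) x = (1 / (n : ℝ)) • ∑ i, gradient (f i) x := by
  have h : HasFDerivAt (globalObjective f) ((1 / (n : ℝ)) • ∑ i, fderiv ℝ (f i) x) x := by
    have h1 : HasFDerivAt (fun y => ∑ i, f i y) (∑ i, fderiv ℝ (f i) x) x :=
      HasFDerivAt.fun_sum fun i _ => (hd i x).hasFDerivAt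
    exact h1.const_mul _
  rw [gradient, h.fderiv]
  simp [gradient, map_sum]

/-- Only the average is assumed smooth. By convexity all Bregman divergences of the components are
nonnegative, so each is at most their sum, which is `n` times that of the global objective. The lost
factor `n` ends up inside logarithms. -/
theorem gradient_component_lipschitz {n : ℕ} (hn : 0 < n) {f : Fin n → Vec m → ℝ} {L : ℝ}
    (hL : 0 < L) (hc : ∀ i, ConvexOn ℝ Set.univ (f i)) (hd : ∀ i, Differentiable ℝ (f i))
    (hs : IsSmooth L (globalObjective f)) (i : Fin n) (x y : Vec m) :
    ‖gradient (f i) x - gradient (f i) y‖ ≤ n * L * ‖x - y‖ := by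
  have hn' : (0 : ℝ) < n := Nat.cast_pos.2 hn
  refine gradient_lipschitz_of_bregman_le (by positivity)
    (convexOn_gradient_le (hc i) (hd i)) (fun x y => ?_) x y
  have h1 := hs.le_quadratic x y
  rw [gradient_globalObjective hd, inner_smul_left, sum_inner] at h1
  simp only [globalObjective, conj_trivial] at h1
  have h2 : ∑ j, (f j x - (f j y + inner ℝ (gradient (f j) y) (x - y))) ≤
      n * L / 2 * ‖x - y‖ ^ 2 := by
    rw [Finset.sum_sub_distrib, Finset.sum_add_distrib]
    have h3 := mul_le_mul_of_nonneg_left h1 hn'.le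
    have e : (n : ℝ) * (1 / (n : ℝ)) = 1 := by field_simp
    rw [mul_add, mul_add, ← mul_assoc, ← mul_assoc, ← mul_assoc, e] at h3
    linarith
  have h4 := Finset.single_le_sum
    (f := fun j => f j x - (f j y + inner ℝ (gradient (f j) y) (x - y)))
    (fun j _ => sub_nonneg.2 (convexOn_gradient_le (hc j) (hd j) x y)) (Finset.mem_univ i)
  linarith

theorem gradient_eq_zero_of_forall_le {h : Vec m → ℝ} {xs : Vec m} (hmin : ∀ x, h xs ≤ h x) :
    gradient h xs = 0 := by
  have : IsLocalMin h xs := Filter.Eventually.of_forall hmin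
  simp [gradient, this.fderiv_eq_zero]

theorem IsSmooth.gradient_sq_le {L : ℝ} (hL : 0 < L) {h : Vec m → ℝ} (hs : IsSmooth L h)
    {xs : Vec m} (hmin : ∀ x, h xs ≤ h x) (x : Vec m) :
    ‖gradient h x‖ ^ 2 ≤ 2 * L * (h x - h xs) := by
  have h1 := hs.le_quadratic (x - L⁻¹ • gradient h x) x
  have h2 := hmin (x - L⁻¹ • gradient h x)
  have e1 : x - L⁻¹ • gradient h x - x = -(L⁻¹ • gradient h x) := by abel
  rw [e1, norm_neg, norm_smul, inner_neg_right, inner_smul_right, Real.norm_of_nonneg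
    (inv_nonneg.2 hL.le), real_inner_self_eq_norm_sq] at h1
  have e5 : -(L⁻¹ * ‖gradient h x‖ ^ 2) + L / 2 * (L⁻¹ * ‖gradient h x‖) ^ 2
      = -(‖gradient h x‖ ^ 2 / (2 * L)) := by
    field_simp; ring
  have h6 : ‖gradient h x‖ ^ 2 / (2 * L) ≤ h x - h xs := by linarith
  rwa [div_le_iff₀ (by positivity), mul_comm] at h6

/-- The suboptimality at a point in terms of that at a nearby point. -/
theorem IsSmooth.sub_min_le {L : ℝ} (hL : 0 < L) {h : Vec m → ℝ} (hs : IsSmooth L h)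
    {xs : Vec m} (hmin : ∀ x, h xs ≤ h x) (x y : Vec m) :
    h x - h xs ≤ 2 * (h y - h xs) + L * ‖x - y‖ ^ 2 := by
  have h1 := hs.le_quadratic x y
  have h2 := hs.gradient_sq_le hL hmin y
  have h3 := real_inner_le_norm (gradient h y) (x - y)
  have h4 : ‖gradient h y‖ * ‖x - y‖ ≤ ‖gradient h y‖ ^ 2 / (2 * L) + L / 2 * ‖x - y‖ ^ 2 := by
    have := sq_nonneg (‖gradient h y‖ - L * ‖x - y‖)
    rw [← sub_nonneg]
    have e : ‖gradient h y‖ ^ 2 / (2 * L) + L / 2 * ‖x - y‖ ^ 2 - ‖gradient h y‖ * ‖x - y‖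
      = (‖gradient h y‖ - L * ‖x - y‖) ^ 2 / (2 * L) := by field_simp; ring
    rw [e]; positivity
  have h5 : ‖gradient h y‖ ^ 2 / (2 * L) ≤ h y - h xs := by
    rwa [div_le_iff₀ (by positivity), mul_comm]
  linarith

theorem IsStronglyConvex.sq_dist_le {μ : ℝ} {h : Vec m → ℝ} (hs : IsStronglyConvex μ h)
    {xs : Vec m} (hmin : ∀ x, h xs ≤ h x) (x : Vec m) :
    μ / 2 * ‖x - xs‖ ^ 2 ≤ h x - h xs := by
  have := hs.2 xs x
  rw [gradient_eq_zero_of_forall_le hmin, inner_zero_left] at this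
  linarith

end Calculus

/-! ### One step of Nesterov's method with an inexact gradient. -/

section InexactNesterov

variable {m : ℕ}

theorem norm_sq_convex_comb_le {F : Type*} [NormedAddCommGroup F] [InnerProductSpace ℝ F]
    {t : ℝ} (h0 : 0 ≤ t) (h1 : t ≤ 1) (u v : F) :
    ‖(1 - t) • u + t • v‖ ^ 2 ≤ (1 - t) * ‖u‖ ^ 2 + t * ‖v‖ ^ 2 := by
  have h2 : ‖(1 - t) • u + t • v‖ ^ 2 =
      (1 - t) * ‖u‖ ^ 2 + t * ‖v‖ ^ 2 - (1 - t) * t * ‖u - v‖ ^ 2 := by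
    rw [norm_add_sq_real, norm_sub_sq_real, inner_smul_left, inner_smul_right, norm_smul,
      norm_smul, mul_pow, mul_pow, Real.norm_eq_abs, Real.norm_eq_abs, sq_abs, sq_abs]
    simp only [conj_trivial]
    ring
  rw [h2]
  have : 0 ≤ (1 - t) * t * ‖u - v‖ ^ 2 := by
    have := sub_nonneg.2 h1
    positivity
  linarith

/-- With the exact gradient the Lyapunov function contracts by `1 - α`. The error enters through a
single inner product with the new auxiliary point; Young's inequality pays for it with half of the
contraction. -/
theorem inexact_nesterov_step {L μ α : ℝ} (hμ : 0 < μ) (hL : 0 < L) (hα : 0 < α) (hα1 : α ≤ 1)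
    (hαL : α ^ 2 * L = μ) {h : Vec m → ℝ} (hs : IsSmooth L h) (hsc : IsStronglyConvex μ h)
    {xs : Vec m} (x y z g : Vec m) (hz : α • z = (1 + α) • y - x)
    (hmin : ∀ x, h xs ≤ h x) :
    (h (y - L⁻¹ • g) - h xs) +
        μ / 2 * ‖(1 - α) • z + α • y - (α / μ) • g - xs‖ ^ 2 ≤
      (1 - α / 2) * ((h x - h xs) + μ / 2 * ‖z - xs‖ ^ 2) +
        2 * α / μ * ‖g - gradient h y‖ ^ 2 := by
  set G := gradient h y with hG
  set w := (1 - α) • (z - xs) + α • (y - xs) with hw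
  have hz' : (1 - α) • z + α • y - (α / μ) • g - xs = w - (α / μ) • g := by
    rw [hw]; module
  rw [hz']
  set z' := w - (α / μ) • g with hz'd
  have hLα : α ^ 2 / μ = L⁻¹ := by rw [← hαL]; field_simp
  have I1 : h (y - L⁻¹ • g) ≤ h y - L⁻¹ * inner ℝ G g + L⁻¹ / 2 * ‖g‖ ^ 2 := by
    have := hs.le_quadratic (y - L⁻¹ • g) y
    have e1 : y - L⁻¹ • g - y = -(L⁻¹ • g) := by abel
    rw [e1, norm_neg, norm_smul, inner_neg_right, inner_smul_right, Real.norm_of_nonneg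
      (inv_nonneg.2 hL.le)] at this
    have e2 : L / 2 * (L⁻¹ * ‖g‖) ^ 2 = L⁻¹ / 2 * ‖g‖ ^ 2 := by field_simp
    linarith
  have I2 := hsc.2 y xs
  have I3 := hsc.2 y x
  have I3' : h y + inner ℝ G (x - y) ≤ h x := by
    have : 0 ≤ μ / 2 * ‖x - y‖ ^ 2 := by positivity
    linarith
  have I4 : ‖w‖ ^ 2 ≤ (1 - α) * ‖z - xs‖ ^ 2 + α * ‖y - xs‖ ^ 2 :=
    norm_sq_convex_comb_le hα.le hα1 _ _
  have I5 : α * inner ℝ G w = -((1 - α) * inner ℝ G (x - y)) - α * inner ℝ G (xs - y) := by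
    have : α • w = -((1 - α) • (x - y)) - α • (xs - y) := by
      have e : α • w = (1 - α) • (α • z) - ((1 - α) * α) • xs + (α * α) • (y - xs) := by
        rw [hw]; module
      rw [e, hz]; module
    have e2 := congrArg (fun v => inner ℝ G v) this
    simpa only [inner_smul_right, inner_sub_right, inner_neg_right] using e2
  have I6 : ‖z'‖ ^ 2 = ‖w‖ ^ 2 - 2 * (α / μ) * inner ℝ g w + (α / μ) ^ 2 * ‖g‖ ^ 2 := by
    rw [hz'd, norm_sub_sq_real, inner_smul_right, norm_smul, mul_pow, Real.norm_eq_abs, sq_abs,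
      real_inner_comm]
    ring
  have I7 : α * inner ℝ (g - G) z' =
      α * inner ℝ g w - α * inner ℝ G w - L⁻¹ * ‖g‖ ^ 2 + L⁻¹ * inner ℝ G g := by
    rw [hz'd, inner_sub_right, inner_smul_right, inner_sub_left, inner_sub_left,
      real_inner_self_eq_norm_sq, ← hLα]
    ring
  -- Young's inequality, weighted so that the second term is the fraction `α / 2` of the new
  -- Lyapunov function.
  have I8 : -(α * inner ℝ (g - G) z') ≤ α / μ * ‖g - G‖ ^ 2 + α / 2 * (μ / 2 * ‖z'‖ ^ 2) := by
    have h1 := abs_le.1 (abs_real_inner_le_norm (g - G) z')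
    have h2 : α / μ * ‖g - G‖ ^ 2 + α / 2 * (μ / 2 * ‖z'‖ ^ 2) - α * (‖g - G‖ * ‖z'‖)
        = α / μ * (‖g - G‖ - μ / 2 * ‖z'‖) ^ 2 := by field_simp; ring
    have h3 : 0 ≤ α / μ * (‖g - G‖ - μ / 2 * ‖z'‖) ^ 2 := by positivity
    nlinarith
  have e1 : μ / 2 * ‖z'‖ ^ 2 = μ / 2 * ‖w‖ ^ 2 - α * inner ℝ g w + L⁻¹ / 2 * ‖g‖ ^ 2 := by
    rw [I6, ← hLα]; field_simp
  have J2 := mul_le_mul_of_nonneg_left I2 hα.le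
  have J3 := mul_le_mul_of_nonneg_left I3' (sub_nonneg.2 hα1)
  have J4 := mul_le_mul_of_nonneg_left I4 (by positivity : 0 ≤ μ / 2)
  rw [← hG, norm_sub_rev xs y] at J2
  -- Since `α ^ 2 / μ = L⁻¹`, the terms in `‖g‖ ^ 2` and `inner ℝ G g` match those hidden in the
  -- inner product with `z'`.
  have main : (h (y - L⁻¹ • g) - h xs) + μ / 2 * ‖z'‖ ^ 2 ≤
      (1 - α) * ((h x - h xs) + μ / 2 * ‖z - xs‖ ^ 2) - α * inner ℝ (g - G) z' := by
    rw [e1, I7]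
    linarith
  have hX : 0 ≤ h (y - L⁻¹ • g) - h xs := sub_nonneg.2 (hmin _)
  have hΦ0 : 0 ≤ (h x - h xs) + μ / 2 * ‖z - xs‖ ^ 2 := by
    have : 0 ≤ h x - h xs := sub_nonneg.2 (hmin _)
    positivity
  generalize h (y - L⁻¹ • g) - h xs = X at *
  generalize (h x - h xs) + μ / 2 * ‖z - xs‖ ^ 2 = Φ at *
  set D := α / μ * ‖g - G‖ ^ 2 with hD
  have hD0 : 0 ≤ D := by positivity
  have hP : 0 ≤ X + μ / 2 * ‖z'‖ ^ 2 := by positivity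
  have k1 : (1 - α / 2) * (X + μ / 2 * ‖z'‖ ^ 2) ≤ (1 - α) * Φ + D := by
    have := mul_nonneg (half_pos hα).le hX
    linarith
  -- Uses `1 - α ≤ (1 - α / 2) ^ 2` and `1 ≤ 2 * (1 - α / 2)`, after which the factor `1 - α / 2`
  -- cancels.
  have k2 : (1 - α / 2) * (X + μ / 2 * ‖z'‖ ^ 2) ≤ (1 - α / 2) * ((1 - α / 2) * Φ + 2 * D) := by
    have h1 := mul_nonneg (sq_nonneg α) hΦ0
    have h2 := mul_nonneg (sub_nonneg.2 hα1) hD0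
    linarith
  have k3 := le_of_mul_le_mul_left k2 (by linarith)
  refine k3.trans (le_of_eq ?_)
  rw [hD]; ring

end InexactNesterov

/-- The Euclidean space of `n` stacked vectors of `ℝᵐ`. -/
abbrev Stack (n m : ℕ) := PiLp 2 fun _ : Fin n => Vec m

/-- Stacking the node variables. -/
def stack {n m : ℕ} : (Fin n → Vec m) ≃ₗ[ℝ] Stack n m :=
  (WithLp.linearEquiv 2 ℝ (Fin n → Vec m)).symm

/-- The average of the node variables. -/
def nodeMean {n m : ℕ} : (Fin n → Vec m) →ₗ[ℝ] Vec m :=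
  (n : ℝ)⁻¹ • ∑ i, LinearMap.proj i

/-- The deviation of the node variables from their average. -/
def dev {n m : ℕ} : (Fin n → Vec m) →ₗ[ℝ] (Fin n → Vec m) :=
  LinearMap.id - LinearMap.pi fun _ => nodeMean

/-! ### Stacked vectors, their mean and their deviation. -/

section Stack

variable {n m : ℕ}

@[simp] theorem stack_apply (x : Fin n → Vec m) (i : Fin n) : stack x i = x i := rfl

theorem norm_stack_sq (x : Fin n → Vec m) : ‖stack x‖ ^ 2 = ∑ i, ‖x i‖ ^ 2 :=
  PiLp.norm_sq_eq_of_L2 _ _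

theorem inner_stack (x y : Fin n → Vec m) : inner ℝ (stack x) (stack y) = ∑ i, inner ℝ (x i) (y i) :=
  PiLp.inner_apply _ _

theorem norm_apply_le_norm_stack (x : Fin n → Vec m) (i : Fin n) : ‖x i‖ ≤ ‖stack x‖ :=
  PiLp.norm_apply_le (stack x) i

theorem nodeMean_apply (x : Fin n → Vec m) : nodeMean x = (n : ℝ)⁻¹ • ∑ i, x i := by
  simp [nodeMean]

theorem dev_apply (x : Fin n → Vec m) (i : Fin n) : dev x i = x i - nodeMean x := by
  simp [dev]

theorem nodeMean_const (hn : 0 < n) (a : Vec m) : nodeMean (fun _ : Fin n => a) = a := by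
  have : (n : ℝ) ≠ 0 := Nat.cast_ne_zero.2 hn.ne'
  rw [nodeMean_apply, Finset.sum_const, Finset.card_univ, Fintype.card_fin, ← Nat.cast_smul_eq_nsmul ℝ,
    smul_smul, inv_mul_cancel₀ this, one_smul]

theorem dev_const (hn : 0 < n) (a : Vec m) : dev (fun _ : Fin n => a) = 0 := by
  ext1 i
  rw [dev_apply, nodeMean_const hn, sub_self, Pi.zero_apply]

theorem dev_eq_sub (x : Fin n → Vec m) : dev x = x - fun _ => nodeMean x := by
  ext1 i; rw [dev_apply, Pi.sub_apply]

theorem nodeMean_dev (hn : 0 < n) (x : Fin n → Vec m) : nodeMean (dev x) = 0 := by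
  rw [dev_eq_sub, map_sub, nodeMean_const hn, sub_self]

theorem norm_stack_dev_le (hn : 0 < n) (x : Fin n → Vec m) : ‖stack (dev x)‖ ≤ ‖stack x‖ := by
  have h : inner ℝ (stack (dev x)) (stack fun _ => nodeMean x) = 0 := by
    rw [inner_stack, ← sum_inner]
    have : ∑ i, dev x i = 0 := by
      have h1 := nodeMean_dev hn x
      rw [nodeMean_apply] at h1
      exact (smul_eq_zero.1 h1).resolve_left (by positivity)
    rw [this, inner_zero_left]
  have h2 : stack x = stack (dev x) + stack fun _ => nodeMean x := by
    rw [← map_add, dev_eq_sub, sub_add_cancel]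
  rw [h2]
  refine le_of_sq_le_sq ?_ (norm_nonneg _)
  rw [norm_add_sq_real, h]
  nlinarith [sq_nonneg ‖stack fun _ : Fin n => nodeMean x‖]

end Stack

/-! ### Deterministic analysis of the outer loop. -/

section Outer

variable {n m : ℕ} {f : Fin n → Vec m → ℝ} {μ L α η : ℝ} {x₀ xs : Vec m}
  {x y v : ℕ → Fin n → Vec m}

/-- All nodes start at the same point and the recursion is linear, so the deviations of the iterates
are driven only by those of the consensus outputs. As `η ≤ 1`, the momentum term grows by at most
one new error per iteration, and summing the momenta gives the factor `k`. -/
theorem norm_dev_agd_le (hn : 0 < n) (hL : 0 < L) (hη0 : 0 ≤ η) (hη1 : η ≤ 1)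
    (hx0 : x 0 = fun _ => x₀) (hy0 : y 0 = fun _ => x₀)
    (hx : ∀ k, x (k + 1) = y k - (1 / L) • v k)
    (hy : ∀ k, y (k + 1) = x (k + 1) + η • (x (k + 1) - x k)) (k : ℕ) :
    ‖stack (dev (y k)) - stack (dev (x k))‖ ≤ (∑ j ∈ Finset.range k, ‖stack (dev (v j))‖) / L ∧
      ‖stack (dev (x k))‖ ≤ k * (∑ j ∈ Finset.range k, ‖stack (dev (v j))‖) / L := by
  induction k with
  | zero => simp [hx0, hy0, dev_const hn]
  | succ k ih =>
    obtain ⟨h1, h2⟩ := ih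
    have hS : 0 ≤ ∑ j ∈ Finset.range k, ‖stack (dev (v j))‖ :=
      Finset.sum_nonneg fun _ _ => norm_nonneg _
    rw [Finset.sum_range_succ]
    set s := ∑ j ∈ Finset.range k, ‖stack (dev (v j))‖
    have hu : ‖stack (dev (x (k + 1))) - stack (dev (x k))‖ ≤ (s + ‖stack (dev (v k))‖) / L := by
      rw [hx k, map_sub, map_sub, map_smul, map_smul, sub_right_comm]
      refine (norm_sub_le _ _).trans ?_
      rw [norm_smul, Real.norm_of_nonneg (by positivity), add_div]
      refine add_le_add h1 (le_of_eq (by ring))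
    constructor
    · rw [hy k, map_add, map_add, add_sub_cancel_left, map_smul, map_smul, map_sub, map_sub,
        norm_smul, Real.norm_of_nonneg hη0]
      exact (mul_le_of_le_one_left (norm_nonneg _) hη1).trans hu
    · have e : stack (dev (x (k + 1))) =
          (stack (dev (x (k + 1))) - stack (dev (x k))) + stack (dev (x k)) := by abel
      rw [e]
      refine (norm_add_le _ _).trans ((add_le_add hu h2).trans ?_)
      rw [← add_div]
      gcongr
      have : 0 ≤ (k : ℝ) * ‖stack (dev (v k))‖ := by positivity
      push_cast
      linarith

theorem norm_dev_agd_extrapolated_le (hn : 0 < n) (hL : 0 < L) (hη0 : 0 ≤ η) (hη1 : η ≤ 1)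
    (hx0 : x 0 = fun _ => x₀) (hy0 : y 0 = fun _ => x₀)
    (hx : ∀ k, x (k + 1) = y k - (1 / L) • v k)
    (hy : ∀ k, y (k + 1) = x (k + 1) + η • (x (k + 1) - x k)) (k : ℕ) :
    ‖stack (dev (y k))‖ ≤ (k + 1) * (∑ j ∈ Finset.range k, ‖stack (dev (v j))‖) / L := by
  obtain ⟨h1, h2⟩ := norm_dev_agd_le hn hL hη0 hη1 hx0 hy0 hx hy k
  have e : stack (dev (y k)) = (stack (dev (y k)) - stack (dev (x k))) + stack (dev (x k)) := by abel
  rw [e]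
  refine (norm_add_le _ _).trans ((add_le_add h1 h2).trans (le_of_eq (by ring)))

/-- The inexactness of the gradient seen by the averaged method: the local gradients are taken at
the `y i` rather than at their mean, and the Lipschitz constant `n * L` of a component is offset by
the `1 / n` of the average. -/
theorem norm_gradient_mean_error_sq_le (hn : 0 < n) (hL : 0 < L)
    (hc : ∀ i, ConvexOn ℝ Set.univ (f i)) (hd : ∀ i, Differentiable ℝ (f i))
    (hs : IsSmooth L (globalObjective f)) (y : Fin n → Vec m) :
    ‖nodeMean (fun i => gradient (f i) (y i)) - gradient (globalObjective f) (nodeMean y)‖ ^ 2 ≤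
      n * L ^ 2 * ‖stack (dev y)‖ ^ 2 := by
  have hn' : (0 : ℝ) < n := Nat.cast_pos.2 hn
  have h1 : ‖nodeMean (fun i => gradient (f i) (y i)) - gradient (globalObjective f) (nodeMean y)‖ ≤
      L * ∑ i, ‖dev y i‖ := by
    rw [gradient_globalObjective hd, nodeMean_apply, one_div, ← smul_sub, ← Finset.sum_sub_distrib,
      norm_smul, Real.norm_of_nonneg (by positivity), inv_mul_le_iff₀ hn', Finset.mul_sum,
      Finset.mul_sum]
    refine norm_sum_le_of_le _ fun i _ => ?_
    rw [dev_apply, ← mul_assoc]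
    exact gradient_component_lipschitz hn hL hc hd hs i _ _
  calc _ ≤ (L * ∑ i, ‖dev y i‖) ^ 2 := by gcongr
    _ = L ^ 2 * (∑ i, ‖dev y i‖) ^ 2 := by ring
    _ ≤ L ^ 2 * (n * ∑ i, ‖dev y i‖ ^ 2) := by
      gcongr
      simpa using sq_sum_le_card_mul_sum_sq (s := Finset.univ) (f := fun i => ‖dev y i‖)
    _ = _ := by rw [norm_stack_sq]; ring

/-- The Lyapunov function of Nesterov's method at the points `x` and `y`. -/
def nesterovLyapunov (h : Vec m → ℝ) (μ α : ℝ) (xs x y : Vec m) : ℝ :=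
  (h x - h xs) + μ / 2 * ‖y + α⁻¹ • (y - x) - xs‖ ^ 2

/-- The inexact step is iterated. The gradient error at iteration `k` is bounded through the
accumulated deviations, which are monotone in `k`, so the geometric sum of errors loses only a
factor `2 / α`. -/
theorem nesterovLyapunov_agd_le (hn : 0 < n) (hμ : 0 < μ) (hL : 0 < L) (hα : 0 < α) (hα1 : α ≤ 1)
    (hαL : α ^ 2 * L = μ) (hη : η = (1 - α) / (1 + α))
    (hc : ∀ i, ConvexOn ℝ Set.univ (f i)) (hd : ∀ i, Differentiable ℝ (f i))
    (hsc : IsStronglyConvex μ (globalObjective f)) (hs : IsSmooth L (globalObjective f))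
    (hmin : ∀ x, globalObjective f xs ≤ globalObjective f x)
    (hx0 : x 0 = fun _ => x₀) (hy0 : y 0 = fun _ => x₀)
    (hx : ∀ k, x (k + 1) = y k - (1 / L) • v k)
    (hy : ∀ k, y (k + 1) = x (k + 1) + η • (x (k + 1) - x k))
    (hv : ∀ k, nodeMean (v k) = nodeMean fun i => gradient (f i) (y k i)) (k : ℕ) :
    nesterovLyapunov (globalObjective f) μ α xs (nodeMean (x k)) (nodeMean (y k)) ≤
      (1 - α / 2) ^ k * (2 * (globalObjective f x₀ - globalObjective f xs)) +
        4 * n / μ * k ^ 2 * (∑ j ∈ Finset.range k, ‖stack (dev (v j))‖) ^ 2 := by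
  have hη0 : 0 ≤ η := by rw [hη]; exact div_nonneg (by linarith) (by linarith)
  have hη1 : η ≤ 1 := by rw [hη, div_le_one (by linarith)]; linarith
  induction k with
  | zero =>
    have := hsc.sq_dist_le hmin x₀
    simp [nesterovLyapunov, hx0, hy0, nodeMean_const hn]
    linarith
  | succ k ih =>
    have hS : 0 ≤ ∑ j ∈ Finset.range k, ‖stack (dev (v j))‖ :=
      Finset.sum_nonneg fun _ _ => norm_nonneg _
    have hD := norm_dev_agd_extrapolated_le hn hL hη0 hη1 hx0 hy0 hx hy k
    have hE := norm_gradient_mean_error_sq_le hn hL hc hd hs (y k)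
    have hstep := inexact_nesterov_step hμ hL hα hα1 hαL hs hsc (nodeMean (x k)) (nodeMean (y k))
      (nodeMean (y k) + α⁻¹ • (nodeMean (y k) - nodeMean (x k))) (nodeMean (v k))
      (by rw [smul_add, smul_smul, mul_inv_cancel₀ hα.ne']; module) hmin
    have ex : nodeMean (x (k + 1)) = nodeMean (y k) - L⁻¹ • nodeMean (v k) := by
      rw [hx, map_sub, map_smul, one_div]
    -- The momentum coefficient `(1 - α) / (1 + α)` is the one for which `y + α⁻¹ • (y - x)` obeys
    -- the update of the auxiliary point in `inexact_nesterov_step`.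
    have ez : nodeMean (y (k + 1)) + α⁻¹ • (nodeMean (y (k + 1)) - nodeMean (x (k + 1))) =
        (1 - α) • (nodeMean (y k) + α⁻¹ • (nodeMean (y k) - nodeMean (x k))) +
          α • nodeMean (y k) - (α / μ) • nodeMean (v k) := by
      rw [hy, map_add, map_smul, map_sub, ex, hη, ← hαL]
      match_scalars <;> field_simp <;> ring
    rw [nesterovLyapunov, ez, ex]
    refine hstep.trans ?_
    rw [nesterovLyapunov] at ih
    rw [Finset.sum_range_succ]
    set s := ∑ j ∈ Finset.range k, ‖stack (dev (v j))‖
    have hs' : s ≤ s + ‖stack (dev (v k))‖ := le_add_of_nonneg_right (norm_nonneg _)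
    have hD2 : ‖stack (dev (y k))‖ ^ 2 ≤ ((k + 1) * s / L) ^ 2 := by gcongr
    have hE2 : ‖nodeMean (v k) - gradient (globalObjective f) (nodeMean (y k))‖ ^ 2 ≤
        n * ((k + 1) ^ 2 * (s + ‖stack (dev (v k))‖) ^ 2) := by
      rw [hv]
      refine hE.trans ?_
      calc n * L ^ 2 * ‖stack (dev (y k))‖ ^ 2 ≤ n * L ^ 2 * ((k + 1) * s / L) ^ 2 := by gcongr
        _ = n * ((k + 1) ^ 2 * s ^ 2) := by field_simp
        _ ≤ _ := by gcongr
    have ha : 0 ≤ 1 - α / 2 := by linarith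
    have hk : (k : ℝ) ^ 2 * s ^ 2 ≤ (k + 1) ^ 2 * (s + ‖stack (dev (v k))‖) ^ 2 := by
      gcongr; linarith
    have hih := mul_le_mul_of_nonneg_left ih ha
    have hE3 := mul_le_mul_of_nonneg_left hE2 (by positivity : 0 ≤ 2 * α / μ)
    have hk2 := mul_le_mul_of_nonneg_left hk (by positivity : 0 ≤ (1 - α / 2) * (4 * n / μ))
    push_cast
    set A := ((k : ℝ) + 1) ^ 2 * (s + ‖stack (dev (v k))‖) ^ 2 with hA
    -- The constant `4 * n / μ` is the fixed point of `t ↦ (1 - α / 2) * t + 2 * α * n / μ`.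
    have e1 : (1 - α / 2) ^ (k + 1) * (2 * (globalObjective f x₀ - globalObjective f xs)) +
        4 * n / μ * ((k : ℝ) + 1) ^ 2 * (s + ‖stack (dev (v k))‖) ^ 2 =
        (1 - α / 2) * ((1 - α / 2) ^ k * (2 * (globalObjective f x₀ - globalObjective f xs))) +
        ((1 - α / 2) * (4 * n / μ) * A + 2 * α / μ * (n * A)) := by
      rw [hA]; ring
    rw [e1]
    have e2 : (1 - α / 2) * ((1 - α / 2) ^ k * (2 * (globalObjective f x₀ - globalObjective f xs)) +
        4 * n / μ * k ^ 2 * s ^ 2) =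
        (1 - α / 2) * ((1 - α / 2) ^ k * (2 * (globalObjective f x₀ - globalObjective f xs))) +
        (1 - α / 2) * (4 * n / μ) * (k ^ 2 * s ^ 2) := by ring
    rw [e2] at hih
    linarith

/-- The point `y` is a convex combination of `x` and the auxiliary point, and the Lyapunov function
controls the distance of both to the minimizer. -/
theorem norm_sub_sq_le_nesterovLyapunov (hμ : 0 < μ) (hα : 0 < α) {h : Vec m → ℝ}
    (hsc : IsStronglyConvex μ h) (hmin : ∀ x, h xs ≤ h x) (x y : Vec m) :
    ‖y - xs‖ ^ 2 ≤ 2 / μ * nesterovLyapunov h μ α xs x y := by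
  set z := y + α⁻¹ • (y - x) with hz
  have e : y - xs = (1 - α / (1 + α)) • (x - xs) + (α / (1 + α)) • (z - xs) := by
    rw [hz]
    match_scalars <;> field_simp <;> ring
  have h1 := norm_sq_convex_comb_le (t := α / (1 + α)) (by positivity)
    (by rw [div_le_one (by linarith)]; linarith) (x - xs) (z - xs)
  rw [← e] at h1
  have h2 := hsc.sq_dist_le hmin x
  have h3 : α / (1 + α) ≤ 1 := by rw [div_le_one (by linarith)]; linarith
  have h4 : 0 ≤ α / (1 + α) := by positivity
  have h5 : ‖y - xs‖ ^ 2 ≤ ‖x - xs‖ ^ 2 + ‖z - xs‖ ^ 2 := by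
    nlinarith [sq_nonneg ‖x - xs‖, sq_nonneg ‖z - xs‖]
  refine h5.trans ?_
  rw [nesterovLyapunov, ← hz, mul_add]
  have e2 : 2 / μ * (μ / 2 * ‖z - xs‖ ^ 2) = ‖z - xs‖ ^ 2 := by field_simp
  rw [e2]
  have h6 := mul_le_mul_of_nonneg_left h2 (by positivity : 0 ≤ 2 / μ)
  have e3 : 2 / μ * (μ / 2 * ‖x - xs‖ ^ 2) = ‖x - xs‖ ^ 2 := by field_simp
  linarith

/-- Bounds the input of a consensus run: the local gradients do not vanish at the optimum, which is
why the gradients at `xs` enter the complexity. -/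
theorem sum_gradient_sq_le (hn : 0 < n) (hL : 0 < L)
    (hc : ∀ i, ConvexOn ℝ Set.univ (f i)) (hd : ∀ i, Differentiable ℝ (f i))
    (hs : IsSmooth L (globalObjective f)) (y : Fin n → Vec m) (xs : Vec m) :
    ‖stack fun i => gradient (f i) (y i)‖ ^ 2 ≤ 2 * ∑ i, ‖gradient (f i) xs‖ ^ 2 +
      4 * n ^ 2 * L ^ 2 * ‖stack (dev y)‖ ^ 2 + 4 * n ^ 3 * L ^ 2 * ‖nodeMean y - xs‖ ^ 2 := by
  have h2 : ∀ i, ‖gradient (f i) (y i)‖ ^ 2 ≤ 2 * ‖gradient (f i) xs‖ ^ 2 +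
      4 * n ^ 2 * L ^ 2 * ‖dev y i‖ ^ 2 + 4 * n ^ 2 * L ^ 2 * ‖nodeMean y - xs‖ ^ 2 := by
    intro i
    have a1 := gradient_component_lipschitz hn hL hc hd hs i (y i) xs
    have a2 : ‖y i - xs‖ ≤ ‖dev y i‖ + ‖nodeMean y - xs‖ := by
      have e : y i - xs = dev y i + (nodeMean y - xs) := by rw [dev_apply]; abel
      rw [e]; exact norm_add_le _ _
    have a3 : ‖gradient (f i) (y i)‖ ≤ ‖gradient (f i) xs‖ +
        n * L * (‖dev y i‖ + ‖nodeMean y - xs‖) := by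
      have e : gradient (f i) (y i) = gradient (f i) xs +
        (gradient (f i) (y i) - gradient (f i) xs) := by abel
      rw [e]
      refine (norm_add_le _ _).trans (add_le_add le_rfl (a1.trans ?_))
      gcongr
    calc ‖gradient (f i) (y i)‖ ^ 2 ≤ (‖gradient (f i) xs‖ +
        n * L * (‖dev y i‖ + ‖nodeMean y - xs‖)) ^ 2 := by gcongr
      _ ≤ 2 * (‖gradient (f i) xs‖ ^ 2 + (n * L * (‖dev y i‖ + ‖nodeMean y - xs‖)) ^ 2) :=
        add_sq_le
      _ = 2 * ‖gradient (f i) xs‖ ^ 2 +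
          2 * (n ^ 2 * L ^ 2) * (‖dev y i‖ + ‖nodeMean y - xs‖) ^ 2 := by ring
      _ ≤ 2 * ‖gradient (f i) xs‖ ^ 2 +
          2 * (n ^ 2 * L ^ 2) * (2 * (‖dev y i‖ ^ 2 + ‖nodeMean y - xs‖ ^ 2)) := by
        gcongr; exact add_sq_le
      _ = _ := by ring
  rw [norm_stack_sq, norm_stack_sq]
  refine (Finset.sum_le_sum fun i _ => h2 i).trans (le_of_eq ?_)
  rw [Finset.sum_add_distrib, Finset.sum_add_distrib, ← Finset.mul_sum, ← Finset.mul_sum,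
    Finset.sum_const, Finset.card_univ, Fintype.card_fin, nsmul_eq_mul]
  ring

end Outer

/-! ### Accelerated consensus as a perturbed linear iteration. -/

section Lyapunov

variable {E : Type*} [NormedAddCommGroup E] [InnerProductSpace ℝ E]

/-- The Lyapunov function of accelerated consensus. -/
def consensusLyapunov (A : E →ₗ[ℝ] E) (l : ℝ) (x xf : E) : ℝ :=
  ‖x‖ ^ 2 + 12 / l * inner ℝ (A xf) xf

variable {A : E →ₗ[ℝ] E} {l lmax β : ℝ}

/-- Nesterov's argument for the quadratic `inner ℝ (A x) x`: the relation `hxg` exchanges the mixed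
term with `w` for terms with `xg` and `xf`, convexity of the quadratic removes the one with `xf`,
and the spectral gap `l` absorbs `β * ‖xg‖ ^ 2`. -/
theorem consensusLyapunov_step_le (hA : A.IsSymmetric) (hpos : ∀ x, 0 ≤ inner ℝ (A x) x)
    (hmax : ∀ x, inner ℝ (A x) x ≤ lmax * ‖x‖ ^ 2) (hl : 0 < l) (hβ : 0 < β) (hβ1 : β ≤ 1)
    (hβl : lmax * β ^ 2 ≤ l / 12) {x xf xg : E} (hlow : l * ‖xg‖ ^ 2 ≤ inner ℝ (A xg) xg)
    (hxg : (1 - β ^ 2 / 4) • xg = (1 - β / 4) • xf + (β / 4 * (1 - β)) • x) :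
    consensusLyapunov A l ((1 - β) • x + β • xg - (3 * β / l) • A xg)
        (xg - (3 * β ^ 2 / l) • A xg) ≤ (1 - β / 4) * consensusLyapunov A l x xf := by
  set g := A xg with hg
  set w := (1 - β) • x + β • xg with hw
  have F1 : ‖w‖ ^ 2 ≤ (1 - β) * ‖x‖ ^ 2 + β * ‖xg‖ ^ 2 := norm_sq_convex_comb_le hβ.le hβ1 _ _
  have F2 : ‖w - (3 * β / l) • g‖ ^ 2 =
      ‖w‖ ^ 2 - 6 / l * (β * inner ℝ g w) + 9 * β ^ 2 / l ^ 2 * ‖g‖ ^ 2 := by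
    rw [norm_sub_sq_real, inner_smul_right, norm_smul, mul_pow, Real.norm_eq_abs, sq_abs,
      real_inner_comm]
    ring
  have F3 : β * inner ℝ g w = 4 * inner ℝ g xg - (4 - β) * inner ℝ g xf := by
    have e : β • w = (4 : ℝ) • xg - (4 - β) • xf := by
      have : β • w = (4 : ℝ) • ((1 - β ^ 2 / 4) • xg) - (4 - β) • xf + β ^ 2 • xg := by
        rw [hxg, hw]; module
      rw [this]; module
    have e2 := congrArg (fun v => inner ℝ g v) e
    simpa only [inner_smul_right, inner_sub_right] using e2
  -- Positivity of `A` at `xf - xg`, that is, convexity of the quadratic between the two points.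
  have F4 : 0 ≤ inner ℝ (A xf) xf - 2 * inner ℝ g xf + inner ℝ g xg := by
    have h1 := hpos (xf - xg)
    have h2 : inner ℝ (A xf) xg = inner ℝ g xf := by
      rw [hA xf xg, real_inner_comm]
    rw [map_sub, inner_sub_left, inner_sub_right, inner_sub_right, h2, ← hg] at h1
    linarith
  have F6 : inner ℝ (A (xg - (3 * β ^ 2 / l) • g)) (xg - (3 * β ^ 2 / l) • g) =
      inner ℝ g xg - 6 * β ^ 2 / l * ‖g‖ ^ 2 + 9 * β ^ 4 / l ^ 2 * inner ℝ (A g) g := by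
    have h2 : inner ℝ (A g) xg = ‖g‖ ^ 2 := by
      rw [hA g xg, ← hg, real_inner_self_eq_norm_sq]
    rw [map_sub, map_smul, inner_sub_left, inner_sub_right, inner_sub_right, inner_smul_left,
      inner_smul_right, inner_smul_left, inner_smul_right, h2, ← hg, real_inner_self_eq_norm_sq]
    simp only [conj_trivial]
    ring
  -- The only use of the stepsize condition: the curvature along `g` costs less than the descent of
  -- the gradient step.
  have F7 : 108 * β ^ 4 / l ^ 3 * inner ℝ (A g) g ≤ 9 * β ^ 2 / l ^ 2 * ‖g‖ ^ 2 := by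
    calc 108 * β ^ 4 / l ^ 3 * inner ℝ (A g) g
        ≤ 108 * β ^ 4 / l ^ 3 * (lmax * ‖g‖ ^ 2) := by gcongr; exact hmax g
      _ = 108 * β ^ 2 / l ^ 3 * ‖g‖ ^ 2 * (lmax * β ^ 2) := by ring
      _ ≤ 108 * β ^ 2 / l ^ 3 * ‖g‖ ^ 2 * (l / 12) := by gcongr
      _ = _ := by field_simp; ring
  have F5 : β * ‖xg‖ ^ 2 ≤ β / l * inner ℝ g xg := by
    rw [div_mul_eq_mul_div, le_div_iff₀ hl]
    nlinarith
  have F4' := mul_nonneg (by have := hβ1; positivity : 0 ≤ 3 / l) (mul_nonneg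
    (by linarith : 0 ≤ 4 - β) F4)
  have hG : 0 ≤ β / l * inner ℝ g xg := by
    have := hpos xg
    positivity
  have hN : 0 ≤ β ^ 2 / l ^ 2 * ‖g‖ ^ 2 := by positivity
  have hX : 0 ≤ β * ‖x‖ ^ 2 := by positivity
  simp only [consensusLyapunov]
  rw [F2, F3, F6]
  ring_nf at F1 F4' F5 F7 hG hN hX ⊢
  linarith

theorem norm_sq_le_consensusLyapunov (hpos : ∀ x, 0 ≤ inner ℝ (A x) x) (hl : 0 < l) (x xf : E) :
    ‖x‖ ^ 2 ≤ consensusLyapunov A l x xf := by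
  have := hpos xf
  rw [consensusLyapunov]
  exact le_add_of_nonneg_right (by positivity)

theorem consensusLyapunov_nonneg (hpos : ∀ x, 0 ≤ inner ℝ (A x) x) (hl : 0 < l) (x xf : E) :
    0 ≤ consensusLyapunov A l x xf :=
  (sq_nonneg _).trans (norm_sq_le_consensusLyapunov hpos hl x xf)

/-- The extrapolated point is a convex combination of `xf` and `x`, both controlled by the Lyapunov
function. The gossip noise is proportional to this point, so this makes the noise relative to the
current error. -/
theorem norm_sq_extrapolation_le (hl : 0 < l) (hβ : 0 < β) (hβ1 : β ≤ 1) {x xf xg : E}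
    (hlow : l * ‖xf‖ ^ 2 ≤ inner ℝ (A xf) xf)
    (hxg : (1 - β ^ 2 / 4) • xg = (1 - β / 4) • xf + (β / 4 * (1 - β)) • x) :
    ‖xg‖ ^ 2 ≤ consensusLyapunov A l x xf := by
  have h0 : 0 < 1 - β ^ 2 / 4 := by nlinarith
  set s := (β / 4 * (1 - β)) / (1 - β ^ 2 / 4) with hs
  have hs0 : 0 ≤ s := div_nonneg (mul_nonneg (by linarith) (by linarith)) h0.le
  have hs1 : s ≤ 1 := by rw [hs, div_le_one h0]; nlinarith
  have e : xg = (1 - s) • xf + s • x := by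
    have h1 : (1 - s) = (1 - β / 4) / (1 - β ^ 2 / 4) := by
      rw [hs, eq_div_iff h0.ne', sub_mul, div_mul_cancel₀ _ h0.ne']; ring
    have h2 : xg = (1 - β ^ 2 / 4)⁻¹ • ((1 - β ^ 2 / 4) • xg) := by
      rw [smul_smul, inv_mul_cancel₀ h0.ne', one_smul]
    rw [h2, hxg, h1, hs]
    match_scalars <;> ring
  have h1 := norm_sq_convex_comb_le hs0 hs1 xf x
  rw [← e] at h1
  have h3 : ‖xf‖ ^ 2 ≤ 12 / l * inner ℝ (A xf) xf := by
    rw [div_mul_eq_mul_div, le_div_iff₀ hl]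
    nlinarith [sq_nonneg ‖xf‖]
  rw [consensusLyapunov]
  nlinarith [sq_nonneg ‖xf‖, sq_nonneg ‖x‖]

/-- Cocoercivity, read off from positivity of `A` at `x - lmax⁻¹ • A x`. -/
theorem norm_apply_sq_le (hA : A.IsSymmetric) (hpos : ∀ x, 0 ≤ inner ℝ (A x) x) (hm : 0 < lmax)
    (hmax : ∀ x, inner ℝ (A x) x ≤ lmax * ‖x‖ ^ 2) (x : E) :
    ‖A x‖ ^ 2 ≤ lmax * inner ℝ (A x) x := by
  have h1 := hpos (x - lmax⁻¹ • A x)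
  have h2 : inner ℝ (A (A x)) x = ‖A x‖ ^ 2 := by rw [hA (A x) x, real_inner_self_eq_norm_sq]
  rw [map_sub, map_smul, inner_sub_left, inner_sub_right, inner_sub_right, inner_smul_left,
      inner_smul_right, inner_smul_left, inner_smul_right, h2, real_inner_self_eq_norm_sq] at h1
  simp only [conj_trivial] at h1
  have h3 : lmax⁻¹ * (lmax⁻¹ * inner ℝ (A (A x)) (A x)) ≤ lmax⁻¹ * ‖A x‖ ^ 2 := by
    gcongr
    rw [inv_mul_le_iff₀ hm]
    exact hmax _
  have h4 : lmax⁻¹ * ‖A x‖ ^ 2 ≤ inner ℝ (A x) x := by linarith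
  rwa [inv_mul_le_iff₀ hm] at h4

/-- The coefficient of the noise in the linear part of the Lyapunov function. -/
def lyapunovDual (A : E →ₗ[ℝ] E) (l β : ℝ) (x xf : E) : E :=
  -((3 * β / l) • x) - (36 * β ^ 2 / l ^ 2) • A xf

/-- The Lyapunov function is quadratic, so its expansion in the noise is exact. The two quadratic
noise terms are at most `9 * β ^ 2 / l ^ 2 * ‖ξ‖ ^ 2` each, the second one by the stepsize
condition. -/
theorem consensusLyapunov_noise_le (hA : A.IsSymmetric)
    (hmax : ∀ x, inner ℝ (A x) x ≤ lmax * ‖x‖ ^ 2) (hl : 0 < l)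
    (hβl : lmax * β ^ 2 ≤ l / 12) (x xf ξ : E) :
    consensusLyapunov A l (x - (3 * β / l) • ξ) (xf - (3 * β ^ 2 / l) • ξ) ≤
      consensusLyapunov A l x xf + 2 * inner ℝ (lyapunovDual A l β x xf) ξ +
        18 * β ^ 2 / l ^ 2 * ‖ξ‖ ^ 2 := by
  have h2 : inner ℝ (A ξ) xf = inner ℝ (A xf) ξ := by rw [hA ξ xf, real_inner_comm]
  have h3 : 12 / l * (9 * β ^ 4 / l ^ 2 * inner ℝ (A ξ) ξ) ≤ 9 * β ^ 2 / l ^ 2 * ‖ξ‖ ^ 2 := by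
    calc 12 / l * (9 * β ^ 4 / l ^ 2 * inner ℝ (A ξ) ξ)
        ≤ 12 / l * (9 * β ^ 4 / l ^ 2 * (lmax * ‖ξ‖ ^ 2)) := by gcongr; exact hmax ξ
      _ = 108 * β ^ 2 / l ^ 3 * ‖ξ‖ ^ 2 * (lmax * β ^ 2) := by ring
      _ ≤ 108 * β ^ 2 / l ^ 3 * ‖ξ‖ ^ 2 * (l / 12) := by gcongr
      _ = _ := by field_simp; ring
  simp only [consensusLyapunov, lyapunovDual]
  rw [norm_sub_sq_real, map_sub, map_smul, norm_smul, mul_pow, Real.norm_eq_abs, sq_abs]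
  simp only [inner_sub_left, inner_sub_right, inner_smul_left, inner_smul_right, inner_neg_left,
    conj_trivial, h2]
  ring_nf at h3 ⊢
  linarith

/-- Makes the linear noise term quadratic in the current error, like the rest: a factor `√V` comes
from here and another from the noise. The part with `A xf` needs cocoercivity. -/
theorem norm_lyapunovDual_le (hA : A.IsSymmetric) (hpos : ∀ x, 0 ≤ inner ℝ (A x) x)
    (hm : 0 < lmax) (hmax : ∀ x, inner ℝ (A x) x ≤ lmax * ‖x‖ ^ 2) (hl : 0 < l) (hβ : 0 < β)
    (hβl : lmax * β ^ 2 ≤ l / 12) (x xf : E) :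
    ‖lyapunovDual A l β x xf‖ ≤ 6 * β / l * √(consensusLyapunov A l x xf) := by
  have hV := consensusLyapunov_nonneg hpos hl x xf
  set V := consensusLyapunov A l x xf with hVd
  have h1 : ‖(3 * β / l) • x‖ ≤ 3 * β / l * √V := by
    rw [norm_smul, Real.norm_of_nonneg (by positivity)]
    gcongr
    exact Real.le_sqrt_of_sq_le (norm_sq_le_consensusLyapunov hpos hl x xf)
  have h2 : ‖(36 * β ^ 2 / l ^ 2) • A xf‖ ≤ 3 * β / l * √V := by
    refine le_of_sq_le_sq ?_ (by positivity)
    rw [norm_smul, Real.norm_of_nonneg (by positivity), mul_pow, mul_pow, Real.sq_sqrt hV]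
    have h3 : inner ℝ (A xf) xf ≤ l / 12 * V := by
      rw [hVd, consensusLyapunov, mul_add]
      have : l / 12 * (12 / l * inner ℝ (A xf) xf) = inner ℝ (A xf) xf := by field_simp
      rw [this]
      exact le_add_of_nonneg_left (by positivity)
    calc (36 * β ^ 2 / l ^ 2) ^ 2 * ‖A xf‖ ^ 2
        ≤ (36 * β ^ 2 / l ^ 2) ^ 2 * (lmax * (l / 12 * V)) := by
          gcongr
          refine (norm_apply_sq_le hA hpos hm hmax xf).trans ?_
          gcongr
      _ = 108 * β ^ 2 / l ^ 3 * V * (lmax * β ^ 2) := by field_simp; ring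
      _ ≤ 108 * β ^ 2 / l ^ 3 * V * (l / 12) := by gcongr
      _ = _ := by field_simp; ring
  rw [lyapunovDual]
  refine (norm_sub_le _ _).trans ?_
  rw [norm_neg]
  refine (add_le_add h1 h2).trans (le_of_eq (by ring))

end Lyapunov

/-! ### Spectral bounds for the mean gossip matrix. -/

section Spectral

variable {n : ℕ} {A : Matrix (Fin n) (Fin n) ℝ} {G : SimpleGraph (Fin n)}

theorem inner_toEuclideanCLM_eq_sum (hA : A.IsHermitian) (x : EuclideanSpace ℝ (Fin n)) :
    inner ℝ (Matrix.toEuclideanCLM (𝕜 := ℝ) A x) x =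
      ∑ i, hA.eigenvalues i * (inner ℝ (hA.eigenvectorBasis i) x) ^ 2 := by
  rw [← hA.eigenvectorBasis.sum_inner_mul_inner]
  refine Finset.sum_congr rfl fun i _ => ?_
  have hsymm : inner ℝ (Matrix.toEuclideanCLM (𝕜 := ℝ) A x) (hA.eigenvectorBasis i) =
      inner ℝ x (Matrix.toEuclideanCLM (𝕜 := ℝ) A (hA.eigenvectorBasis i)) :=
    Matrix.isSymmetric_toEuclideanLin_iff.2 hA _ _
  have heig : Matrix.toEuclideanCLM (𝕜 := ℝ) A (hA.eigenvectorBasis i) =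
      hA.eigenvalues i • hA.eigenvectorBasis i := by
    ext1 j
    exact congrFun (hA.mulVec_eigenvectorBasis i) j
  rw [hsymm, heig, inner_smul_right, real_inner_comm]
  ring

theorem eigenvalues_le_lambdaMax (hA : A.IsHermitian) (i : Fin n) :
    hA.eigenvalues i ≤ lambdaMax A :=
  le_csSup A.finite_real_spectrum.bddAbove (hA.eigenvalues_mem_spectrum_real i)

theorem lambdaMinPos_le_eigenvalues (hA : A.IsHermitian) {i : Fin n} (h : 0 < hA.eigenvalues i) :
    lambdaMinPos A ≤ hA.eigenvalues i :=
  csInf_le ⟨0, fun _ hl => hl.2.le⟩ ⟨hA.eigenvalues_mem_spectrum_real i, h⟩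

/-- The spectrum is finite, so the infimum is attained once there is a positive eigenvalue. There is
one because, for two or more nodes, a matrix that kills only constants is not zero. -/
theorem lambdaMinPos_mem (hn : 2 ≤ n) (hA : A.PosSemidef) (hG : IsGossipMatrix G A) :
    lambdaMinPos A ∈ {l : ℝ | l ∈ spectrum ℝ A ∧ 0 < l} := by
  refine Set.Nonempty.csInf_mem ?_ (A.finite_real_spectrum.subset fun l hl => hl.1)
  have hne : A ≠ 0 := by
    rintro rfl
    obtain ⟨a, ha⟩ := (hG.2 (Pi.single ⟨0, by omega⟩ 1)).1 (Matrix.zero_mulVec _)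
    have h0 := congrFun ha ⟨0, by omega⟩
    have h1 := congrFun ha ⟨1, by omega⟩
    simp at h0 h1
    exact zero_ne_one (h1.trans h0.symm)
  have : hA.1.eigenvalues ≠ 0 := fun h => hne (hA.1.eigenvalues_eq_zero_iff.1 h)
  obtain ⟨i, hi⟩ := Function.ne_iff.1 this
  exact ⟨_, hA.1.eigenvalues_mem_spectrum_real i,
    lt_of_le_of_ne (hA.eigenvalues_nonneg i) (Ne.symm hi)⟩

theorem lambdaMinPos_pos (hn : 2 ≤ n) (hA : A.PosSemidef) (hG : IsGossipMatrix G A) :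
    0 < lambdaMinPos A :=
  (lambdaMinPos_mem hn hA hG).2

theorem lambdaMinPos_le_lambdaMax (hn : 2 ≤ n) (hA : A.PosSemidef) (hG : IsGossipMatrix G A) :
    lambdaMinPos A ≤ lambdaMax A :=
  le_csSup A.finite_real_spectrum.bddAbove (lambdaMinPos_mem hn hA hG).1

theorem inner_toEuclideanCLM_le (hA : A.IsHermitian) (x : EuclideanSpace ℝ (Fin n)) :
    inner ℝ (Matrix.toEuclideanCLM (𝕜 := ℝ) A x) x ≤ lambdaMax A * ‖x‖ ^ 2 := by
  rw [inner_toEuclideanCLM_eq_sum hA, ← real_inner_self_eq_norm_sq,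
    ← hA.eigenvectorBasis.sum_inner_mul_inner, Finset.mul_sum]
  refine Finset.sum_le_sum fun i _ => ?_
  rw [real_inner_comm, ← sq]
  exact mul_le_mul_of_nonneg_right (eigenvalues_le_lambdaMax hA i) (sq_nonneg _)

theorem inner_toEuclideanCLM_nonneg (hA : A.PosSemidef) (x : EuclideanSpace ℝ (Fin n)) :
    0 ≤ inner ℝ (Matrix.toEuclideanCLM (𝕜 := ℝ) A x) x := by
  rw [inner_toEuclideanCLM_eq_sum hA.1]
  exact Finset.sum_nonneg fun i _ => mul_nonneg (hA.eigenvalues_nonneg i) (sq_nonneg _)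

/-- Eigenvectors with eigenvalue zero are constant, hence orthogonal to zero-sum vectors; the
remaining eigenvalues are at least the smallest positive one. -/
theorem le_inner_toEuclideanCLM (hA : A.PosSemidef) (hG : IsGossipMatrix G A)
    (x : EuclideanSpace ℝ (Fin n)) (hx : ∑ i, x i = 0) :
    lambdaMinPos A * ‖x‖ ^ 2 ≤ inner ℝ (Matrix.toEuclideanCLM (𝕜 := ℝ) A x) x := by
  rw [inner_toEuclideanCLM_eq_sum hA.1, ← real_inner_self_eq_norm_sq,
    ← hA.1.eigenvectorBasis.sum_inner_mul_inner, Finset.mul_sum]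
  refine Finset.sum_le_sum fun i _ => ?_
  rw [real_inner_comm, ← sq]
  rcases (hA.eigenvalues_nonneg i).eq_or_lt with h | h
  · have h1 := hA.1.mulVec_eigenvectorBasis i
    rw [← h, zero_smul] at h1
    obtain ⟨a, ha⟩ := (hG.2 _).1 h1
    have h2 : inner ℝ (hA.1.eigenvectorBasis i) x = 0 := by
      have e : inner ℝ (hA.1.eigenvectorBasis i) x = ∑ j, x j * a := by
        rw [PiLp.inner_apply]
        refine Finset.sum_congr rfl fun j _ => ?_
        rw [congrFun ha j]; simp
      rw [e, ← Finset.sum_mul, hx, zero_mul]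
    simp [h2]
  · exact mul_le_mul_of_nonneg_right (lambdaMinPos_le_eigenvalues hA.1 h) (sq_nonneg _)

end Spectral

/-! ### Gossip rounds as operators on stacked vectors. -/

section GossipOperator

variable {n m : ℕ}

/-- A communication round as a linear operator on stacked vectors. -/
def gossipMap (W : Matrix (Fin n) (Fin n) ℝ) : Stack n m →ₗ[ℝ] Stack n m where
  toFun x := stack (gossip W (stack.symm x))
  map_add' x y := by
    rw [← map_add]; congr 1; ext1 i
    simp [gossip, smul_add, Finset.sum_add_distrib]
  map_smul' c x := by
    rw [RingHom.id_apply, ← map_smul]; congr 1; ext1 i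
    simp [gossip, Finset.smul_sum, smul_comm c]

theorem gossipMap_stack (W : Matrix (Fin n) (Fin n) ℝ) (x : Fin n → Vec m) :
    gossipMap W (stack x) = stack (gossip W x) := by
  simp [gossipMap]

/-- The `d`-th coordinates of the node variables. -/
def nodeCoord (x : Stack n m) (d : Fin m) : EuclideanSpace ℝ (Fin n) :=
  WithLp.toLp 2 fun i => x i d

theorem inner_eq_sum_nodeCoord (x y : Stack n m) :
    inner ℝ x y = ∑ d, inner ℝ (nodeCoord x d) (nodeCoord y d) := by
  simp_rw [PiLp.inner_apply, nodeCoord]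
  rw [Finset.sum_comm]

theorem norm_sq_eq_sum_nodeCoord (x : Stack n m) : ‖x‖ ^ 2 = ∑ d, ‖nodeCoord x d‖ ^ 2 := by
  simp_rw [← real_inner_self_eq_norm_sq]
  exact inner_eq_sum_nodeCoord x x

/-- A round acts by the same matrix on each of the `m` coordinates, so all spectral bounds transfer
to stacked vectors without a factor `m`. -/
theorem nodeCoord_gossipMap (W : Matrix (Fin n) (Fin n) ℝ) (x : Stack n m) (d : Fin m) :
    nodeCoord (gossipMap W x) d = Matrix.toEuclideanCLM (𝕜 := ℝ) W (nodeCoord x d) := by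
  ext1 i
  rw [Matrix.ofLp_toEuclideanCLM]
  simp [nodeCoord, gossipMap, gossip, Matrix.mulVec, dotProduct]
  rfl

theorem gossipMap_isSymmetric {A : Matrix (Fin n) (Fin n) ℝ} (hA : A.IsHermitian) :
    (gossipMap A : Stack n m →ₗ[ℝ] Stack n m).IsSymmetric := by
  intro x y
  rw [inner_eq_sum_nodeCoord, inner_eq_sum_nodeCoord]
  refine Finset.sum_congr rfl fun d _ => ?_
  rw [nodeCoord_gossipMap, nodeCoord_gossipMap]
  exact Matrix.isSymmetric_toEuclideanLin_iff.2 hA _ _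

theorem inner_gossipMap_nonneg {A : Matrix (Fin n) (Fin n) ℝ} (hA : A.PosSemidef)
    (x : Stack n m) : 0 ≤ inner ℝ (gossipMap A x) x := by
  rw [inner_eq_sum_nodeCoord]
  refine Finset.sum_nonneg fun d _ => ?_
  rw [nodeCoord_gossipMap]
  exact inner_toEuclideanCLM_nonneg hA _

theorem inner_gossipMap_le {A : Matrix (Fin n) (Fin n) ℝ} (hA : A.IsHermitian)
    (x : Stack n m) : inner ℝ (gossipMap A x) x ≤ lambdaMax A * ‖x‖ ^ 2 := by
  rw [inner_eq_sum_nodeCoord, norm_sq_eq_sum_nodeCoord, Finset.mul_sum]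
  refine Finset.sum_le_sum fun d _ => ?_
  rw [nodeCoord_gossipMap]
  exact inner_toEuclideanCLM_le hA _

theorem le_inner_gossipMap {A : Matrix (Fin n) (Fin n) ℝ} {G : SimpleGraph (Fin n)}
    (hA : A.PosSemidef) (hG : IsGossipMatrix G A) (x : Fin n → Vec m) (hx : ∑ i, x i = 0) :
    lambdaMinPos A * ‖stack x‖ ^ 2 ≤ inner ℝ (gossipMap A (stack x)) (stack x) := by
  rw [inner_eq_sum_nodeCoord, norm_sq_eq_sum_nodeCoord, Finset.mul_sum]
  refine Finset.sum_le_sum fun d _ => ?_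
  rw [nodeCoord_gossipMap]
  refine le_inner_toEuclideanCLM hA hG _ ?_
  have := congrArg (fun v : Vec m => v d) hx
  simpa [nodeCoord] using this

theorem norm_gossipMap_le (D : Matrix (Fin n) (Fin n) ℝ) {r : ℝ}
    (hr : ‖Matrix.toEuclideanCLM (n := Fin n) (𝕜 := ℝ) D‖ ≤ r) (x : Stack n m) :
    ‖gossipMap D x‖ ≤ r * ‖x‖ := by
  have hr0 : 0 ≤ r := (norm_nonneg _).trans hr
  refine le_of_sq_le_sq ?_ (by positivity)
  rw [norm_sq_eq_sum_nodeCoord, mul_pow, norm_sq_eq_sum_nodeCoord, Finset.mul_sum]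
  refine Finset.sum_le_sum fun d _ => ?_
  rw [nodeCoord_gossipMap, ← mul_pow]
  gcongr
  exact (ContinuousLinearMap.le_opNorm _ _).trans (by gcongr)

theorem gossipMap_sub (V W : Matrix (Fin n) (Fin n) ℝ) (x : Stack n m) :
    gossipMap (V - W) x = gossipMap V x - gossipMap W x := by
  simp only [gossipMap, LinearMap.coe_mk, AddHom.coe_mk]
  rw [← map_sub]
  congr 1
  ext1 i
  simp [gossip, sub_smul, Finset.sum_sub_distrib]

theorem inner_gossipMap_eq_sum (D : Matrix (Fin n) (Fin n) ℝ) (x y : Stack n m) :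
    inner ℝ y (gossipMap D x) = ∑ a, ∑ b, D a b * inner ℝ (y a) (x b) := by
  rw [PiLp.inner_apply]
  refine Finset.sum_congr rfl fun a _ => ?_
  simp only [gossipMap, LinearMap.coe_mk, AddHom.coe_mk, stack_apply, gossip, inner_sum,
    inner_smul_right]
  rfl

theorem gossip_const {W : Matrix (Fin n) (Fin n) ℝ} {G : SimpleGraph (Fin n)}
    (hG : IsGossipMatrix G W) (a : Vec m) : gossip W (fun _ => a) = 0 := by
  ext1 i
  have h := congrFun ((hG.2 fun _ => (1 : ℝ)).2 ⟨1, rfl⟩) i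
  simp [Matrix.mulVec, dotProduct] at h
  rw [gossip, ← Finset.sum_smul, h, zero_smul, Pi.zero_apply]

theorem sum_gossip {W : Matrix (Fin n) (Fin n) ℝ} (hW : ∀ j, ∑ i, W i j = 0)
    (x : Fin n → Vec m) : ∑ i, gossip W x i = 0 := by
  simp only [gossip]
  rw [Finset.sum_comm]
  refine Finset.sum_eq_zero fun j _ => ?_
  rw [← Finset.sum_smul, hW, zero_smul]

end GossipOperator

/-! ### Total variation and integrals of bounded functions. -/

section TotalVariation

variable {S : Type*} [MeasurableSpace S]

theorem abs_measureReal_sub_le_tvDist (P Q : Measure S) [IsProbabilityMeasure P]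
    [IsProbabilityMeasure Q] {A : Set S} (hA : MeasurableSet A) :
    |P.real A - Q.real A| ≤ tvDist P Q := by
  refine le_ciSup (f := fun A : {A : Set S // MeasurableSet A} => |P.real A - Q.real A|)
    ⟨1, ?_⟩ ⟨A, hA⟩
  rintro _ ⟨B, rfl⟩
  have h1 : P.real B ≤ 1 := measureReal_le_one
  have h2 : Q.real B ≤ 1 := measureReal_le_one
  have h3 : 0 ≤ P.real B := measureReal_nonneg
  have h4 : 0 ≤ Q.real B := measureReal_nonneg
  exact abs_le.2 ⟨by linarith, by linarith⟩

/-- Layer-cake formula for `h + H`, which takes values in `[0, 2 * H]`: the integrals differ by the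
integral over that interval of differences of probabilities of superlevel sets. -/
theorem abs_integral_sub_le_tvDist (P Q : Measure S) [IsProbabilityMeasure P]
    [IsProbabilityMeasure Q] {h : S → ℝ} (hm : Measurable h) {H : ℝ} (hH : ∀ s, |h s| ≤ H) :
    |∫ s, h s ∂P - ∫ s, h s ∂Q| ≤ 2 * H * tvDist P Q := by
  obtain ⟨s0⟩ : Nonempty S := P.nonempty_of_neZero
  have hH0 : 0 ≤ H := (abs_nonneg _).trans (hH s0)
  have key : ∀ (ν : Measure S) [IsProbabilityMeasure ν], Integrable h ν ∧
      ∫ s, h s ∂ν = (∫ t in Set.Ioc 0 (2 * H), ν.real {a | t ≤ h a + H}) - H := by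
    intro ν _
    have hint : Integrable h ν := Integrable.of_bound hm.aestronglyMeasurable H
      (Filter.Eventually.of_forall hH)
    have h1 := (hint.add (integrable_const H)).integral_eq_integral_Ioc_meas_le (M := 2 * H)
      (Filter.Eventually.of_forall fun s => by
        have := abs_le.1 (hH s); simp only [Pi.zero_apply, Pi.add_apply]; linarith)
      (Filter.Eventually.of_forall fun s => by
        have := abs_le.1 (hH s); simp only [Pi.add_apply]; linarith)
    refine ⟨hint, ?_⟩
    simp only [Pi.add_apply] at h1
    rw [← h1, integral_add hint (integrable_const H)]
    simp
  have hI : ∀ (ν : Measure S) [IsProbabilityMeasure ν],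
      IntegrableOn (fun t => ν.real {a | t ≤ h a + H}) (Set.Ioc 0 (2 * H)) := by
    intro ν _
    have hanti : Antitone fun t : ℝ => ν.real {a | t ≤ h a + H} := fun s t hst =>
      measureReal_mono fun a ha => le_trans hst ha
    refine Integrable.of_bound hanti.measurable.aestronglyMeasurable 1
      (Filter.Eventually.of_forall fun t => ?_)
    rw [Real.norm_of_nonneg measureReal_nonneg]
    exact measureReal_le_one
  rw [(key P).2, (key Q).2, sub_sub_sub_cancel_right, ← integral_sub (hI P) (hI Q)]
  have := norm_setIntegral_le_of_norm_le_const (μ := volume) (s := Set.Ioc 0 (2 * H))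
    (f := fun t => P.real {a | t ≤ h a + H} - Q.real {a | t ≤ h a + H}) (C := tvDist P Q)
    (by rw [Real.volume_Ioc]; exact ENNReal.ofReal_lt_top) (fun t _ => abs_measureReal_sub_le_tvDist P Q
      (measurableSet_le measurable_const (hm.add_const H)))
  refine this.trans (le_of_eq ?_)
  rw [Measure.real, Real.volume_Ioc, ENNReal.toReal_ofReal (by linarith)]
  ring

end TotalVariation

/-! ### Kernel powers, ergodicity and the Markov property. -/

section Markov

variable {S Ω : Type*} [mS : MeasurableSpace S]

instance isMarkovKernel_pow (Q : Kernel S S) [IsMarkovKernel Q] (i : ℕ) :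
    IsMarkovKernel (Q ^ i) := by
  induction i with
  | zero => rw [pow_zero]; exact inferInstanceAs (IsMarkovKernel Kernel.id)
  | succ i ih => rw [pow_succ]; exact inferInstanceAs (IsMarkovKernel ((Q ^ i) ∘ₖ Q))

theorem bind_pow_succ (Q : Kernel S S) (μ : Measure S) (i : ℕ) :
    μ.bind (Q ^ (i + 1) : Kernel S S) = (μ.bind (Q ^ i : Kernel S S)).bind Q := by
  have : Q ^ (i + 1) = Q ∘ₖ (Q ^ i) := pow_succ' Q i
  rw [this, Measure.bind_bind (Kernel.aemeasurable _) (Kernel.aemeasurable _)]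
  rfl

theorem bind_pow_zero (Q : Kernel S S) (μ : Measure S) :
    μ.bind (Q ^ 0 : Kernel S S) = μ := by
  rw [pow_zero]
  exact Measure.bind_dirac

theorem bind_pow_of_invariant {Q : Kernel S S} {π : Measure S} (h : Q.Invariant π) (i : ℕ) :
    π.bind (Q ^ i : Kernel S S) = π := by
  induction i with
  | zero => exact bind_pow_zero Q π
  | succ i ih => rw [bind_pow_succ, ih]; exact h

theorem integral_bind_of_bounded (μ : Measure S) [IsFiniteMeasure μ] (κ : Kernel S S)
    [IsMarkovKernel κ] {h : S → ℝ} (hm : Measurable h) {H : ℝ} (hH : ∀ s, |h s| ≤ H) :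
    ∫ s, h s ∂(μ.bind κ) = ∫ s, ∫ s', h s' ∂(κ s) ∂μ := by
  have h1 := Kernel.integral_comp (η := κ) (κ := Kernel.const Unit μ) (a := ()) (f := h)
    (Integrable.of_bound hm.aestronglyMeasurable H (Filter.Eventually.of_forall hH))
  simpa [Kernel.comp_apply] using h1

/-- Uniform ergodicity for bounded functions. -/
theorem abs_integral_pow_sub_le {Q : Kernel S S} [IsMarkovKernel Q] {π : Measure S}
    [IsProbabilityMeasure π] (hinv : Q.Invariant π) {i : ℕ} {r : ℝ}
    (hmix : ∀ s s', tvDist ((Q ^ i) s) ((Q ^ i) s') ≤ r)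
    {h : S → ℝ} (hm : Measurable h) {H : ℝ} (hH : ∀ s, |h s| ≤ H) (s : S) :
    |∫ s', h s' ∂((Q ^ i) s) - ∫ s', h s' ∂π| ≤ 2 * H * r := by
  have hH0 : 0 ≤ H := (abs_nonneg _).trans (hH s)
  have hint : Integrable (fun s' => ∫ u, h u ∂((Q ^ i) s')) π := by
    refine Integrable.of_bound
      (StronglyMeasurable.integral_kernel hm.stronglyMeasurable).aestronglyMeasurable H
      (Filter.Eventually.of_forall fun s' => ?_)
    simpa using norm_integral_le_of_norm_le_const (μ := (Q ^ i) s') (f := h)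
      (Filter.Eventually.of_forall hH)
  have h1 : ∫ s', h s' ∂π = ∫ s', ∫ u, h u ∂((Q ^ i) s') ∂π := by
    rw [← integral_bind_of_bounded π (Q ^ i) hm hH, bind_pow_of_invariant hinv]
  -- By invariance the stationary mean is an average over starting points `s'` of means after `i`
  -- steps, so the mixing bound for pairs of states applies.
  have h2 : ∫ s', h s' ∂((Q ^ i) s) - ∫ s', h s' ∂π =
      ∫ s', (∫ u, h u ∂((Q ^ i) s) - ∫ u, h u ∂((Q ^ i) s')) ∂π := by
    rw [integral_sub (integrable_const _) hint, h1]
    simp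
  rw [h2]
  have h3 : ∀ s', ‖∫ u, h u ∂((Q ^ i) s) - ∫ u, h u ∂((Q ^ i) s')‖ ≤ 2 * H * r := fun s' =>
    (abs_integral_sub_le_tvDist _ _ hm hH).trans (by gcongr; exact hmix s s')
  simpa using norm_integral_le_of_norm_le_const (μ := π) (Filter.Eventually.of_forall h3)

/-- The `σ`-algebra generated by the chain up to time `t`. -/
@[reducible]
def history (X : ℕ → Ω → S) (t : ℕ) : MeasurableSpace Ω :=
  ⨆ j : Fin (t + 1), MeasurableSpace.comap (X j) mS

theorem history_mono (X : ℕ → Ω → S) {s t : ℕ} (h : s ≤ t) : history X s ≤ history X t :=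
  iSup_le fun j => le_iSup (fun j : Fin (t + 1) => MeasurableSpace.comap (X j) mS)
    ⟨j, j.2.trans_le (Nat.succ_le_succ h)⟩

theorem measurable_history (X : ℕ → Ω → S) {j t : ℕ} (h : j ≤ t) :
    Measurable[history X t] (X j) :=
  Measurable.mono (comap_measurable (X j))
    (le_iSup (fun j : Fin (t + 1) => MeasurableSpace.comap (X j) mS) ⟨j, Nat.lt_succ_of_le h⟩)
    le_rfl

theorem history_le_comap (X : ℕ → Ω → S) (t : ℕ) :
    history X t ≤ MeasurableSpace.comap (fun ω k => X k ω) MeasurableSpace.pi :=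
  iSup_le fun j => by
    have : X j = (fun x : ℕ → S => x j) ∘ fun ω k => X k ω := rfl
    rw [this, ← MeasurableSpace.comap_comp]
    exact MeasurableSpace.comap_mono (measurable_pi_apply _).comap_le

variable [mΩ : MeasurableSpace Ω] {P : Measure Ω} {Q : Kernel S S} {π : Measure S}
  {X : ℕ → Ω → S}

theorem IsStationaryMarkovChain.history_le (hX : IsStationaryMarkovChain P Q π X) (t : ℕ) :
    history X t ≤ mΩ :=
  iSup_le fun j => (hX.measurable j).comap_le

variable [IsProbabilityMeasure P] [IsMarkovKernel Q]

theorem IsStationaryMarkovChain.map_restrict_succ (hX : IsStationaryMarkovChain P Q π X) (k : ℕ)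
    {A : Set Ω} (hA : MeasurableSet[history X k] A) :
    (P.restrict A).map (X (k + 1)) = ((P.restrict A).map (X k)).bind Q := by
  have hA' := hX.history_le k _ hA
  ext B hB
  have hB' := hX.measurable (k + 1) hB
  rw [Measure.map_apply (hX.measurable _) hB, Measure.restrict_apply hB',
    Measure.bind_apply hB (Kernel.aemeasurable _),
    lintegral_map (Kernel.measurable_coe Q hB) (hX.measurable k)]
  have h1 := setIntegral_condExp (hX.history_le k) (μ := P)
    (f := (X (k + 1) ⁻¹' B).indicator fun _ => (1 : ℝ))
    ((integrable_const _).indicator hB') hA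
  have h2 : ∫ ω in A, (P[(X (k + 1) ⁻¹' B).indicator (fun _ => (1 : ℝ)) | history X k]) ω ∂P =
      ∫ ω in A, (Q (X k ω)).real B ∂P :=
    integral_congr_ae (ae_restrict_of_ae (hX.markov k B hB))
  rw [h2, integral_indicator hB', Measure.restrict_restrict hB', setIntegral_const, smul_eq_mul,
    mul_one] at h1
  have h3 : ∫ ω in A, (Q (X k ω)).real B ∂P = (∫⁻ ω in A, Q (X k ω) B ∂P).toReal :=
    integral_toReal ((Kernel.measurable_coe Q hB).comp (hX.measurable k)).aemeasurable
      (Filter.Eventually.of_forall fun ω => measure_lt_top _ _)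
  rw [h3] at h1
  refine ((ENNReal.toReal_eq_toReal_iff' ?_ (measure_ne_top _ _)).1 h1).symm
  refine ne_of_lt (lt_of_le_of_lt (lintegral_mono fun ω => prob_le_one) ?_)
  simp

/-- The multi-step Markov property for restricted measures. An event of the history up to `t` stays
an event of every later history, so the one-step property can be iterated. -/
theorem IsStationaryMarkovChain.map_restrict_add (hX : IsStationaryMarkovChain P Q π X) (t i : ℕ)
    {A : Set Ω} (hA : MeasurableSet[history X t] A) :
    (P.restrict A).map (X (t + i)) = ((P.restrict A).map (X t)).bind (Q ^ i : Kernel S S) := by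
  induction i with
  | zero => rw [bind_pow_zero]; rfl
  | succ i ih =>
    rw [bind_pow_succ, ← ih, ← add_assoc]
    exact hX.map_restrict_succ (t + i) (history_mono X (Nat.le_add_right t i) _ hA)

/-- The Markov property at time `t`. -/
theorem IsStationaryMarkovChain.integral_mul (hX : IsStationaryMarkovChain P Q π X) (t i : ℕ)
    {Z : Ω → ℝ} (hZ : StronglyMeasurable[history X t] Z) {C : ℝ} (hC : ∀ ω, |Z ω| ≤ C)
    {h : S → ℝ} (hm : Measurable h) {H : ℝ} (hH : ∀ s, |h s| ≤ H) :
    ∫ ω, Z ω * h (X (t + i) ω) ∂P = ∫ ω, Z ω * ∫ s, h s ∂((Q ^ i) (X t ω)) ∂P := by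
  have hle := hX.history_le t
  have hmX : Measurable fun ω => h (X (t + i) ω) := hm.comp (hX.measurable _)
  have hsK : StronglyMeasurable fun s => ∫ u, h u ∂((Q ^ i) s) :=
    StronglyMeasurable.integral_kernel hm.stronglyMeasurable
  have hKb : ∀ s, |∫ u, h u ∂((Q ^ i) s)| ≤ H := fun s => by
    simpa using norm_integral_le_of_norm_le_const (μ := (Q ^ i) s) (f := h)
      (Filter.Eventually.of_forall hH)
  have hint : Integrable (fun ω => h (X (t + i) ω)) P :=
    Integrable.of_bound hmX.aestronglyMeasurable H (Filter.Eventually.of_forall fun ω => hH _)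
  have hKX : Measurable[history X t] fun ω => ∫ u, h u ∂((Q ^ i) (X t ω)) :=
    hsK.measurable.comp (measurable_history X le_rfl)
  have hKint : Integrable (fun ω => ∫ u, h u ∂((Q ^ i) (X t ω))) P :=
    Integrable.of_bound (hKX.mono hle le_rfl).aestronglyMeasurable H
      (Filter.Eventually.of_forall fun ω => hKb _)
  -- The kernel mean is a version of the conditional expectation: both have the same integrals over
  -- events of the history.
  have h1 : (fun ω => ∫ u, h u ∂((Q ^ i) (X t ω))) =ᵐ[P]
      P[fun ω => h (X (t + i) ω) | history X t] := by
    refine ae_eq_condExp_of_forall_setIntegral_eq hle hint (fun A _ _ => hKint.integrableOn)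
      (fun A hA _ => ?_) hKX.stronglyMeasurable.aestronglyMeasurable
    have e1 := integral_map (μ := P.restrict A) (hX.measurable (t + i)).aemeasurable
      hm.aestronglyMeasurable
    have e2 := integral_map (μ := P.restrict A) (hX.measurable t).aemeasurable
      hsK.aestronglyMeasurable
    rw [← e1, ← e2, hX.map_restrict_add t i hA, integral_bind_of_bounded _ _ hm hH]
  have h2 := condExp_stronglyMeasurable_mul_of_bound hle hZ hint C (Filter.Eventually.of_forall hC)
  have h3 := integral_condExp (μ := P) hle (f := Z * fun ω => h (X (t + i) ω))
  have h4 : ∫ ω, Z ω * h (X (t + i) ω) ∂P =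
      ∫ ω, (P[Z * (fun ω => h (X (t + i) ω)) | history X t]) ω ∂P := h3.symm
  rw [h4]
  refine integral_congr_ae ?_
  filter_upwards [h1, h2] with ω w1 w2
  rw [w2, Pi.mul_apply, w1]

end Markov

/-! ### Decay of correlations of the gossip noise. -/

section NoiseCorrelation

variable {n m : ℕ} {S Ω : Type*} [mS : MeasurableSpace S]
  {Q : Kernel S S} {π : Measure S} {τ : ℕ} {G : S → SimpleGraph (Fin n)}
  {W : S → Matrix (Fin n) (Fin n) ℝ} {Wt : Matrix (Fin n) (Fin n) ℝ} {ρ : ℝ}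

theorem inner_toEuclideanCLM_eq_double_sum (D : Matrix (Fin n) (Fin n) ℝ)
    (u v : EuclideanSpace ℝ (Fin n)) :
    inner ℝ u (Matrix.toEuclideanCLM (𝕜 := ℝ) D v) = ∑ a, ∑ b, u a * v b * D a b := by
  rw [Matrix.inner_toEuclideanCLM]
  simp only [dotProduct, Matrix.mulVec, Finset.mul_sum]
  refine Finset.sum_congr rfl fun a _ => Finset.sum_congr rfl fun b _ => by ring

theorem abs_inner_toEuclideanCLM_le {D : Matrix (Fin n) (Fin n) ℝ} {r : ℝ}
    (hD : ‖Matrix.toEuclideanCLM (n := Fin n) (𝕜 := ℝ) D‖ ≤ r) (u v : EuclideanSpace ℝ (Fin n)) :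
    |inner ℝ u (Matrix.toEuclideanCLM (𝕜 := ℝ) D v)| ≤ r * ‖u‖ * ‖v‖ := by
  refine (abs_real_inner_le_norm _ _).trans ?_
  calc ‖u‖ * ‖Matrix.toEuclideanCLM (𝕜 := ℝ) D v‖ ≤ ‖u‖ * (r * ‖v‖) := by
        gcongr
        exact (ContinuousLinearMap.le_opNorm _ _).trans (by gcongr)
    _ = _ := by ring

theorem abs_entry_le {D : Matrix (Fin n) (Fin n) ℝ} {r : ℝ}
    (hD : ‖Matrix.toEuclideanCLM (n := Fin n) (𝕜 := ℝ) D‖ ≤ r) (a b : Fin n) : |D a b| ≤ r := by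
  have := abs_inner_toEuclideanCLM_le hD (EuclideanSpace.single a 1) (EuclideanSpace.single b 1)
  rw [inner_toEuclideanCLM_eq_double_sum] at this
  simpa [Pi.single_apply] using this

/-- The conditional expectation of the deviation matrix after `i` steps. -/
def meanDeviation (Q : Kernel S S) (W : S → Matrix (Fin n) (Fin n) ℝ)
    (Wt : Matrix (Fin n) (Fin n) ℝ) (i : ℕ) (s : S) : Matrix (Fin n) (Fin n) ℝ :=
  Matrix.of fun a b => ∫ s', (W s' - Wt) a b ∂((Q ^ i) s)

theorem NetworkAssumptions.measurable_deviation (hN : NetworkAssumptions Q π τ G W Wt ρ)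
    (a b : Fin n) : Measurable fun s => (W s - Wt) a b := by
  simpa only [Matrix.sub_apply] using (hN.measurable a b).sub_const (Wt a b)

theorem stronglyMeasurable_inner_apply {mΩ' : MeasurableSpace Ω} {x y : Ω → Stack n m}
    (hx : StronglyMeasurable[mΩ'] x) (hy : StronglyMeasurable[mΩ'] y) (a b : Fin n) :
    StronglyMeasurable[mΩ'] fun ω => inner ℝ (y ω a) (x ω b) := by
  have h : Continuous fun p : Stack n m × Stack n m => (inner ℝ (p.2 a) (p.1 b) : ℝ) := by
    fun_prop
  exact h.comp_stronglyMeasurable (hx.prodMk hy)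

variable [IsMarkovKernel Q] [IsProbabilityMeasure π]

/-- The deviation has stationary mean zero, so uniform ergodicity applies. It is applied to bilinear
forms rather than to entries, which gives the operator norm without a dimensional factor. -/
theorem NetworkAssumptions.norm_meanDeviation_le (hN : NetworkAssumptions Q π τ G W Wt ρ)
    (i : ℕ) (s : S) :
    ‖Matrix.toEuclideanCLM (n := Fin n) (𝕜 := ℝ) (meanDeviation Q W Wt i s)‖ ≤
      2 * ρ * (1 / 4 : ℝ) ^ (i / τ) := by
  have hρ : 0 ≤ ρ := (norm_nonneg _).trans (hN.deviation s)
  have hint : ∀ (ν : Measure S) [IsProbabilityMeasure ν] (a b : Fin n),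
      Integrable (fun s' => (W s' - Wt) a b) ν := fun ν _ a b =>
    Integrable.of_bound (hN.measurable_deviation a b).aestronglyMeasurable ρ
      (Filter.Eventually.of_forall fun s' => abs_entry_le (hN.deviation s') a b)
  have hsum : ∀ (ν : Measure S) [IsProbabilityMeasure ν] (u v : EuclideanSpace ℝ (Fin n)),
      ∫ s', inner ℝ u (Matrix.toEuclideanCLM (𝕜 := ℝ) (W s' - Wt) v) ∂ν =
        ∑ a, ∑ b, u a * v b * ∫ s', (W s' - Wt) a b ∂ν := by
    intro ν _ u v
    simp_rw [inner_toEuclideanCLM_eq_double_sum]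
    rw [integral_finsetSum _ fun a _ => integrable_finsetSum _ fun b _ =>
      (hint ν a b).const_mul _]
    refine Finset.sum_congr rfl fun a _ => ?_
    rw [integral_finsetSum _ fun b _ => (hint ν a b).const_mul _]
    refine Finset.sum_congr rfl fun b _ => integral_const_mul _ _
  have key : ∀ u v : EuclideanSpace ℝ (Fin n),
      |inner ℝ u (Matrix.toEuclideanCLM (𝕜 := ℝ) (meanDeviation Q W Wt i s) v)| ≤
        2 * (ρ * ‖u‖ * ‖v‖) * (1 / 4 : ℝ) ^ (i / τ) := by
    intro u v
    have hm : Measurable fun s' => inner ℝ u (Matrix.toEuclideanCLM (𝕜 := ℝ) (W s' - Wt) v) := by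
      simp_rw [inner_toEuclideanCLM_eq_double_sum]
      exact Finset.measurable_sum _ fun a _ => Finset.measurable_sum _ fun b _ =>
        (hN.measurable_deviation a b).const_mul _
    have h1 := abs_integral_pow_sub_le hN.invariant (hN.mixing i) hm
      (fun s' => abs_inner_toEuclideanCLM_le (hN.deviation s') u v) s
    have h2 : ∫ s', inner ℝ u (Matrix.toEuclideanCLM (𝕜 := ℝ) (W s' - Wt) v) ∂π = 0 := by
      rw [hsum]
      refine Finset.sum_eq_zero fun a _ => Finset.sum_eq_zero fun b _ => ?_
      have h3 : Integrable (fun s' => W s' a b) π := by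
        have := (hint π a b).add (integrable_const (Wt a b))
        refine this.congr (Filter.Eventually.of_forall fun s' => ?_)
        simp
      simp only [Matrix.sub_apply]
      rw [integral_sub h3 (integrable_const _), hN.mean]
      simp
    rw [h2, sub_zero, hsum] at h1
    rw [inner_toEuclideanCLM_eq_double_sum]
    exact h1
  -- The bilinear estimate is tested with the image of `v` itself, and one factor of its norm is
  -- cancelled.
  refine ContinuousLinearMap.opNorm_le_bound _ (by positivity) fun v => ?_
  have h1 := key (Matrix.toEuclideanCLM (𝕜 := ℝ) (meanDeviation Q W Wt i s) v) v
  rw [real_inner_self_eq_norm_sq, abs_of_nonneg (sq_nonneg _)] at h1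
  set z := ‖Matrix.toEuclideanCLM (n := Fin n) (𝕜 := ℝ) (meanDeviation Q W Wt i s) v‖
  have hz : 0 ≤ z := norm_nonneg _
  clear_value z
  rcases hz.eq_or_lt with h | h
  · rw [← h]; positivity
  · refine le_of_mul_le_mul_left ?_ h
    refine le_trans (le_of_eq (by ring)) (h1.trans (le_of_eq (by ring)))

variable [mΩ : MeasurableSpace Ω] {P : Measure Ω} [IsProbabilityMeasure P] {X : ℕ → Ω → S}

/-- Decay of the correlation of the gossip noise with the past. -/
theorem NetworkAssumptions.abs_integral_inner_noise_le (hN : NetworkAssumptions Q π τ G W Wt ρ)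
    (hX : IsStationaryMarkovChain P Q π X) (t i : ℕ) {x y : Ω → Stack n m}
    (hx : StronglyMeasurable[history X t] x) (hy : StronglyMeasurable[history X t] y)
    {C : ℝ} (hxC : ∀ ω, ‖x ω‖ ≤ C) (hyC : ∀ ω, ‖y ω‖ ≤ C) :
    |∫ ω, inner ℝ (y ω) (gossipMap (W (X (t + i) ω) - Wt) (x ω)) ∂P| ≤
      2 * ρ * (1 / 4 : ℝ) ^ (i / τ) * ∫ ω, ‖y ω‖ * ‖x ω‖ ∂P := by
  have hle := hX.history_le t
  have hb : ∀ a b ω, |(inner ℝ (y ω a) (x ω b) : ℝ)| ≤ C * C := fun a b ω => by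
    have h1 : ‖y ω a‖ ≤ C := (PiLp.norm_apply_le (y ω) a).trans (hyC ω)
    have h2 : ‖x ω b‖ ≤ C := (PiLp.norm_apply_le (x ω) b).trans (hxC ω)
    exact (abs_real_inner_le_norm _ _).trans
      (mul_le_mul h1 h2 (norm_nonneg _) ((norm_nonneg _).trans h1))
  have hsm := fun a b => stronglyMeasurable_inner_apply hx hy a b
  have hD1 : ∀ a b s, |(W s - Wt) a b| ≤ ρ := fun a b s => abs_entry_le (hN.deviation s) a b
  have hK : ∀ a b, StronglyMeasurable fun s => ∫ s', (W s' - Wt) a b ∂((Q ^ i) s) := fun a b =>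
    StronglyMeasurable.integral_kernel (hN.measurable_deviation a b).stronglyMeasurable
  have hKb : ∀ a b s, |∫ s', (W s' - Wt) a b ∂((Q ^ i) s)| ≤ ρ := fun a b s => by
    simpa using norm_integral_le_of_norm_le_const (μ := (Q ^ i) s)
      (f := fun s' => (W s' - Wt) a b) (Filter.Eventually.of_forall (hD1 a b))
  have hint : ∀ (h : S → ℝ), Measurable h → (∀ s, |h s| ≤ ρ) → ∀ (j : ℕ) (a b : Fin n),
      Integrable (fun ω => inner ℝ (y ω a) (x ω b) * h (X j ω)) P := by
    intro h hm hh j a b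
    refine Integrable.of_bound (((hsm a b).mono hle).aestronglyMeasurable.mul
      (hm.comp (hX.measurable j)).aestronglyMeasurable) (C * C * ρ)
      (Filter.Eventually.of_forall fun ω => ?_)
    rw [norm_mul]
    exact mul_le_mul (hb a b ω) (hh _) (norm_nonneg _) ((abs_nonneg _).trans (hb a b ω))
  -- The scalar Markov property is applied to each matrix entry; afterwards the entries are
  -- reassembled, so that the operator bound can be used.
  have h1 : ∫ ω, inner ℝ (y ω) (gossipMap (W (X (t + i) ω) - Wt) (x ω)) ∂P =
      ∫ ω, inner ℝ (y ω) (gossipMap (meanDeviation Q W Wt i (X t ω)) (x ω)) ∂P := by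
    simp_rw [inner_gossipMap_eq_sum, mul_comm _ (inner ℝ _ _), meanDeviation, Matrix.of_apply]
    rw [integral_finsetSum _ fun a _ => integrable_finsetSum _ fun b _ =>
        hint _ (hN.measurable_deviation a b) (hD1 a b) (t + i) a b,
      integral_finsetSum _ fun a _ => integrable_finsetSum _ fun b _ =>
        hint _ (hK a b).measurable (hKb a b) t a b]
    refine Finset.sum_congr rfl fun a _ => ?_
    rw [integral_finsetSum _ fun b _ =>
        hint _ (hN.measurable_deviation a b) (hD1 a b) (t + i) a b,
      integral_finsetSum _ fun b _ => hint _ (hK a b).measurable (hKb a b) t a b]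
    refine Finset.sum_congr rfl fun b _ => ?_
    exact hX.integral_mul t i (hsm a b) (hb a b) (hN.measurable_deviation a b) (hD1 a b)
  rw [h1, ← integral_const_mul, ← Real.norm_eq_abs]
  have hxn : AEStronglyMeasurable x P := (hx.mono hle).aestronglyMeasurable
  have hyn : AEStronglyMeasurable y P := (hy.mono hle).aestronglyMeasurable
  refine norm_integral_le_of_norm_le ?_ (Filter.Eventually.of_forall fun ω => ?_)
  · refine Integrable.const_mul ?_ _
    refine Integrable.of_bound (hyn.norm.mul hxn.norm) (C * C)
      (Filter.Eventually.of_forall fun ω => ?_)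
    rw [norm_mul, norm_norm, norm_norm]
    exact mul_le_mul (hyC ω) (hxC ω) (norm_nonneg _) ((norm_nonneg _).trans (hyC ω))
  · calc _ ≤ ‖y ω‖ * ‖gossipMap (meanDeviation Q W Wt i (X t ω)) (x ω)‖ :=
        abs_real_inner_le_norm _ _
      _ ≤ ‖y ω‖ * (2 * ρ * (1 / 4 : ℝ) ^ (i / τ) * ‖x ω‖) := by
        gcongr
        exact norm_gossipMap_le _ (hN.norm_meanDeviation_le i _) _
      _ = _ := by ring

end NoiseCorrelation

/-! ### Bias and second moment of the randomized batch estimator. -/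

section BatchMoments

/-- The terms form blocks of length `τ`, each with a quarter of the sum of its predecessor. -/
theorem sum_geometric_floor_le {τ : ℕ} (hτ : 1 ≤ τ) (D : ℕ) :
    ∑ d ∈ Finset.range D, (1 / 4 : ℝ) ^ (d / τ) ≤ 4 / 3 * τ := by
  induction D using Nat.strong_induction_on with
  | _ D ih =>
    rcases le_or_gt D τ with h | h
    · calc ∑ d ∈ Finset.range D, (1 / 4 : ℝ) ^ (d / τ) ≤ ∑ d ∈ Finset.range D, 1 :=
          Finset.sum_le_sum fun d _ => pow_le_one₀ (by norm_num) (by norm_num)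
        _ = (D : ℝ) := by simp
        _ ≤ τ := by exact_mod_cast h
        _ ≤ _ := by linarith [(Nat.cast_nonneg τ : (0 : ℝ) ≤ τ)]
    · obtain ⟨e, rfl⟩ := Nat.exists_eq_add_of_le h.le
      rw [Finset.sum_range_add]
      have h1 : ∑ d ∈ Finset.range τ, (1 / 4 : ℝ) ^ (d / τ) = τ := by
        rw [Finset.sum_congr rfl fun d hd => by
          rw [Nat.div_eq_of_lt (Finset.mem_range.1 hd), pow_zero]]
        simp
      have h2 : ∑ d ∈ Finset.range e, (1 / 4 : ℝ) ^ ((τ + d) / τ) =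
          1 / 4 * ∑ d ∈ Finset.range e, (1 / 4 : ℝ) ^ (d / τ) := by
        rw [Finset.mul_sum]
        refine Finset.sum_congr rfl fun d _ => ?_
        rw [Nat.add_div_left _ (by omega), pow_succ']
      rw [h1, h2]
      have := ih e (by omega)
      linarith

variable {Ω E : Type*} [MeasurableSpace Ω] {P : Measure Ω} [IsProbabilityMeasure P]
  [NormedAddCommGroup E] [InnerProductSpace ℝ E]

theorem integrable_inner_of_bounded {x y : Ω → E} {C D : ℝ} (hx : AEStronglyMeasurable x P)
    (hy : AEStronglyMeasurable y P) (hxC : ∀ ω, ‖x ω‖ ≤ C) (hyD : ∀ ω, ‖y ω‖ ≤ D) :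
    Integrable (fun ω => (inner ℝ (x ω) (y ω) : ℝ)) P := by
  refine Integrable.of_bound (hx.inner hy) (C * D) (Filter.Eventually.of_forall fun ω => ?_)
  exact (abs_real_inner_le_norm _ _).trans
    (mul_le_mul (hxC ω) (hyD ω) (norm_nonneg _) ((norm_nonneg _).trans (hxC ω)))

theorem integrable_norm_sq_of_bounded {x : Ω → E} {C : ℝ} (hx : AEStronglyMeasurable x P)
    (hxC : ∀ ω, ‖x ω‖ ≤ C) : Integrable (fun ω => ‖x ω‖ ^ 2) P := by
  simp_rw [← real_inner_self_eq_norm_sq]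
  exact integrable_inner_of_bounded hx hx hxC hxC

variable {ζ : ℕ → Ω → E} {C v κ : ℝ} {τ : ℕ} {Y : Ω → E}

/-- The sum of the first `N` noise terms. -/
def noiseSum (ζ : ℕ → Ω → E) (N : ℕ) (ω : Ω) : E := ∑ r ∈ Finset.range N, ζ (r + 1) ω

theorem aestronglyMeasurable_noiseSum (hζ : ∀ r, AEStronglyMeasurable (ζ r) P) (N : ℕ) :
    AEStronglyMeasurable (noiseSum ζ N) P :=
  Finset.aestronglyMeasurable_fun_sum _ fun r _ => hζ (r + 1)

theorem norm_noiseSum_le (hC : ∀ r ω, ‖ζ r ω‖ ≤ C) (N : ℕ) (ω : Ω) :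
    ‖noiseSum ζ N ω‖ ≤ N * C := by
  refine (norm_sum_le_of_le _ fun r _ => hC (r + 1) ω).trans (le_of_eq ?_)
  simp

/-- Geometric decay of correlations makes the variance of a sum linear in its length: a new term
adds `v` and at most `16 / 3 * τ * v` of cross terms. -/
theorem integral_norm_noiseSum_sq_le (hτ : 1 ≤ τ) (hζ : ∀ r, AEStronglyMeasurable (ζ r) P)
    (hC : ∀ r ω, ‖ζ r ω‖ ≤ C) (hv : ∀ r, ∫ ω, ‖ζ r ω‖ ^ 2 ∂P ≤ v)
    (hcorr : ∀ r d, |∫ ω, inner ℝ (ζ r ω) (ζ (r + d) ω) ∂P| ≤ 2 * (1 / 4 : ℝ) ^ (d / τ) * v)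
    (N : ℕ) : ∫ ω, ‖noiseSum ζ N ω‖ ^ 2 ∂P ≤ N * (7 * τ * v) := by
  have hv0 : 0 ≤ v := (integral_nonneg fun ω => sq_nonneg _).trans (hv 0)
  have hτ' : (1 : ℝ) ≤ τ := by exact_mod_cast hτ
  induction N with
  | zero => simp [noiseSum]
  | succ N ih =>
    have hS := aestronglyMeasurable_noiseSum hζ N
    have hSC := norm_noiseSum_le hC N
    have e : ∀ ω, ‖noiseSum ζ (N + 1) ω‖ ^ 2 = ‖noiseSum ζ N ω‖ ^ 2 +
        2 * inner ℝ (noiseSum ζ N ω) (ζ (N + 1) ω) + ‖ζ (N + 1) ω‖ ^ 2 := fun ω => by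
      rw [noiseSum, Finset.sum_range_succ, norm_add_sq_real]; rfl
    have i1 := integrable_norm_sq_of_bounded hS hSC
    have i2 := (integrable_inner_of_bounded hS (hζ (N + 1)) hSC (hC (N + 1))).const_mul 2
    have i3 := integrable_norm_sq_of_bounded (hζ (N + 1)) (hC (N + 1))
    simp_rw [e]
    have i12 : Integrable (fun ω => ‖noiseSum ζ N ω‖ ^ 2 +
        2 * inner ℝ (noiseSum ζ N ω) (ζ (N + 1) ω)) P := i1.add i2
    rw [integral_add i12 i3, integral_add i1 i2, integral_const_mul]
    have hcross : ∫ ω, inner ℝ (noiseSum ζ N ω) (ζ (N + 1) ω) ∂P ≤ 8 / 3 * τ * v := by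
      simp_rw [noiseSum, sum_inner]
      rw [integral_finsetSum _ fun r _ =>
        integrable_inner_of_bounded (hζ _) (hζ _) (hC _) (hC _)]
      -- The lag is lowered from `N - r` to `N - 1 - r`, so that the sum can be reflected on
      -- `Finset.range N`.
      have h1 : ∀ r ∈ Finset.range N, ∫ ω, inner ℝ (ζ (r + 1) ω) (ζ (N + 1) ω) ∂P ≤
          2 * (1 / 4 : ℝ) ^ ((N - 1 - r) / τ) * v := fun r hr => by
        have hr' := Finset.mem_range.1 hr
        have h2 := hcorr (r + 1) (N - r)
        rw [show r + 1 + (N - r) = N + 1 by omega] at h2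
        refine (le_abs_self _).trans (h2.trans ?_)
        have : (1 / 4 : ℝ) ^ ((N - r) / τ) ≤ (1 / 4 : ℝ) ^ ((N - 1 - r) / τ) :=
          pow_le_pow_of_le_one (by norm_num) (by norm_num)
            (Nat.div_le_div_right (by omega))
        gcongr
      refine (Finset.sum_le_sum h1).trans ?_
      rw [← Finset.sum_mul, ← Finset.mul_sum,
        Finset.sum_range_reflect (fun d => (1 / 4 : ℝ) ^ (d / τ)) N]
      have := sum_geometric_floor_le hτ N
      nlinarith
    have h3 := hv (N + 1)
    push_cast
    nlinarith [mul_nonneg hv0 (sub_nonneg.2 hτ')]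

/-- The average of the first `2 ^ j * B` noise terms. -/
def noiseMean (ζ : ℕ → Ω → E) (B j : ℕ) (ω : Ω) : E :=
  ((2 : ℝ) ^ j * B)⁻¹ • noiseSum ζ (2 ^ j * B) ω

/-- The noise of the randomized estimator whose draw is `i`. -/
def estimatorNoise (ζ : ℕ → Ω → E) (B i : ℕ) (ω : Ω) : E :=
  noiseMean ζ B 0 ω + (2 : ℝ) ^ i • (noiseMean ζ B i ω - noiseMean ζ B (i - 1) ω)

/-- The law of the truncated geometric draw on `{0, …, K}`. -/
def truncWeight (K i : ℕ) : ℝ := if i = 0 then (1 / 2) ^ K else (1 / 2) ^ i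

theorem truncWeight_nonneg (K i : ℕ) : 0 ≤ truncWeight K i := by
  rw [truncWeight]; split <;> positivity

theorem sum_truncWeight (K : ℕ) : ∑ i ∈ Finset.range (K + 1), truncWeight K i = 1 := by
  rw [Finset.sum_range_succ']
  simp only [truncWeight, Nat.add_eq_zero_iff, one_ne_zero, and_false, if_false, if_true]
  induction K with
  | zero => simp
  | succ K ih => 
    rw [Finset.sum_range_succ]
    have := pow_succ (1 / 2 : ℝ) K
    linarith

/-- The factor `2 ^ i` cancels the probability of level `i`, and the differences of consecutive
levels telescope. The estimator thus has the bias of the longest batch. -/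
theorem sum_truncWeight_smul_estimatorNoise (ζ : ℕ → Ω → E) (B K : ℕ) (ω : Ω) :
    ∑ i ∈ Finset.range (K + 1), truncWeight K i • estimatorNoise ζ B i ω = noiseMean ζ B K ω := by
  simp only [estimatorNoise, smul_add, Finset.sum_add_distrib]
  rw [← Finset.sum_smul, sum_truncWeight, one_smul, Finset.sum_range_succ']
  have : ∀ i, truncWeight K (i + 1) • (2 : ℝ) ^ (i + 1) •
      (noiseMean ζ B (i + 1) ω - noiseMean ζ B (i + 1 - 1) ω) =
      noiseMean ζ B (i + 1) ω - noiseMean ζ B i ω := fun i => by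
    rw [smul_smul, truncWeight, if_neg (Nat.succ_ne_zero i), ← mul_pow]
    norm_num
  simp_rw [this]
  rw [Finset.sum_range_sub (fun i => noiseMean ζ B i ω)]
  simp

theorem aestronglyMeasurable_noiseMean (hζ : ∀ r, AEStronglyMeasurable (ζ r) P) (B j : ℕ) :
    AEStronglyMeasurable (noiseMean ζ B j) P :=
  (aestronglyMeasurable_noiseSum hζ _).const_smul _

theorem norm_noiseMean_le (hC : ∀ r ω, ‖ζ r ω‖ ≤ C) (B j : ℕ) (ω : Ω) :
    ‖noiseMean ζ B j ω‖ ≤ C := by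
  have hC0 : 0 ≤ C := (norm_nonneg _).trans (hC 0 ω)
  rw [noiseMean, norm_smul, Real.norm_of_nonneg (by positivity)]
  have h := norm_noiseSum_le hC (2 ^ j * B) ω
  push_cast at h
  calc ((2 : ℝ) ^ j * B)⁻¹ * ‖noiseSum ζ (2 ^ j * B) ω‖
      ≤ ((2 : ℝ) ^ j * B)⁻¹ * ((2 : ℝ) ^ j * B * C) := by gcongr
    _ = (((2 : ℝ) ^ j * B)⁻¹ * ((2 : ℝ) ^ j * B)) * C := by ring
    _ ≤ 1 * C := by gcongr; exact inv_mul_le_one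
    _ = C := one_mul C

theorem aestronglyMeasurable_estimatorNoise (hζ : ∀ r, AEStronglyMeasurable (ζ r) P) (B i : ℕ) :
    AEStronglyMeasurable (estimatorNoise ζ B i) P :=
  (aestronglyMeasurable_noiseMean hζ B 0).add
    (((aestronglyMeasurable_noiseMean hζ B i).sub
      (aestronglyMeasurable_noiseMean hζ B (i - 1))).const_smul _)

theorem norm_estimatorNoise_le (hC : ∀ r ω, ‖ζ r ω‖ ≤ C) (B i : ℕ) (ω : Ω) :
    ‖estimatorNoise ζ B i ω‖ ≤ C + 2 ^ i * (C + C) := by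
  refine (norm_add_le _ _).trans (add_le_add (norm_noiseMean_le hC B 0 ω) ?_)
  rw [norm_smul, Real.norm_of_nonneg (by positivity)]
  gcongr
  exact (norm_sub_le _ _).trans (add_le_add (norm_noiseMean_le hC B i ω)
    (norm_noiseMean_le hC B (i - 1) ω))

theorem integral_norm_noiseMean_sq_le (hτ : 1 ≤ τ) (hζ : ∀ r, AEStronglyMeasurable (ζ r) P)
    (hC : ∀ r ω, ‖ζ r ω‖ ≤ C) (hv : ∀ r, ∫ ω, ‖ζ r ω‖ ^ 2 ∂P ≤ v)
    (hcorr : ∀ r d, |∫ ω, inner ℝ (ζ r ω) (ζ (r + d) ω) ∂P| ≤ 2 * (1 / 4 : ℝ) ^ (d / τ) * v)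
    {B : ℕ} (hB : 1 ≤ B) (j : ℕ) :
    ∫ ω, ‖noiseMean ζ B j ω‖ ^ 2 ∂P ≤ (1 / 2) ^ j * (7 * τ * v / B) := by
  have hB' : (0 : ℝ) < B := by exact_mod_cast hB
  have h := integral_norm_noiseSum_sq_le hτ hζ hC hv hcorr (2 ^ j * B)
  simp_rw [noiseMean, norm_smul, mul_pow, Real.norm_eq_abs, sq_abs]
  rw [integral_const_mul]
  push_cast at h
  calc (((2 : ℝ) ^ j * B)⁻¹) ^ 2 * ∫ ω, ‖noiseSum ζ (2 ^ j * B) ω‖ ^ 2 ∂P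
      ≤ (((2 : ℝ) ^ j * B)⁻¹) ^ 2 * ((2 : ℝ) ^ j * B * (7 * τ * v)) := by gcongr
    _ = _ := by
      have e : (1 / 2 : ℝ) ^ j = ((2 : ℝ) ^ j)⁻¹ := by rw [one_div, inv_pow]
      rw [e]; field_simp

/-- At level `i` the squared factor `4 ^ i`, the variance of order `2 ^ (-i)` and the probability `2
^ (-i)` multiply to a constant, so the second moment grows linearly in the number `K` of levels. A
base batch of at least `τ * K` rounds cancels this growth. -/
theorem sum_truncWeight_integral_norm_sq_le (hτ : 1 ≤ τ)
    (hζ : ∀ r, AEStronglyMeasurable (ζ r) P) (hC : ∀ r ω, ‖ζ r ω‖ ≤ C)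
    (hv : ∀ r, ∫ ω, ‖ζ r ω‖ ^ 2 ∂P ≤ v)
    (hcorr : ∀ r d, |∫ ω, inner ℝ (ζ r ω) (ζ (r + d) ω) ∂P| ≤ 2 * (1 / 4 : ℝ) ^ (d / τ) * v)
    {B K : ℕ} (hB : 1 ≤ B) (hK : 1 ≤ K) (hBK : τ * K ≤ B) :
    ∑ i ∈ Finset.range (K + 1), truncWeight K i * ∫ ω, ‖estimatorNoise ζ B i ω‖ ^ 2 ∂P ≤
      98 * v := by
  have hB' : (0 : ℝ) < B := by exact_mod_cast hB
  have hv0 : 0 ≤ v := (integral_nonneg fun ω => sq_nonneg _).trans (hv 0)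
  set D := 7 * τ * v / B with hD
  have hD0 : 0 ≤ D := by positivity
  have hm := fun j => integral_norm_noiseMean_sq_le hτ hζ hC hv hcorr hB j
  rw [← hD] at hm
  have hi := fun j => integrable_norm_sq_of_bounded
    (aestronglyMeasurable_noiseMean hζ B j) (norm_noiseMean_le hC B j)
  have hest : ∀ i, ∫ ω, ‖estimatorNoise ζ B i ω‖ ^ 2 ∂P ≤
      2 * ∫ ω, ‖noiseMean ζ B 0 ω‖ ^ 2 ∂P + 4 * 4 ^ i *
        (∫ ω, ‖noiseMean ζ B i ω‖ ^ 2 ∂P + ∫ ω, ‖noiseMean ζ B (i - 1) ω‖ ^ 2 ∂P) := by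
    intro i
    have hii : Integrable (fun ω => 4 * 4 ^ i *
        (‖noiseMean ζ B i ω‖ ^ 2 + ‖noiseMean ζ B (i - 1) ω‖ ^ 2)) P :=
      ((hi i).add (hi (i - 1))).const_mul _
    rw [← integral_add (hi i) (hi (i - 1)), ← integral_const_mul, ← integral_const_mul,
      ← integral_add ((hi 0).const_mul _) hii]
    refine integral_mono (integrable_norm_sq_of_bounded
      (aestronglyMeasurable_estimatorNoise hζ B i) (norm_estimatorNoise_le hC B i))
      (((hi 0).const_mul _).add hii) fun ω => ?_
    simp only [estimatorNoise]
    have h4 : (4 : ℝ) ^ i = (2 ^ i) ^ 2 := by rw [← pow_mul, mul_comm, pow_mul]; norm_num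
    calc _ ≤ (‖noiseMean ζ B 0 ω‖ +
          2 ^ i * (‖noiseMean ζ B i ω‖ + ‖noiseMean ζ B (i - 1) ω‖)) ^ 2 := by
          gcongr
          refine (norm_add_le _ _).trans (add_le_add le_rfl ?_)
          rw [norm_smul, Real.norm_of_nonneg (by positivity)]
          gcongr
          exact norm_sub_le _ _
      _ ≤ 2 * (‖noiseMean ζ B 0 ω‖ ^ 2 +
          (2 ^ i * (‖noiseMean ζ B i ω‖ + ‖noiseMean ζ B (i - 1) ω‖)) ^ 2) := add_sq_le
      _ = 2 * ‖noiseMean ζ B 0 ω‖ ^ 2 +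
          2 * 4 ^ i * (‖noiseMean ζ B i ω‖ + ‖noiseMean ζ B (i - 1) ω‖) ^ 2 := by rw [h4]; ring
      _ ≤ 2 * ‖noiseMean ζ B 0 ω‖ ^ 2 +
          2 * 4 ^ i * (2 * (‖noiseMean ζ B i ω‖ ^ 2 + ‖noiseMean ζ B (i - 1) ω‖ ^ 2)) := by
          gcongr; exact add_sq_le
      _ = _ := by ring
  -- At level zero the truncated subtraction `0 - 1 = 0` makes the correction vanish.
  have h0 : ∫ ω, ‖estimatorNoise ζ B 0 ω‖ ^ 2 ∂P ≤ 2 * D := by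
    have e : estimatorNoise ζ B 0 = noiseMean ζ B 0 := by
      ext1 ω; simp [estimatorNoise]
    rw [e]
    have := hm 0
    simp only [pow_zero, one_mul] at this
    linarith
  have hsucc : ∀ i, truncWeight K (i + 1) * ∫ ω, ‖estimatorNoise ζ B (i + 1) ω‖ ^ 2 ∂P ≤
      truncWeight K (i + 1) * (2 * D) + 12 * D := by
    intro i
    have h1 := hest (i + 1)
    have h2 := hm 0
    have h3 := hm (i + 1)
    have h4 := hm i
    rw [pow_zero, one_mul] at h2
    rw [Nat.add_sub_cancel] at h1
    have h5 : ∫ ω, ‖estimatorNoise ζ B (i + 1) ω‖ ^ 2 ∂P ≤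
        2 * D + 4 * 4 ^ (i + 1) * ((1 / 2) ^ (i + 1) * D + (1 / 2) ^ i * D) := by
      refine h1.trans ?_
      gcongr
    refine (mul_le_mul_of_nonneg_left h5 (truncWeight_nonneg K _)).trans (le_of_eq ?_)
    rw [mul_add]
    congr 1
    rw [truncWeight, if_neg (Nat.succ_ne_zero i)]
    have e1 : (1 / 2 : ℝ) ^ i = 2 * (1 / 2) ^ (i + 1) := by ring
    have e2 : (1 / 2 : ℝ) ^ (i + 1) * 4 ^ (i + 1) * (1 / 2) ^ (i + 1) = 1 := by
      rw [← mul_pow, ← mul_pow]; norm_num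
    rw [e1]
    linear_combination (12 * D) * e2
  have hfin : ∑ i ∈ Finset.range (K + 1),
      truncWeight K i * ∫ ω, ‖estimatorNoise ζ B i ω‖ ^ 2 ∂P ≤ 2 * D + K * (12 * D) := by
    have hs := sum_truncWeight K
    rw [Finset.sum_range_succ'] at hs ⊢
    have a1 := Finset.sum_le_sum (s := Finset.range K) fun i _ => hsucc i
    rw [Finset.sum_add_distrib, ← Finset.sum_mul, Finset.sum_const, Finset.card_range,
      nsmul_eq_mul] at a1
    have a2 := mul_le_mul_of_nonneg_left h0 (truncWeight_nonneg K 0)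
    have a3 : (∑ i ∈ Finset.range K, truncWeight K (i + 1)) * (2 * D) +
        truncWeight K 0 * (2 * D) = 2 * D := by rw [← add_mul, hs, one_mul]
    linarith
  refine hfin.trans ?_
  have hK' : (1 : ℝ) ≤ K := by exact_mod_cast hK
  have hBK' : (τ : ℝ) * K ≤ B := by exact_mod_cast hBK
  have hKD : K * D ≤ 7 * v := by
    rw [hD, mul_div_assoc', div_le_iff₀ hB']
    nlinarith
  nlinarith

/-- The correlations with a fixed past vector are summable with total of order `τ`, so averaging
divides them by the full length of the batch. -/
theorem abs_integral_inner_noiseMean_le (hτ : 1 ≤ τ) (hζ : ∀ r, AEStronglyMeasurable (ζ r) P)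
    (hC : ∀ r ω, ‖ζ r ω‖ ≤ C) (hY : AEStronglyMeasurable Y P) {D : ℝ} (hYD : ∀ ω, ‖Y ω‖ ≤ D)
    (hκ0 : 0 ≤ κ) (hκ : ∀ r, |∫ ω, inner ℝ (Y ω) (ζ r ω) ∂P| ≤ κ * (1 / 4 : ℝ) ^ (r / τ))
    {B : ℕ} (hB : 1 ≤ B) (j : ℕ) :
    |∫ ω, inner ℝ (Y ω) (noiseMean ζ B j ω) ∂P| ≤ κ * (4 / 3 * τ) / (2 ^ j * B) := by
  simp_rw [noiseMean, inner_smul_right, noiseSum, inner_sum]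
  have hB' : (0 : ℝ) < B := by exact_mod_cast hB
  rw [integral_const_mul, integral_finsetSum _ fun r _ =>
    integrable_inner_of_bounded hY (hζ _) hYD (hC _), abs_mul, abs_of_nonneg (by positivity),
    div_eq_inv_mul]
  gcongr
  refine (Finset.abs_sum_le_sum_abs _ _).trans ?_
  have h1 : ∀ r ∈ Finset.range (2 ^ j * B), |∫ ω, inner ℝ (Y ω) (ζ (r + 1) ω) ∂P| ≤
      κ * (1 / 4 : ℝ) ^ (r / τ) := fun r _ => by
    refine (hκ (r + 1)).trans ?_
    have : (1 / 4 : ℝ) ^ ((r + 1) / τ) ≤ (1 / 4 : ℝ) ^ (r / τ) :=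
      pow_le_pow_of_le_one (by norm_num) (by norm_num) (Nat.div_le_div_right (by omega))
    gcongr
  refine (Finset.sum_le_sum h1).trans ?_
  rw [← Finset.mul_sum]
  gcongr
  exact sum_geometric_floor_le hτ _

theorem sum_truncWeight_integral_inner_le (hτ : 1 ≤ τ) (hζ : ∀ r, AEStronglyMeasurable (ζ r) P)
    (hC : ∀ r ω, ‖ζ r ω‖ ≤ C) (hY : AEStronglyMeasurable Y P) {D : ℝ} (hYD : ∀ ω, ‖Y ω‖ ≤ D)
    (hκ0 : 0 ≤ κ) (hκ : ∀ r, |∫ ω, inner ℝ (Y ω) (ζ r ω) ∂P| ≤ κ * (1 / 4 : ℝ) ^ (r / τ))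
    {B : ℕ} (hB : 1 ≤ B) (K : ℕ) :
    ∑ i ∈ Finset.range (K + 1), truncWeight K i * ∫ ω, inner ℝ (Y ω) (estimatorNoise ζ B i ω) ∂P ≤
      κ * (4 / 3 * τ) / (2 ^ K * B) := by
  have e : ∑ i ∈ Finset.range (K + 1),
      truncWeight K i * ∫ ω, inner ℝ (Y ω) (estimatorNoise ζ B i ω) ∂P =
      ∫ ω, inner ℝ (Y ω) (noiseMean ζ B K ω) ∂P := by
    simp_rw [← sum_truncWeight_smul_estimatorNoise, inner_sum, inner_smul_right]
    rw [integral_finsetSum _ fun i _ => (integrable_inner_of_bounded hY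
      (aestronglyMeasurable_estimatorNoise hζ B i) hYD (norm_estimatorNoise_le hC B i)).const_mul _]
    refine Finset.sum_congr rfl fun i _ => (integral_const_mul _ _).symm
  rw [e]
  exact (le_abs_self _).trans (abs_integral_inner_noiseMean_le hτ hζ hC hY hYD hκ0 hκ hB K)

end BatchMoments

/-! ### Properties of the chosen parameters. -/

section Parameters

/-- The relations between the parameters of accelerated consensus that its analysis uses. -/
structure ConsensusParams.IsTuned (a : ConsensusParams) (lmax l ρ : ℝ) (τ : ℕ) : Prop where
  l_pos : 0 < l
  lmax_pos : 0 < lmax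
  β_pos : 0 < a.β
  β_le_one : a.β ≤ 1
  p_eq : a.p = 1 / 4
  η_eq : a.η = a.β⁻¹
  stepsize : a.p * a.γ = 3 * a.β ^ 2 / l
  θ_eq : (1 - a.β ^ 2 / 4) * a.θ = 1 - a.β / 4
  smooth : lmax * a.β ^ 2 ≤ l / 12
  noise : a.β * ρ ^ 2 ≤ l ^ 2 / 2 ^ 21
  two_le_M : 2 ≤ a.M
  one_le_M : 1 ≤ 2 * a.β * a.M ^ 2
  le_B : τ * Real.logb 2 a.M ≤ a.B

/-- The largest draw that is not truncated. -/
def ConsensusParams.maxDraw (a : ConsensusParams) : ℕ := ⌊Real.logb 2 a.M⌋₊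

/-- The truncation of a draw. -/
def ConsensusParams.clip (a : ConsensusParams) (J : ℕ) : ℕ := if (2 : ℝ) ^ J ≤ a.M then J else 0

theorem consensusParams_beta_sq {c lmax l : ℝ} (ρ : ℝ) (τ : ℕ) (hc : 0 < c) (hl : 0 < l)
    (hm : 0 < lmax) :
    (consensusParams c lmax l ρ τ).β ^ 2 = c * l / (12 * max lmax (ρ ^ 4 / l ^ 3)) := by
  have h : 0 < max lmax (ρ ^ 4 / l ^ 3) := lt_max_of_lt_left hm
  simp only [consensusParams]
  rw [Real.sq_sqrt (by positivity)]
  field_simp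
  norm_num

/-- The stepsize enters only through `β ^ 2 = c * l / (12 * max lmax (ρ ^ 4 / l ^ 3))`. The first
entry of the maximum gives the smoothness condition, the second the noise condition. -/
theorem consensusParams_isTuned {c lmax l ρ : ℝ} (τ : ℕ) (hc : c = (1 / 2) ^ 40) (hl : 0 < l)
    (hm : l ≤ lmax) : (consensusParams c lmax l ρ τ).IsTuned lmax l ρ τ := by
  have hc0 : 0 < c := by rw [hc]; positivity
  have hm0 : 0 < lmax := hl.trans_le hm
  have hβ2 := consensusParams_beta_sq ρ τ hc0 hl hm0
  have hmax : 0 < max lmax (ρ ^ 4 / l ^ 3) := lt_max_of_lt_left hm0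
  have hγ : (consensusParams c lmax l ρ τ).γ = c * (max lmax (ρ ^ 4 / l ^ 3))⁻¹ := rfl
  have hβ0 : 0 < (consensusParams c lmax l ρ τ).β := by
    simp only [consensusParams]
    exact Real.sqrt_pos.2 (by positivity)
  have hη : (consensusParams c lmax l ρ τ).η = 3 * (consensusParams c lmax l ρ τ).β /
      (1 / 4 * l * (consensusParams c lmax l ρ τ).γ) := rfl
  have hθ : (consensusParams c lmax l ρ τ).θ =
      (1 / 4 * (consensusParams c lmax l ρ τ).η⁻¹ - 1) /
      ((consensusParams c lmax l ρ τ).β * (1 / 4) * (consensusParams c lmax l ρ τ).η⁻¹ - 1) := rfl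
  have hp : (consensusParams c lmax l ρ τ).p = 1 / 4 := rfl
  have hM : (consensusParams c lmax l ρ τ).M =
      max 2 (√(1 / 4 * (1 + 2 / (consensusParams c lmax l ρ τ).β))) := rfl
  have hB : (consensusParams c lmax l ρ τ).B =
      ⌈(τ : ℝ) * Real.logb 2 (consensusParams c lmax l ρ τ).M⌉₊ := rfl
  generalize consensusParams c lmax l ρ τ = a at *
  have hγβ : a.γ * l = 12 * a.β ^ 2 := by
    rw [hβ2, hγ]; field_simp
  have hc1 : c ≤ 1 := by rw [hc]; norm_num
  have hsm : lmax * a.β ^ 2 ≤ c * l / 12 := by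
    rw [hβ2, mul_div_assoc', div_le_div_iff₀ (by positivity) (by norm_num)]
    have : lmax ≤ max lmax (ρ ^ 4 / l ^ 3) := le_max_left _ _
    have := mul_le_mul_of_nonneg_left this (by positivity : 0 ≤ c * l * 12)
    linarith
  have hsm' : lmax * a.β ^ 2 ≤ l / 12 := hsm.trans (by
    have := mul_le_mul_of_nonneg_right hc1 hl.le
    linarith)
  have hβ1 : a.β ≤ 1 := by
    have : lmax * a.β ^ 2 ≤ lmax * 1 ^ 2 := by linarith
    exact le_of_sq_le_sq (le_of_mul_le_mul_left this hm0) zero_le_one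
  have hηβ : a.η = a.β⁻¹ := by
    rw [hη]
    have : (1 / 4 * l * a.γ) = 3 * a.β ^ 2 := by linarith
    rw [this]; field_simp
  refine ⟨hl, hm0, hβ0, hβ1, hp, hηβ, ?_, ?_, hsm', ?_, ?_, ?_, ?_⟩
  · rw [hp, eq_div_iff hl.ne']; linarith
  · rw [hθ, hηβ, inv_inv]
    have h1 : a.β * (1 / 4) * a.β - 1 ≠ 0 := by nlinarith
    rw [mul_div_assoc', div_eq_iff h1]
    ring
  -- After squaring this reads `c / 12 ≤ 1 / 2 ^ 42`; it is what forces `c` to be as small as `2 ^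
  -- (-40)`.
  · have h4 : (a.β * ρ ^ 2) ^ 2 ≤ (l ^ 2 / 2 ^ 21) ^ 2 := by
      have h5 : ρ ^ 4 / l ^ 3 * a.β ^ 2 ≤ c * l / 12 := by
        rw [hβ2, mul_div_assoc', div_le_div_iff₀ (by positivity) (by norm_num)]
        have : ρ ^ 4 / l ^ 3 ≤ max lmax (ρ ^ 4 / l ^ 3) := le_max_right _ _
        have := mul_le_mul_of_nonneg_left this (by positivity : 0 ≤ c * l * 12)
        linarith
      rw [div_mul_eq_mul_div, div_le_iff₀ (by positivity)] at h5
      have e : (a.β * ρ ^ 2) ^ 2 = ρ ^ 4 * a.β ^ 2 := by ring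
      rw [e]
      refine h5.trans ?_
      have e2 : c * l / 12 * l ^ 3 = (c / 12) * l ^ 4 := by ring
      have e3 : (l ^ 2 / 2 ^ 21) ^ 2 = (1 / 2 ^ 42) * l ^ 4 := by ring
      rw [e2, e3]
      refine mul_le_mul_of_nonneg_right ?_ (by positivity)
      rw [hc]; norm_num
    exact le_of_sq_le_sq h4 (by positivity)
  · rw [hM]; exact le_max_left _ _
  · have h1 : √(1 / 4 * (1 + 2 / a.β)) ≤ a.M := by rw [hM]; exact le_max_right _ _
    have h2 : 1 / 4 * (1 + 2 / a.β) ≤ a.M ^ 2 := by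
      rw [← Real.sq_sqrt (by positivity : 0 ≤ 1 / 4 * (1 + 2 / a.β))]
      gcongr
    calc (1 : ℝ) ≤ 2 * a.β * (1 / 4 * (1 + 2 / a.β)) := by
          field_simp; linarith
      _ ≤ _ := by gcongr
  · rw [hB]; exact Nat.le_ceil _

variable {a : ConsensusParams} {lmax l ρ : ℝ} {τ : ℕ}

theorem ConsensusParams.IsTuned.two_pow_le_iff (h : a.IsTuned lmax l ρ τ) (i : ℕ) :
    (2 : ℝ) ^ i ≤ a.M ↔ i ≤ a.maxDraw := by
  have hM : 0 < a.M := by linarith [h.two_le_M]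
  rw [ConsensusParams.maxDraw, Nat.le_floor_iff
    (Real.logb_nonneg one_lt_two (by linarith [h.two_le_M])), Real.le_logb_iff_rpow_le one_lt_two hM,
    Real.rpow_natCast]

theorem ConsensusParams.IsTuned.one_le_maxDraw (h : a.IsTuned lmax l ρ τ) : 1 ≤ a.maxDraw := by
  rw [← h.two_pow_le_iff, pow_one]; exact h.two_le_M

theorem ConsensusParams.IsTuned.lt_two_pow (h : a.IsTuned lmax l ρ τ) :
    a.M < 2 ^ (a.maxDraw + 1) := by
  by_contra hlt
  have := (h.two_pow_le_iff (a.maxDraw + 1)).1 (not_lt.1 hlt)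
  omega

theorem ConsensusParams.IsTuned.maxDraw_le (h : a.IsTuned lmax l ρ τ) :
    (a.maxDraw : ℝ) ≤ Real.logb 2 a.M :=
  Nat.floor_le (Real.logb_nonneg one_lt_two (by linarith [h.two_le_M]))

theorem ConsensusParams.IsTuned.mul_maxDraw_le (h : a.IsTuned lmax l ρ τ) :
    τ * a.maxDraw ≤ a.B := by
  have h1 : (τ : ℝ) * a.maxDraw ≤ a.B :=
    (mul_le_mul_of_nonneg_left h.maxDraw_le (Nat.cast_nonneg τ)).trans h.le_B
  exact_mod_cast h1

theorem ConsensusParams.IsTuned.tau_le_B (h : a.IsTuned lmax l ρ τ) : τ ≤ a.B :=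
  (Nat.le_mul_of_pos_right τ h.one_le_maxDraw).trans h.mul_maxDraw_le

theorem ConsensusParams.IsTuned.clip_le (h : a.IsTuned lmax l ρ τ) (J : ℕ) :
    a.clip J ≤ a.maxDraw := by
  rw [ConsensusParams.clip]
  split_ifs with h1
  · exact (h.two_pow_le_iff J).1 h1
  · exact Nat.zero_le _

theorem ConsensusParams.IsTuned.clip_eq (h : a.IsTuned lmax l ρ τ) {J : ℕ} (hJ : J ≤ a.maxDraw) :
    a.clip J = J := by
  rw [ConsensusParams.clip, if_pos ((h.two_pow_le_iff J).2 hJ)]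

end Parameters

/-! ### Dependence on the draws only through their truncation. -/

section Clip

variable {n m : ℕ} {a : ConsensusParams}

/-- A rejected draw behaves like the draw `0`, for which the correction is `g₀ - g₀` because `0 - 1
= 0`. Hence only finitely many values of a draw have to be distinguished. -/
theorem gradEstimate_clip (h2 : 2 ≤ a.M) (W : ℕ → Matrix (Fin n) (Fin n) ℝ) (t J : ℕ)
    (x : Fin n → Vec m) : gradEstimate a W t (a.clip J) x = gradEstimate a W t J x := by
  rw [ConsensusParams.clip]
  split_ifs with h
  · rfl
  · have h1 : (1 : ℝ) ≤ a.M := by linarith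
    simp [gradEstimate, h, h1]

theorem batchRounds_clip (h2 : 2 ≤ a.M) (J : ℕ) : batchRounds a (a.clip J) = batchRounds a J := by
  rw [ConsensusParams.clip]
  split_ifs with h
  · rfl
  · have h1 : (1 : ℝ) ≤ a.M := by linarith
    simp [batchRounds, h, h1]

theorem consensusStep_clip (h2 : 2 ≤ a.M) (W : ℕ → Matrix (Fin n) (Fin n) ℝ) (J : ℕ)
    (s : ConsensusState n m) : consensusStep a W (a.clip J) s = consensusStep a W J s := by
  simp only [consensusStep, gradEstimate_clip h2, batchRounds_clip h2]

theorem consensusRun_congr (h2 : 2 ≤ a.M) (W : ℕ → Matrix (Fin n) (Fin n) ℝ) {J J' : ℕ → ℕ}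
    (v : Fin n → Vec m) (t k : ℕ) (h : ∀ r < k, a.clip (J r) = a.clip (J' r)) :
    consensusRun a W J v t k = consensusRun a W J' v t k := by
  induction k with
  | zero => rfl
  | succ k ih =>
    rw [consensusRun, consensusRun, ih fun r hr => h r (by omega), ← consensusStep_clip h2,
      h k (by omega), consensusStep_clip h2]

theorem agdRun_congr (h2 : 2 ≤ a.M) {γ η : ℝ} {f : Fin n → Vec m → ℝ} {x₀ : Vec m} {T : ℕ}
    (W : ℕ → Matrix (Fin n) (Fin n) ℝ) {J J' : ℕ → ℕ} (k : ℕ)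
    (h : ∀ r < k * T, a.clip (J r) = a.clip (J' r)) :
    agdRun a γ η f x₀ T W J k = agdRun a γ η f x₀ T W J' k := by
  induction k with
  | zero => rfl
  | succ k ih =>
    rw [Nat.succ_mul] at h
    simp only [agdRun]
    rw [ih fun r hr => h r (by omega),
      consensusRun_congr h2 W _ _ T (J' := fun t => J' (k * T + t)) fun r hr => h _ (by omega)]

end Clip

/-! ### The consensus iteration in Nesterov form with additive noise. -/

section Step

variable {n m : ℕ} {a : ConsensusParams} {lmax l ρ : ℝ} {τ : ℕ}

/-- The extrapolated point of an iteration of accelerated consensus. -/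
def extrapolate (a : ConsensusParams) (x xf : Fin n → Vec m) : Fin n → Vec m :=
  a.θ • xf + (1 - a.θ) • x

theorem ConsensusParams.IsTuned.extrapolate_eq (h : a.IsTuned lmax l ρ τ) (x xf : Fin n → Vec m) :
    (1 - a.β ^ 2 / 4) • stack (extrapolate a x xf) =
      (1 - a.β / 4) • stack xf + (a.β / 4 * (1 - a.β)) • stack x := by
  rw [extrapolate, map_add, map_smul, map_smul, smul_add, smul_smul, smul_smul, h.θ_eq, mul_sub,
    h.θ_eq]
  match_scalars <;> ring

theorem ConsensusParams.IsTuned.stack_step_xf (h : a.IsTuned lmax l ρ τ)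
    (W : ℕ → Matrix (Fin n) (Fin n) ℝ) (J : ℕ) (s : ConsensusState n m) :
    stack (consensusStep a W J s).xf = stack (extrapolate a s.x s.xf) -
      (3 * a.β ^ 2 / l) • stack (gradEstimate a W s.time J (extrapolate a s.x s.xf)) := by
  simp only [consensusStep]
  rw [map_sub, map_smul, h.stepsize]
  rfl

/-- The definition of the extrapolated point expresses `xf` through it and `x`. For `p = 1 / 4` and
`η = β⁻¹` this elimination leaves the two-term update analysed in `consensusLyapunov_step_le`. -/
theorem ConsensusParams.IsTuned.stack_step_x (h : a.IsTuned lmax l ρ τ)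
    (W : ℕ → Matrix (Fin n) (Fin n) ℝ) (J : ℕ) (s : ConsensusState n m) :
    stack (consensusStep a W J s).x =
      (1 - a.β) • stack s.x + a.β • stack (extrapolate a s.x s.xf) -
      (3 * a.β / l) • stack (gradEstimate a W s.time J (extrapolate a s.x s.xf)) := by
  have e : (consensusStep a W J s).x = a.η • (consensusStep a W J s).xf + (a.p - a.η) • s.xf +
    ((1 - a.p) * (1 - a.β)) • s.x + ((1 - a.p) * a.β) • extrapolate a s.x s.xf := rfl
  have hx := h.extrapolate_eq s.x s.xf
  rw [e]
  simp only [map_add, map_smul]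
  rw [h.stack_step_xf, h.p_eq, h.η_eq]
  set xg := stack (extrapolate a s.x s.xf)
  set g := stack (gradEstimate a W s.time J (extrapolate a s.x s.xf))
  have hβ := h.β_pos.ne'
  have hβ4 : 1 - a.β / 4 ≠ 0 := by linarith [h.β_le_one]
  have hxf : (a.β⁻¹ - 1 / 4) • stack s.xf =
      (a.β⁻¹ - a.β / 4) • xg - (1 / 4 * (1 - a.β)) • stack s.x := by
    have h1 : (a.β⁻¹ - 1 / 4) • stack s.xf = a.β⁻¹ • ((1 - a.β / 4) • stack s.xf) := by
      rw [smul_smul]; congr 1; field_simp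
    have h2 : (1 - a.β / 4) • stack s.xf =
      (1 - a.β ^ 2 / 4) • xg - (a.β / 4 * (1 - a.β)) • stack s.x := by rw [hx]; abel
    rw [h1, h2, smul_sub, smul_smul, smul_smul]
    congr 2 <;> field_simp
  have h3 : (1 / 4 - a.β⁻¹) • stack s.xf = -((a.β⁻¹ - 1 / 4) • stack s.xf) := by module
  rw [h3, hxf, smul_sub, smul_smul]
  have h4 : a.β⁻¹ * (3 * a.β ^ 2 / l) = 3 * a.β / l := by field_simp
  rw [h4]
  module

theorem sum_Icc_one_eq_sum_range {M : Type*} [AddCommMonoid M] (g : ℕ → M) (N : ℕ) :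
    ∑ i ∈ Finset.Icc 1 N, g i = ∑ i ∈ Finset.range N, g (i + 1) := by
  induction N with
  | zero => simp
  | succ N ih => rw [Finset.sum_Icc_succ_top (by omega), ih, Finset.sum_range_succ]

theorem stack_batchMean {Ω : Type*} (W : ℕ → Ω → Matrix (Fin n) (Fin n) ℝ)
    (Wt : Matrix (Fin n) (Fin n) ℝ) {B : ℕ} (hB : 1 ≤ B) (t j : ℕ) (x : Ω → Fin n → Vec m)
    (ω : Ω) :
    stack (batchMean (fun k => W k ω) B t j (x ω)) = gossipMap Wt (stack (x ω)) +
      noiseMean (fun r ω => gossipMap (W (t + r) ω - Wt) (stack (x ω))) B j ω := by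
  have hN : ((2 : ℝ) ^ j * B) ≠ 0 := by positivity
  rw [batchMean, map_smul, sum_Icc_one_eq_sum_range, map_sum, noiseMean, noiseSum]
  simp_rw [gossipMap_sub, ← gossipMap_stack]
  rw [Finset.sum_sub_distrib, Finset.sum_const, Finset.card_range, smul_sub,
    ← Nat.cast_smul_eq_nsmul ℝ, smul_smul]
  push_cast
  rw [inv_mul_cancel₀ hN, one_smul]
  abel

theorem stack_gradEstimate {Ω : Type*} (W : ℕ → Ω → Matrix (Fin n) (Fin n) ℝ)
    (Wt : Matrix (Fin n) (Fin n) ℝ) (hB : 1 ≤ a.B) (t : ℕ) {J : ℕ} (hJ : (2 : ℝ) ^ J ≤ a.M)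
    (x : Ω → Fin n → Vec m) (ω : Ω) :
    stack (gradEstimate a (fun k => W k ω) t J (x ω)) = gossipMap Wt (stack (x ω)) +
      estimatorNoise (fun r ω => gossipMap (W (t + r) ω - Wt) (stack (x ω))) a.B J ω := by
  rw [gradEstimate, if_pos hJ, map_add, map_smul, map_sub, stack_batchMean W Wt hB,
    stack_batchMean W Wt hB, stack_batchMean W Wt hB, estimatorNoise]
  rw [add_sub_add_left_eq_sub, add_assoc]

end Step

/-! ### Constant shifts and conservation of the mean. -/

section Shift

variable {n m : ℕ} {a : ConsensusParams} {G : ℕ → SimpleGraph (Fin n)}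
  {W : ℕ → Matrix (Fin n) (Fin n) ℝ}

theorem gossip_add_const (hG : ∀ k, IsGossipMatrix (G k) (W k)) (k : ℕ) (x : Fin n → Vec m)
    (b : Vec m) : gossip (W k) (x + fun _ => b) = gossip (W k) x := by
  have h := gossip_const (m := m) (hG k) b
  have e : gossip (W k) (x + fun _ => b) = gossip (W k) x + gossip (W k) fun _ => b := by
    ext1 i; simp [gossip, smul_add, Finset.sum_add_distrib]
  rw [e, h, add_zero]

theorem gradEstimate_add_const (hG : ∀ k, IsGossipMatrix (G k) (W k)) (t J : ℕ)
    (x : Fin n → Vec m) (b : Vec m) :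
    gradEstimate a W t J (x + fun _ => b) = gradEstimate a W t J x := by
  simp only [gradEstimate, batchMean, gossip_add_const hG]

theorem consensusRun_add_const (hG : ∀ k, IsGossipMatrix (G k) (W k)) (J : ℕ → ℕ)
    (v : Fin n → Vec m) (b : Vec m) (t k : ℕ) :
    (consensusRun a W J (v + fun _ => b) t k).x = (consensusRun a W J v t k).x + (fun _ => b) ∧
    (consensusRun a W J (v + fun _ => b) t k).xf = (consensusRun a W J v t k).xf + (fun _ => b) ∧
    (consensusRun a W J (v + fun _ => b) t k).time = (consensusRun a W J v t k).time := by
  induction k with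
  | zero => exact ⟨rfl, rfl, rfl⟩
  | succ k ih =>
    obtain ⟨h1, h2, h3⟩ := ih
    have e : a.θ • ((consensusRun a W J v t k).xf + fun _ => b) +
        (1 - a.θ) • ((consensusRun a W J v t k).x + fun _ => b) =
        (a.θ • (consensusRun a W J v t k).xf + (1 - a.θ) • (consensusRun a W J v t k).x) +
          fun _ => b := by
      module
    simp only [consensusRun, consensusStep, h1, h2, h3, e, gradEstimate_add_const hG]
    refine ⟨?_, ?_, trivial⟩
    · module
    · module

theorem sum_gradEstimate (hW : ∀ k j, ∑ i, W k i j = 0) (t J : ℕ) (x : Fin n → Vec m) :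
    ∑ i, gradEstimate a W t J x i = 0 := by
  have hb : ∀ j, ∑ i, batchMean W a.B t j x i = 0 := fun j => by
    simp only [batchMean, Pi.smul_apply, Finset.sum_apply]
    rw [← Finset.smul_sum, Finset.sum_comm, Finset.sum_eq_zero fun k _ => sum_gossip (hW _) x,
      smul_zero]
  simp only [gradEstimate, Pi.add_apply]
  rw [Finset.sum_add_distrib, hb, zero_add]
  split_ifs
  · simp only [Pi.smul_apply, Pi.sub_apply]
    rw [← Finset.smul_sum, Finset.sum_sub_distrib, hb, hb, sub_zero, smul_zero]
  · simp

theorem consensusRun_sum_eq_zero (hW : ∀ k j, ∑ i, W k i j = 0) (J : ℕ → ℕ)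
    {v : Fin n → Vec m} (hv : ∑ i, v i = 0) (t k : ℕ) :
    ∑ i, (consensusRun a W J v t k).x i = 0 ∧ ∑ i, (consensusRun a W J v t k).xf i = 0 := by
  induction k with
  | zero => exact ⟨hv, hv⟩
  | succ k ih =>
    obtain ⟨h1, h2⟩ := ih
    have h3 := sum_gradEstimate (a := a) (m := m) hW
    simp only [consensusRun, consensusStep, Pi.add_apply, Pi.sub_apply, Pi.smul_apply,
      Finset.sum_add_distrib, Finset.sum_sub_distrib, ← Finset.smul_sum, h1, h2, h3]
    simp

/-- Constants are in the kernel of every gossip matrix, so a run commutes with adding a constant;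
zero column sums keep the mean. It is therefore enough to analyse runs from zero-sum vectors. -/
theorem consensusRun_dev (hn : 0 < n) (hG : ∀ k, IsGossipMatrix (G k) (W k))
    (hW : ∀ k j, ∑ i, W k i j = 0) (J : ℕ → ℕ) (v : Fin n → Vec m) (t k : ℕ) :
    dev (consensusRun a W J v t k).x = (consensusRun a W J (dev v) t k).x ∧
      nodeMean (consensusRun a W J v t k).x = nodeMean v := by
  have e : v = dev v + fun _ => nodeMean v := by rw [dev_eq_sub, sub_add_cancel]
  have h1 := (consensusRun_add_const (a := a) hG J (dev v) (nodeMean v) t k).1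
  rw [← e] at h1
  have h0 : ∑ i, dev v i = 0 := by
    have h1 := nodeMean_dev hn v
    rw [nodeMean_apply] at h1
    exact (smul_eq_zero.1 h1).resolve_left (by positivity)
  have h2 : nodeMean (consensusRun a W J (dev v) t k).x = 0 := by
    rw [nodeMean_apply, (consensusRun_sum_eq_zero hW J h0 t k).1, smul_zero]
  have h3 : nodeMean (consensusRun a W J v t k).x = nodeMean v := by
    rw [h1, map_add, h2, zero_add, nodeMean_const hn]
  refine ⟨?_, h3⟩
  rw [dev_eq_sub, h3, h1]
  abel

end Shift

/-! ### Measurability of one iteration. -/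

section Measurability

variable {n m : ℕ} {Ω : Type*} {mΩ' : MeasurableSpace Ω} {a : ConsensusParams}

theorem measurable_gossip {D : Ω → Matrix (Fin n) (Fin n) ℝ} {x : Ω → Fin n → Vec m}
    (hD : ∀ i j, Measurable fun ω => D ω i j) (hx : Measurable x) :
    Measurable fun ω => gossip (D ω) (x ω) := by
  refine measurable_pi_lambda _ fun i => ?_
  exact Finset.measurable_sum _ fun j _ => (hD i j).smul ((measurable_pi_apply j).comp hx)

theorem measurable_batchMean {W : ℕ → Ω → Matrix (Fin n) (Fin n) ℝ} {x : Ω → Fin n → Vec m}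
    {B t j : ℕ} (hW : ∀ k ≤ t + 2 ^ j * B, ∀ i j, Measurable fun ω => W k ω i j)
    (hx : Measurable x) : Measurable fun ω => batchMean (fun k => W k ω) B t j (x ω) := by
  have h : Measurable fun ω => ∑ k ∈ Finset.Icc 1 (2 ^ j * B), gossip (W (t + k) ω) (x ω) :=
    Finset.measurable_sum _ fun k hk =>
      measurable_gossip (hW _ (by have := (Finset.mem_Icc.1 hk).2; omega)) hx
  exact h.fun_const_smul _

/-- Only matrices up to the end of the rounds paid for are read, so the new iterate is known at the
new network time. -/
theorem measurable_gradEstimate {W : ℕ → Ω → Matrix (Fin n) (Fin n) ℝ} {x : Ω → Fin n → Vec m}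
    {t J : ℕ} (hW : ∀ k ≤ t + batchRounds a J, ∀ i j, Measurable fun ω => W k ω i j)
    (hx : Measurable x) : Measurable fun ω => gradEstimate a (fun k => W k ω) t J (x ω) := by
  have h0 : 1 * a.B ≤ 2 ^ J * a.B := Nat.mul_le_mul_right _ Nat.one_le_two_pow
  have h1 : 2 ^ (J - 1) * a.B ≤ 2 ^ J * a.B :=
    Nat.mul_le_mul_right _ (Nat.pow_le_pow_right (by norm_num) (by omega))
  simp only [gradEstimate]
  simp only [batchRounds] at hW
  split_ifs with h
  · rw [if_pos h] at hW
    refine Measurable.fun_add (measurable_batchMean (fun k hk => hW k ?_) hx)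
      (Measurable.fun_const_smul ((measurable_batchMean (fun k hk => hW k hk) hx).fun_sub
        (measurable_batchMean (fun k hk => hW k ?_) hx)) _)
    · rw [pow_zero] at hk; omega
    · omega
  · rw [if_neg h] at hW
    refine Measurable.fun_add (measurable_batchMean (fun k hk => hW k ?_) hx) measurable_const
    simpa using hk

theorem measurable_consensusStep {W : ℕ → Ω → Matrix (Fin n) (Fin n) ℝ}
    {x xf : Ω → Fin n → Vec m} {t J : ℕ}
    (hW : ∀ k ≤ t + batchRounds a J, ∀ i j, Measurable fun ω => W k ω i j)
    (hx : Measurable x) (hxf : Measurable xf) :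
    (Measurable fun ω => (consensusStep a (fun k => W k ω) J ⟨x ω, xf ω, t⟩).x) ∧
      Measurable fun ω => (consensusStep a (fun k => W k ω) J ⟨x ω, xf ω, t⟩).xf := by
  have hg : Measurable fun ω => a.θ • xf ω + (1 - a.θ) • x ω :=
    (hxf.fun_const_smul _).fun_add (hx.fun_const_smul _)
  have he := measurable_gradEstimate hW hg
  have h2 : Measurable fun ω => (a.θ • xf ω + (1 - a.θ) • x ω) - (a.p * a.γ) •
      gradEstimate a (fun k => W k ω) t J (a.θ • xf ω + (1 - a.θ) • x ω) :=
    hg.fun_sub (he.fun_const_smul _)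
  exact ⟨(((h2.fun_const_smul _).fun_add (hxf.fun_const_smul _)).fun_add
    (hx.fun_const_smul _)).fun_add (hg.fun_const_smul _), h2⟩

theorem continuous_stack : Continuous (stack : (Fin n → Vec m) → Stack n m) :=
  PiLp.continuous_toLp 2 _

theorem stronglyMeasurable_stack {x : Ω → Fin n → Vec m} (hx : Measurable x) :
    StronglyMeasurable fun ω => stack (x ω) :=
  continuous_stack.comp_stronglyMeasurable hx.stronglyMeasurable

end Measurability

/-! ### Measurability of the Lyapunov quantities. -/

section Lyapunov

variable {E Ω : Type*} [NormedAddCommGroup E] [InnerProductSpace ℝ E] {mΩ' : MeasurableSpace Ω}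
  {A : E →ₗ[ℝ] E} {x y z : Ω → E}

theorem _root_.MeasureTheory.StronglyMeasurable.smul_add_smul_sub_smul (hx : StronglyMeasurable x)
    (hy : StronglyMeasurable y) (hz : StronglyMeasurable z) (b c d : ℝ) :
    StronglyMeasurable fun ω => b • x ω + c • y ω - d • z ω :=
  ((hx.const_smul b).add (hy.const_smul c)).sub (hz.const_smul d)

theorem _root_.MeasureTheory.StronglyMeasurable.sub_smul (hx : StronglyMeasurable x) (hy : StronglyMeasurable y)
    (b : ℝ) : StronglyMeasurable fun ω => x ω - b • y ω :=
  hx.sub (hy.const_smul b)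

theorem stronglyMeasurable_lyapunovDual (hA : Continuous A) (l β : ℝ)
    (hx : StronglyMeasurable x) (hy : StronglyMeasurable y) :
    StronglyMeasurable fun ω => lyapunovDual A l β (x ω) (y ω) :=
  ((hx.const_smul _).neg).sub ((hA.comp_stronglyMeasurable hy).const_smul _)

theorem stronglyMeasurable_consensusLyapunov (hA : Continuous A) (l : ℝ)
    (hx : StronglyMeasurable x) (hy : StronglyMeasurable y) :
    StronglyMeasurable fun ω => consensusLyapunov A l (x ω) (y ω) := by
  have hcV : Continuous fun p : E × E => consensusLyapunov A l p.1 p.2 := by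
    simp only [consensusLyapunov]
    fun_prop
  exact hcV.comp_stronglyMeasurable (hx.prodMk hy)

end Lyapunov

/-! ### Uniform bounds on the iterates. -/

section Boundedness

variable {n m : ℕ} {a : ConsensusParams} {w : ℝ}

/-- A sequence of matrices whose gossip operators have norm at most `w`. -/
def BoundedGossip (m : ℕ) (w : ℝ) (W : ℕ → Matrix (Fin n) (Fin n) ℝ) : Prop :=
  ∀ k (x : Stack n m), ‖gossipMap (W k) x‖ ≤ w * ‖x‖

theorem norm_batchMean_le (hw : 0 ≤ w) {W : ℕ → Matrix (Fin n) (Fin n) ℝ}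
    (hW : BoundedGossip m w W) (B t j : ℕ) (x : Fin n → Vec m) :
    ‖stack (batchMean W B t j x)‖ ≤ w * ‖stack x‖ := by
  rw [batchMean, map_smul, map_sum, norm_smul, Real.norm_of_nonneg (by positivity)]
  have h : ‖∑ i ∈ Finset.Icc 1 (2 ^ j * B), stack (gossip (W (t + i)) x)‖ ≤
      (2 : ℝ) ^ j * B * (w * ‖stack x‖) := by
    refine (norm_sum_le _ _).trans ((Finset.sum_le_sum (g := fun _ => w * ‖stack x‖)
      fun i _ => ?_).trans (le_of_eq ?_))
    · rw [← gossipMap_stack]; exact hW _ _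
    · simp
  calc _ ≤ ((2 : ℝ) ^ j * B)⁻¹ * ((2 : ℝ) ^ j * B * (w * ‖stack x‖)) := by gcongr
    _ = (((2 : ℝ) ^ j * B)⁻¹ * ((2 : ℝ) ^ j * B)) * (w * ‖stack x‖) := by ring
    _ ≤ 1 * (w * ‖stack x‖) := by gcongr; exact inv_mul_le_one
    _ = _ := one_mul _

theorem norm_gradEstimate_le (hM : 0 ≤ a.M) (hw : 0 ≤ w) {W : ℕ → Matrix (Fin n) (Fin n) ℝ}
    (hW : BoundedGossip m w W) (t J : ℕ) (x : Fin n → Vec m) :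
    ‖stack (gradEstimate a W t J x)‖ ≤ (1 + 2 * a.M) * (w * ‖stack x‖) := by
  have hb := fun j => norm_batchMean_le hw hW a.B t j x
  have h0 : 0 ≤ w * ‖stack x‖ := by positivity
  rw [gradEstimate, map_add, add_mul, one_mul]
  refine (norm_add_le _ _).trans (add_le_add (hb 0) ?_)
  split_ifs with h
  · rw [map_smul, map_sub, norm_smul, Real.norm_of_nonneg (by positivity)]
    calc _ ≤ a.M * (w * ‖stack x‖ + w * ‖stack x‖) := by
          gcongr
          exact (norm_sub_le _ _).trans (add_le_add (hb _) (hb _))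
      _ = _ := by ring
  · rw [map_zero, norm_zero]; positivity

theorem exists_bound_consensusStep (n m : ℕ) (hM : 0 ≤ a.M) (hw : 0 ≤ w) (D : ℝ) :
    ∃ D', ∀ W : ℕ → Matrix (Fin n) (Fin n) ℝ, BoundedGossip m w W → ∀ (J : ℕ)
      (s : ConsensusState n m), ‖stack s.x‖ ≤ D → ‖stack s.xf‖ ≤ D →
      ‖stack (consensusStep a W J s).x‖ ≤ D' ∧ ‖stack (consensusStep a W J s).xf‖ ≤ D' := by
  have hs : ∀ (c : ℝ) (x : Fin n → Vec m) (D : ℝ), ‖stack x‖ ≤ D → ‖stack (c • x)‖ ≤ |c| * D :=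
    fun c x D h => by rw [map_smul, norm_smul, Real.norm_eq_abs]; gcongr
  have ha : ∀ (x y : Fin n → Vec m) (D D' : ℝ), ‖stack x‖ ≤ D → ‖stack y‖ ≤ D' →
      ‖stack (x + y)‖ ≤ D + D' := fun x y D D' h h' => by
    rw [map_add]; exact (norm_add_le _ _).trans (add_le_add h h')
  have hsub : ∀ (x y : Fin n → Vec m) (D D' : ℝ), ‖stack x‖ ≤ D → ‖stack y‖ ≤ D' →
      ‖stack (x - y)‖ ≤ D + D' := fun x y D D' h h' => by
    rw [map_sub]; exact (norm_sub_le _ _).trans (add_le_add h h')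
  set g := |a.θ| * D + |1 - a.θ| * D with hg
  set f' := g + |a.p * a.γ| * ((1 + 2 * a.M) * (w * g)) with hf'
  refine ⟨max f' (|a.η| * f' + |a.p - a.η| * D + |(1 - a.p) * (1 - a.β)| * D +
    |(1 - a.p) * a.β| * g), fun W hW J s hx hxf => ?_⟩
  have h1 : ‖stack (a.θ • s.xf + (1 - a.θ) • s.x)‖ ≤ g := ha _ _ _ _ (hs _ _ _ hxf) (hs _ _ _ hx)
  have h2 := norm_gradEstimate_le hM hw hW s.time J (a.θ • s.xf + (1 - a.θ) • s.x)
  have h3 : ‖stack (gradEstimate a W s.time J (a.θ • s.xf + (1 - a.θ) • s.x))‖ ≤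
      (1 + 2 * a.M) * (w * g) := h2.trans (by gcongr)
  have h4 : ‖stack (consensusStep a W J s).xf‖ ≤ f' := hsub _ _ _ _ h1 (hs _ _ _ h3)
  refine ⟨le_trans ?_ (le_max_right _ _), h4.trans (le_max_left _ _)⟩
  exact ha _ _ _ _ (ha _ _ _ _ (ha _ _ _ _ (hs _ _ _ h4) (hs _ _ _ hxf)) (hs _ _ _ hx))
    (hs _ _ _ h1)

theorem exists_bound_consensusRun (n m : ℕ) (hM : 0 ≤ a.M) (hw : 0 ≤ w) (D : ℝ) (k : ℕ) :
    ∃ D', ∀ W : ℕ → Matrix (Fin n) (Fin n) ℝ, BoundedGossip m w W → ∀ (J : ℕ → ℕ)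
      (v : Fin n → Vec m) (t : ℕ), ‖stack v‖ ≤ D →
      ‖stack (consensusRun a W J v t k).x‖ ≤ D' ∧ ‖stack (consensusRun a W J v t k).xf‖ ≤ D' := by
  induction k with
  | zero => exact ⟨D, fun W _ J v t hv => ⟨hv, hv⟩⟩
  | succ k ih =>
    obtain ⟨D₁, h₁⟩ := ih
    obtain ⟨D₂, h₂⟩ := exists_bound_consensusStep (a := a) n m hM hw D₁
    exact ⟨D₂, fun W hW J v t hv => h₂ W hW _ _ (h₁ W hW J v t hv).1 (h₁ W hW J v t hv).2⟩

theorem exists_bound_gradients {f : Fin n → Vec m → ℝ} (hf : ∀ i, Continuous (gradient (f i)))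
    (D : ℝ) : ∃ D', ∀ y : Fin n → Vec m, ‖stack y‖ ≤ D →
      ‖stack fun i => gradient (f i) (y i)‖ ≤ D' := by
  have hc : Continuous fun y : Stack n m => ‖stack fun i => gradient (f i) (y i)‖ := by
    refine (continuous_stack.comp (continuous_pi fun i => (hf i).comp ?_)).norm
    fun_prop
  obtain ⟨D', hD'⟩ := (isCompact_closedBall (0 : Stack n m) D).bddAbove_image hc.continuousOn
  refine ⟨D', fun y hy => hD' ⟨stack y, by simpa using hy, rfl⟩⟩

/-- A qualitative bound, uniform over networks and draws; its value is irrelevant. It makes every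
quantity integrable. Continuous gradients are bounded on the compact balls containing the iterates.
-/
theorem exists_bound_agdRun {f : Fin n → Vec m → ℝ} (hf : ∀ i, Continuous (gradient (f i)))
    (hM : 0 ≤ a.M) (hw : 0 ≤ w) (γ η : ℝ) (x₀ : Vec m) (T k : ℕ) :
    ∃ D, ∀ W : ℕ → Matrix (Fin n) (Fin n) ℝ, BoundedGossip m w W → ∀ (J : ℕ → ℕ),
      ‖stack (agdRun a γ η f x₀ T W J k).x‖ ≤ D ∧ ‖stack (agdRun a γ η f x₀ T W J k).y‖ ≤ D := by
  induction k with
  | zero => exact ⟨‖stack fun _ : Fin n => x₀‖, fun W _ J => ⟨le_rfl, le_rfl⟩⟩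
  | succ k ih =>
    obtain ⟨D₁, h₁⟩ := ih
    obtain ⟨D₂, h₂⟩ := exists_bound_gradients hf D₁
    obtain ⟨D₃, h₃⟩ := exists_bound_consensusRun (a := a) n m hM hw D₂ T
    refine ⟨max (D₁ + |γ| * D₃) ((D₁ + |γ| * D₃) + |η| * ((D₁ + |γ| * D₃) + D₁)),
      fun W hW J => ?_⟩
    obtain ⟨hx, hy⟩ := h₁ W hW J
    have hv := (h₃ W hW (fun t => J (k * T + t)) _ (agdRun a γ η f x₀ T W J k).rounds
      (h₂ _ hy)).1
    have hx' : ‖stack (agdRun a γ η f x₀ T W J (k + 1)).x‖ ≤ D₁ + |γ| * D₃ := by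
      simp only [agdRun]
      rw [map_sub, map_smul]
      refine (norm_sub_le _ _).trans (add_le_add hy ?_)
      rw [norm_smul, Real.norm_eq_abs]
      gcongr
    refine ⟨hx'.trans (le_max_left _ _), le_trans ?_ (le_max_right _ _)⟩
    have e : (agdRun a γ η f x₀ T W J (k + 1)).y = (agdRun a γ η f x₀ T W J (k + 1)).x +
      η • ((agdRun a γ η f x₀ T W J (k + 1)).x - (agdRun a γ η f x₀ T W J k).x) := rfl
    rw [e, map_add, map_smul, map_sub]
    refine (norm_add_le _ _).trans (add_le_add hx' ?_)
    rw [norm_smul, Real.norm_eq_abs]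
    gcongr
    exact (norm_sub_le _ _).trans (add_le_add hx' hx)

end Boundedness

/-! ### Contraction of one randomized consensus iteration. -/

section OneStep

variable {n m : ℕ} {S Ω : Type*} [mS : MeasurableSpace S] [mΩ : MeasurableSpace Ω]
  {Q : Kernel S S} [IsMarkovKernel Q] {π : Measure S} [IsProbabilityMeasure π]
  {τ : ℕ} {G : S → SimpleGraph (Fin n)}
  {W : S → Matrix (Fin n) (Fin n) ℝ} {Wt : Matrix (Fin n) (Fin n) ℝ} {ρ : ℝ}
  {P : Measure Ω} [IsProbabilityMeasure P] {X : ℕ → Ω → S} {a : ConsensusParams}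

theorem continuous_gossipMap (D : Matrix (Fin n) (Fin n) ℝ) :
    Continuous (gossipMap D : Stack n m →ₗ[ℝ] Stack n m) :=
  AddMonoidHomClass.continuous_of_bound _ _ (norm_gossipMap_le D le_rfl)

theorem NetworkAssumptions.rho_nonneg (hN : NetworkAssumptions Q π τ G W Wt ρ) :
    0 ≤ ρ := by
  obtain ⟨s⟩ : Nonempty S := π.nonempty_of_neZero
  exact (norm_nonneg _).trans (hN.deviation s)

theorem NetworkAssumptions.boundedGossip (hN : NetworkAssumptions Q π τ G W Wt ρ) (x : ℕ → S) :
    BoundedGossip m (‖Matrix.toEuclideanCLM (n := Fin n) (𝕜 := ℝ) Wt‖ + ρ) fun k => W (x k) := by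
  intro k y
  have e : gossipMap (W (x k)) y = gossipMap Wt y + gossipMap (W (x k) - Wt) y := by
    rw [gossipMap_sub]; abel
  rw [e, add_mul]
  exact (norm_add_le _ _).trans (add_le_add (norm_gossipMap_le _ le_rfl _)
    (norm_gossipMap_le _ (hN.deviation _) _))

/-- The Lyapunov function at a state of the consensus algorithm. -/
def stateLyapunov (Wt : Matrix (Fin n) (Fin n) ℝ) (l : ℝ) (s : ConsensusState n m) : ℝ :=
  consensusLyapunov (gossipMap Wt) l (stack s.x) (stack s.xf)

-- The draw is averaged as a weighted sum while the time `t` stays deterministic. The noiseless step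
-- gains `β / 4`; the bias of the estimator, paired with `lyapunovDual`, and its second moment give
-- back at most `3 * β / 32`.
set_option maxHeartbeats 400000 in
theorem NetworkAssumptions.sum_integral_lyapunov_step_le
    (hN : NetworkAssumptions Q π τ G W Wt ρ) (hX : IsStationaryMarkovChain P Q π X)
    (ha : a.IsTuned (lambdaMax Wt) (lambdaMinPos Wt) ρ τ) {t : ℕ} {x xf : Ω → Fin n → Vec m}
    (hx : Measurable[history X t] x) (hxf : Measurable[history X t] xf) {C : ℝ}
    (hxC : ∀ ω, ‖stack (x ω)‖ ≤ C) (hxfC : ∀ ω, ‖stack (xf ω)‖ ≤ C)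
    (hx0 : ∀ ω, ∑ i, x ω i = 0) (hxf0 : ∀ ω, ∑ i, xf ω i = 0) :
    ∑ i ∈ Finset.range (a.maxDraw + 1), truncWeight a.maxDraw i *
        ∫ ω, stateLyapunov Wt (lambdaMinPos Wt)
          (consensusStep a (fun k => W (X k ω)) i ⟨x ω, xf ω, t⟩) ∂P ≤
      (1 - a.β / 8) *
        ∫ ω, stateLyapunov Wt (lambdaMinPos Wt) (⟨x ω, xf ω, t⟩ : ConsensusState n m) ∂P := by
  obtain ⟨Gt, -, hG⟩ := hN.mean_gossip
  set l := lambdaMinPos Wt with hl_def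
  set lmax := lambdaMax Wt with hm_def
  set A : Stack n m →ₗ[ℝ] Stack n m := gossipMap Wt with hA_def
  have hl := ha.l_pos
  have hβ := ha.β_pos
  have hρ : 0 ≤ ρ := hN.rho_nonneg
  have hτ := hN.one_le_tau
  have hB : 1 ≤ a.B := hτ.trans ha.tau_le_B
  have hsymm : A.IsSymmetric := gossipMap_isSymmetric hN.mean_posSemidef.1
  have hpos : ∀ y, 0 ≤ inner ℝ (A y) y := inner_gossipMap_nonneg hN.mean_posSemidef
  have hmax : ∀ y, inner ℝ (A y) y ≤ lmax * ‖y‖ ^ 2 := inner_gossipMap_le hN.mean_posSemidef.1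
  have hlow : ∀ y : Fin n → Vec m, ∑ i, y i = 0 →
      l * ‖stack y‖ ^ 2 ≤ inner ℝ (A (stack y)) (stack y) :=
    fun y hy => le_inner_gossipMap hN.mean_posSemidef hG y hy
  have hle := hX.history_le t
  -- the extrapolated point
  set xg : Ω → Fin n → Vec m := fun ω => extrapolate a (x ω) (xf ω) with hxg_def
  have hxg : Measurable[history X t] xg := (hxf.fun_const_smul _).fun_add (hx.fun_const_smul _)
  have hxg0 : ∀ ω, ∑ i, xg ω i = 0 := fun ω => by
    simp only [hxg_def, extrapolate, Pi.add_apply, Pi.smul_apply]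
    rw [Finset.sum_add_distrib, ← Finset.smul_sum, ← Finset.smul_sum, hx0, hxf0, smul_zero,
      smul_zero, add_zero]
  set V : Ω → ℝ := fun ω => stateLyapunov Wt l (⟨x ω, xf ω, t⟩ : ConsensusState n m) with hV_def
  have hgV : ∀ ω, ‖stack (xg ω)‖ ^ 2 ≤ V ω := fun ω =>
    norm_sq_extrapolation_le hl hβ ha.β_le_one (hlow _ (hxf0 ω)) (ha.extrapolate_eq _ _)
  -- the noiseless update
  set x1 : Ω → Stack n m := fun ω => (1 - a.β) • stack (x ω) + a.β • stack (xg ω) -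
    (3 * a.β / l) • A (stack (xg ω)) with hx1_def
  set xf1 : Ω → Stack n m := fun ω => stack (xg ω) - (3 * a.β ^ 2 / l) • A (stack (xg ω))
    with hxf1_def
  set V0 : Ω → ℝ := fun ω => consensusLyapunov A l (x1 ω) (xf1 ω) with hV0_def
  have hV0V : ∀ ω, V0 ω ≤ (1 - a.β / 4) * V ω := fun ω =>
    consensusLyapunov_step_le hsymm hpos hmax hl hβ ha.β_le_one ha.smooth (hlow _ (hxg0 ω))
      (ha.extrapolate_eq _ _)
  set Y : Ω → Stack n m := fun ω => lyapunovDual A l a.β (x1 ω) (xf1 ω) with hY_def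
  have hVnn : ∀ ω, 0 ≤ V ω := fun ω => consensusLyapunov_nonneg hpos hl _ _
  have hV0nn : ∀ ω, 0 ≤ V0 ω := fun ω => consensusLyapunov_nonneg hpos hl _ _
  have hV0V' : ∀ ω, V0 ω ≤ V ω := fun ω => (hV0V ω).trans (by nlinarith [hVnn ω])
  have hYV : ∀ ω, ‖Y ω‖ ≤ 6 * a.β / l * √(V ω) := fun ω =>
    (norm_lyapunovDual_le hsymm hpos ha.lmax_pos hmax hl hβ ha.smooth _ _).trans (by
      gcongr; exact hV0V' ω)
  -- measurability
  have hAc : Continuous A := continuous_gossipMap Wt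
  have sx : StronglyMeasurable[history X t] fun ω => stack (x ω) := stronglyMeasurable_stack hx
  have sxf : StronglyMeasurable[history X t] fun ω => stack (xf ω) := stronglyMeasurable_stack hxf
  have sxg : StronglyMeasurable[history X t] fun ω => stack (xg ω) := stronglyMeasurable_stack hxg
  have sAxg : StronglyMeasurable[history X t] fun ω => A (stack (xg ω)) :=
    hAc.comp_stronglyMeasurable sxg
  have sx1 : StronglyMeasurable[history X t] x1 := sx.smul_add_smul_sub_smul sxg sAxg _ _ _
  have sxf1 : StronglyMeasurable[history X t] xf1 := sxg.sub_smul sAxg _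
  have sY : StronglyMeasurable[history X t] Y := stronglyMeasurable_lyapunovDual hAc _ _ sx1 sxf1
  have mV : AEStronglyMeasurable V P :=
    ((stronglyMeasurable_consensusLyapunov hAc l sx sxf).mono hle).aestronglyMeasurable
  have mV0 : AEStronglyMeasurable V0 P :=
    ((stronglyMeasurable_consensusLyapunov hAc l sx1 sxf1).mono hle).aestronglyMeasurable
  -- boundedness
  obtain ⟨D, hD⟩ : ∃ D, ∀ ω, V ω ≤ D := by
    refine ⟨C ^ 2 + 12 / l * (lmax * C ^ 2), fun ω => ?_⟩
    have h1 := hxC ω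
    have h2 := hxfC ω
    have hm0 := ha.lmax_pos.le
    have h3 := hmax (stack (xf ω))
    simp only [hV_def, stateLyapunov, consensusLyapunov]
    gcongr
    exact h3.trans (by gcongr)
  have iV : Integrable V P := Integrable.of_bound mV D
    (Filter.Eventually.of_forall fun ω => by rw [Real.norm_of_nonneg (hVnn ω)]; exact hD ω)
  have iV0 : Integrable V0 P := Integrable.of_bound mV0 D
    (Filter.Eventually.of_forall fun ω => by
      rw [Real.norm_of_nonneg (hV0nn ω)]; exact (hV0V' ω).trans (hD ω))
  have hgD : ∀ ω, ‖stack (xg ω)‖ ≤ √D := fun ω =>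
    Real.le_sqrt_of_sq_le ((hgV ω).trans (hD ω))
  have hYD : ∀ ω, ‖Y ω‖ ≤ 6 * a.β / l * √D := fun ω =>
    (hYV ω).trans (by gcongr; exact hD ω)
  -- the noise
  set ζ : ℕ → Ω → Stack n m := fun r ω => gossipMap (W (X (t + r) ω) - Wt) (stack (xg ω))
    with hζ_def
  have hζb : ∀ r ω, ‖ζ r ω‖ ≤ ρ * ‖stack (xg ω)‖ := fun r ω =>
    norm_gossipMap_le _ (hN.deviation _) _
  have sζ : ∀ r, StronglyMeasurable[history X (t + r)] (ζ r) := fun r => by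
    have h1 : Measurable[history X (t + r)] fun ω =>
        MarkovGossip.gossip (W (X (t + r) ω) - Wt) (xg ω) :=
      measurable_gossip (fun i j => (hN.measurable_deviation i j).comp
        (measurable_history X le_rfl)) (hxg.mono (history_mono X (Nat.le_add_right t r)) le_rfl)
    have h2 := stronglyMeasurable_stack h1
    simp only [hζ_def, gossipMap_stack]
    exact h2
  have mζ : ∀ r, AEStronglyMeasurable (ζ r) P := fun r =>
    ((sζ r).mono (hX.history_le _)).aestronglyMeasurable
  have hζD : ∀ r ω, ‖ζ r ω‖ ≤ ρ * √D := fun r ω => (hζb r ω).trans (by gcongr; exact hgD ω)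
  have mxg : AEStronglyMeasurable (fun ω => stack (xg ω)) P := (sxg.mono hle).aestronglyMeasurable
  have ig := integrable_norm_sq_of_bounded mxg hgD
  set I := ∫ ω, ‖stack (xg ω)‖ ^ 2 ∂P with hI
  have hIV : I ≤ ∫ ω, V ω ∂P := integral_mono ig iV hgV
  have hv : ∀ r, ∫ ω, ‖ζ r ω‖ ^ 2 ∂P ≤ ρ ^ 2 * I := fun r => by
    rw [hI, ← integral_const_mul]
    refine integral_mono (integrable_norm_sq_of_bounded (mζ r) (hζD r)) (ig.const_mul _)
      fun ω => ?_
    simp only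
    rw [← mul_pow]
    gcongr
    exact hζb r ω
  set D' := max (√D) (max (ρ * √D) (6 * a.β / l * √D)) with hD'
  -- The earlier noise term is known at time `t + r`, so it can play the role of the past vector in
  -- the decay of correlations.
  have hcorr : ∀ r d, |∫ ω, inner ℝ (ζ r ω) (ζ (r + d) ω) ∂P| ≤
      2 * (1 / 4 : ℝ) ^ (d / τ) * (ρ ^ 2 * I) := fun r d => by
    have h1 := hN.abs_integral_inner_noise_le hX (t + r) d
      (sxg.mono (history_mono X (Nat.le_add_right t r))) (sζ r) (C := D')
      (fun ω => (hgD ω).trans (le_max_left _ _))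
      (fun ω => (hζD r ω).trans ((le_max_left _ _).trans (le_max_right _ _)))
    rw [add_assoc] at h1
    refine h1.trans ?_
    have h2 : ∫ ω, ‖ζ r ω‖ * ‖stack (xg ω)‖ ∂P ≤ ρ * I := by
      rw [hI, ← integral_const_mul]
      refine integral_mono_of_nonneg (Filter.Eventually.of_forall fun ω => by positivity)
        (ig.const_mul _) (Filter.Eventually.of_forall fun ω => ?_)
      have := mul_le_mul_of_nonneg_right (hζb r ω) (norm_nonneg (stack (xg ω)))
      simp only
      linarith
    calc 2 * ρ * (1 / 4 : ℝ) ^ (d / τ) * ∫ ω, ‖ζ r ω‖ * ‖stack (xg ω)‖ ∂P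
        ≤ 2 * ρ * (1 / 4 : ℝ) ^ (d / τ) * (ρ * I) := by gcongr
      _ = _ := by ring
  -- The correlation of the dual vector with the noise is at most `κ` times the mixing factor, by
  -- `hYV` and `hgV`.
  set κ := 2 * ρ * (6 * a.β / l * ∫ ω, V ω ∂P) with hκ_def
  have hEV : 0 ≤ ∫ ω, V ω ∂P := integral_nonneg hVnn
  have hκ0 : 0 ≤ κ := by positivity
  have hκ : ∀ r, |∫ ω, inner ℝ (Y ω) (ζ r ω) ∂P| ≤ κ * (1 / 4 : ℝ) ^ (r / τ) := fun r => by
    have h1 := hN.abs_integral_inner_noise_le hX t r sxg sY (C := D')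
      (fun ω => (hgD ω).trans (le_max_left _ _))
      (fun ω => (hYD ω).trans ((le_max_right _ _).trans (le_max_right _ _)))
    refine h1.trans ?_
    have h2 : ∫ ω, ‖Y ω‖ * ‖stack (xg ω)‖ ∂P ≤ 6 * a.β / l * ∫ ω, V ω ∂P := by
      rw [← integral_const_mul]
      refine integral_mono_of_nonneg (Filter.Eventually.of_forall fun ω => by positivity)
        (iV.const_mul _) (Filter.Eventually.of_forall fun ω => ?_)
      simp only
      calc ‖Y ω‖ * ‖stack (xg ω)‖ ≤ (6 * a.β / l * √(V ω)) * √(V ω) := by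
            gcongr
            · exact hYV ω
            · exact Real.le_sqrt_of_sq_le (hgV ω)
        _ = 6 * a.β / l * (√(V ω) * √(V ω)) := by ring
        _ = _ := by rw [Real.mul_self_sqrt (hVnn ω)]
    calc 2 * ρ * (1 / 4 : ℝ) ^ (r / τ) * ∫ ω, ‖Y ω‖ * ‖stack (xg ω)‖ ∂P
        ≤ 2 * ρ * (1 / 4 : ℝ) ^ (r / τ) * (6 * a.β / l * ∫ ω, V ω ∂P) := by gcongr
      _ = _ := by rw [hκ_def]; ring
  have mY : AEStronglyMeasurable Y P := (sY.mono hle).aestronglyMeasurable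
  have hsq := sum_truncWeight_integral_norm_sq_le hτ mζ hζD hv hcorr hB ha.one_le_maxDraw
    ha.mul_maxDraw_le
  have hin := sum_truncWeight_integral_inner_le hτ mζ hζD mY hYD hκ0 hκ hB a.maxDraw
  -- a single draw
  have hdraw : ∀ i ∈ Finset.range (a.maxDraw + 1),
      ∫ ω, stateLyapunov Wt l (consensusStep a (fun k => W (X k ω)) i ⟨x ω, xf ω, t⟩) ∂P ≤
        ∫ ω, V0 ω ∂P + 2 * ∫ ω, inner ℝ (Y ω) (estimatorNoise ζ a.B i ω) ∂P +
          18 * a.β ^ 2 / l ^ 2 * ∫ ω, ‖estimatorNoise ζ a.B i ω‖ ^ 2 ∂P := by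
    intro i hi
    have hi' : (2 : ℝ) ^ i ≤ a.M :=
      (ha.two_pow_le_iff i).2 (Nat.lt_succ_iff.1 (Finset.mem_range.1 hi))
    have i1 := (integrable_inner_of_bounded mY (aestronglyMeasurable_estimatorNoise mζ a.B i) hYD
      (norm_estimatorNoise_le hζD a.B i)).const_mul 2
    have i2 := (integrable_norm_sq_of_bounded (aestronglyMeasurable_estimatorNoise mζ a.B i)
      (norm_estimatorNoise_le hζD a.B i)).const_mul (18 * a.β ^ 2 / l ^ 2)
    have i3 : Integrable (fun ω => V0 ω + 2 * inner ℝ (Y ω) (estimatorNoise ζ a.B i ω)) P :=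
      iV0.add i1
    rw [← integral_const_mul, ← integral_const_mul, ← integral_add iV0 i1, ← integral_add i3 i2]
    refine integral_mono_of_nonneg
      (Filter.Eventually.of_forall fun ω => consensusLyapunov_nonneg hpos hl _ _) (i3.add i2)
      (Filter.Eventually.of_forall fun ω => ?_)
    have e := stack_gradEstimate (fun k ω => W (X k ω)) Wt hB t hi' xg ω
    have h1 := consensusLyapunov_noise_le hsymm hmax hl ha.smooth (x1 ω) (xf1 ω)
      (estimatorNoise ζ a.B i ω)
    refine le_trans (le_of_eq ?_) h1
    simp only [stateLyapunov]
    rw [ha.stack_step_x, ha.stack_step_xf]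
    change consensusLyapunov A l ((1 - a.β) • stack (x ω) + a.β • stack (xg ω) -
      (3 * a.β / l) • stack (gradEstimate a (fun k => W (X k ω)) t i (xg ω))) (stack (xg ω) -
      (3 * a.β ^ 2 / l) • stack (gradEstimate a (fun k => W (X k ω)) t i (xg ω))) = _
    rw [e, smul_add, smul_add, ← sub_sub, ← sub_sub]
  have hsum := Finset.sum_le_sum fun i hi =>
    mul_le_mul_of_nonneg_left (hdraw i hi) (truncWeight_nonneg a.maxDraw i)
  refine hsum.trans ?_
  have e1 : ∑ i ∈ Finset.range (a.maxDraw + 1), truncWeight a.maxDraw i *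
      (∫ ω, V0 ω ∂P + 2 * ∫ ω, inner ℝ (Y ω) (estimatorNoise ζ a.B i ω) ∂P +
          18 * a.β ^ 2 / l ^ 2 * ∫ ω, ‖estimatorNoise ζ a.B i ω‖ ^ 2 ∂P) =
      ∫ ω, V0 ω ∂P + 2 * ∑ i ∈ Finset.range (a.maxDraw + 1), truncWeight a.maxDraw i *
        ∫ ω, inner ℝ (Y ω) (estimatorNoise ζ a.B i ω) ∂P +
      18 * a.β ^ 2 / l ^ 2 * ∑ i ∈ Finset.range (a.maxDraw + 1), truncWeight a.maxDraw i *
        ∫ ω, ‖estimatorNoise ζ a.B i ω‖ ^ 2 ∂P := by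
    simp only [mul_add, Finset.sum_add_distrib, Finset.mul_sum]
    rw [← Finset.sum_mul, sum_truncWeight, one_mul]
    congr 1
    · congr 1
      exact Finset.sum_congr rfl fun i _ => by ring
    · exact Finset.sum_congr rfl fun i _ => by ring
  rw [e1]
  have hV0I : ∫ ω, V0 ω ∂P ≤ (1 - a.β / 4) * ∫ ω, V ω ∂P := by
    rw [← integral_const_mul]
    exact integral_mono iV0 (iV.const_mul _) hV0V
  set EV := ∫ ω, V ω ∂P
  -- the bias
  have hbias : κ * (4 / 3 * τ) / (2 ^ a.maxDraw * a.B) ≤ a.β / 32 * EV := by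
    have hM0 : 0 < a.M := by linarith [ha.two_le_M]
    have hB' : (0 : ℝ) < a.B := by exact_mod_cast hB
    have h1 : (τ : ℝ) ≤ a.B := by exact_mod_cast ha.tau_le_B
    have h2 : a.M / 2 ≤ 2 ^ a.maxDraw := by
      have := ha.lt_two_pow; rw [pow_succ] at this; linarith
    have h3 : (τ : ℝ) / (2 ^ a.maxDraw * a.B) ≤ 2 / a.M := by
      rw [div_le_div_iff₀ (by positivity) hM0]
      have := mul_le_mul h1 h2 (by positivity) hB'.le
      linarith
    -- The lower bound `1 ≤ 2 * β * M ^ 2` combined with the noise condition: the longest batch is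
    -- long enough to beat the noise level.
    have h4 : 1024 * ρ ≤ l * a.M := by
      refine le_of_sq_le_sq ?_ (by positivity)
      have k1 : ρ ^ 2 * 1 ≤ ρ ^ 2 * (2 * a.β * a.M ^ 2) := by gcongr; exact ha.one_le_M
      have k2 : a.β * ρ ^ 2 * (2 * a.M ^ 2) ≤ l ^ 2 / 2 ^ 21 * (2 * a.M ^ 2) := by
        gcongr; exact ha.noise
      nlinarith
    calc κ * (4 / 3 * τ) / (2 ^ a.maxDraw * a.B)
        = κ * (4 / 3) * (τ / (2 ^ a.maxDraw * a.B)) := by ring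
      _ ≤ κ * (4 / 3) * (2 / a.M) := by gcongr
      _ = (32 * ρ / (l * a.M)) * (a.β * EV) := by rw [hκ_def]; field_simp; ring
      _ ≤ (1 / 32) * (a.β * EV) := by
        refine mul_le_mul_of_nonneg_right ?_ (mul_nonneg hβ.le hEV)
        rw [div_le_div_iff₀ (by positivity) (by norm_num)]
        linarith
      _ = _ := by ring
  -- the variance
  have hvar : 18 * a.β ^ 2 / l ^ 2 * (98 * (ρ ^ 2 * I)) ≤ a.β / 32 * EV := by
    calc 18 * a.β ^ 2 / l ^ 2 * (98 * (ρ ^ 2 * I))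
        = 1764 * a.β / l ^ 2 * (a.β * ρ ^ 2) * I := by ring
      _ ≤ 1764 * a.β / l ^ 2 * (l ^ 2 / 2 ^ 21) * EV := by
        gcongr
        exact ha.noise
      _ = 1764 / 2 ^ 21 * (a.β * EV) := by field_simp
      _ ≤ 1 / 32 * (a.β * EV) := by
        refine mul_le_mul_of_nonneg_right ?_ (mul_nonneg hβ.le hEV)
        norm_num
      _ = _ := by ring
  have hsq' := mul_le_mul_of_nonneg_left hsq (by positivity : 0 ≤ 18 * a.β ^ 2 / l ^ 2)
  have := mul_nonneg hβ.le hEV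
  -- The budget: `1 - β / 4`, plus twice `β / 32` for the bias, plus `β / 32` for the variance, is
  -- at most `1 - β / 8`.
  nlinarith

end OneStep

/-! ### Averaging over the random draws. -/

section Randomization

variable {S Ω : Type*} [mS : MeasurableSpace S] [mΩ : MeasurableSpace Ω]
  {P : Measure Ω} [IsProbabilityMeasure P] {X : ℕ → Ω → S} {J : ℕ → Ω → ℕ}
  {a : ConsensusParams} {lmax l ρ : ℝ} {τ : ℕ}

/-- The positive values keep their geometric weights; the mass of the value `0` is whatever remains.
-/
theorem IsIIDGeometric.measureReal_clip (ha : a.IsTuned lmax l ρ τ) (hJ : IsIIDGeometric P J)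
    (k i : ℕ) (hi : i ≤ a.maxDraw) :
    P.real {ω | a.clip (J k ω) = i} = truncWeight a.maxDraw i := by
  have hpos : ∀ i, 1 ≤ i → i ≤ a.maxDraw →
      P.real {ω | a.clip (J k ω) = i} = truncWeight a.maxDraw i := by
    intro i h1 hK
    have e : {ω | a.clip (J k ω) = i} = {ω | J k ω = i} := by
      ext ω
      simp only [Set.mem_ofPred_eq]
      refine ⟨fun h => ?_, fun h => by rw [h, ha.clip_eq hK]⟩
      rw [ConsensusParams.clip] at h
      split_ifs at h <;> omega
    rw [e, hJ.law k i h1, truncWeight, if_neg (by omega)]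
  rcases Nat.eq_zero_or_pos i with rfl | h1
  · have hm : Measurable fun ω => a.clip (J k ω) := (measurable_of_countable a.clip).comp
      (hJ.measurable k)
    have hsum : ∑ i ∈ Finset.range (a.maxDraw + 1), P.real {ω | a.clip (J k ω) = i} = 1 := by
      have h := sum_measureReal_preimage_singleton (μ := P) (f := fun ω => a.clip (J k ω))
        (Finset.range (a.maxDraw + 1)) fun i _ => hm (measurableSet_singleton i)
      refine h.trans ?_
      rw [show (fun ω => a.clip (J k ω)) ⁻¹' ↑(Finset.range (a.maxDraw + 1)) = Set.univ from ?_,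
        probReal_univ]
      ext ω
      simpa using Nat.lt_succ_of_le (ha.clip_le _)
    rw [← sum_truncWeight a.maxDraw, Finset.sum_range_succ', Finset.sum_range_succ'] at hsum
    rw [Finset.sum_congr rfl fun i hi => hpos (i + 1) (by omega)
      (by have := Finset.mem_range.1 hi; omega)] at hsum
    exact add_left_cancel hsum
  · exact hpos i h1 hi

/-- The sequence of draws with given first terms. -/
def drawSeq {K R : ℕ} (h : Fin R → Fin (K + 1)) (r : ℕ) : ℕ :=
  if hr : r < R then h ⟨r, hr⟩ else 0

theorem drawSeq_snoc {K R : ℕ} (h : Fin R → Fin (K + 1)) (i : Fin (K + 1)) (r : ℕ)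
    (hr : r < R + 1) :
    drawSeq (Fin.snoc h i : Fin (R + 1) → Fin (K + 1)) r = Function.update (drawSeq h) R i r := by
  rcases Nat.lt_succ_iff_lt_or_eq.1 hr with h1 | rfl
  · rw [Function.update_of_ne h1.ne, drawSeq, drawSeq, dif_pos hr, dif_pos h1]
    exact congrArg _ (Fin.snoc_castSucc (α := fun _ => Fin (K + 1)) i h ⟨r, h1⟩)
  · rw [Function.update_self, drawSeq, dif_pos hr]
    exact congrArg _ (Fin.snoc_last (α := fun _ => Fin (K + 1)) i h)

theorem IsIIDGeometric.measureReal_forall_clip (ha : a.IsTuned lmax l ρ τ)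
    (hJ : IsIIDGeometric P J) {R : ℕ} (h : Fin R → Fin (a.maxDraw + 1)) :
    P.real {ω | ∀ r : Fin R, a.clip (J r ω) = h r} = ∏ r, truncWeight a.maxDraw (h r) := by
  have h1 := hJ.indep.measure_inter_preimage_eq_mul (Finset.range R)
    (sets := fun r => {j | a.clip j = drawSeq h r}) fun _ _ => MeasurableSet.of_discrete
  have e : (⋂ r ∈ Finset.range R, J r ⁻¹' {j | a.clip j = drawSeq h r}) =
      {ω | ∀ r : Fin R, a.clip (J r ω) = h r} := by
    ext ω
    simp only [Finset.mem_range, Set.mem_iInter, Set.mem_preimage, Set.mem_ofPred_eq]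
    refine ⟨fun H r => ?_, fun H r hr => ?_⟩
    · rw [H r r.2, drawSeq, dif_pos r.2]
    · rw [drawSeq, dif_pos hr]; exact H ⟨r, hr⟩
  rw [e] at h1
  rw [Measure.real, h1, ENNReal.toReal_prod, Finset.prod_range]
  refine Finset.prod_congr rfl fun r _ => ?_
  rw [← hJ.measureReal_clip ha r (h r) (Nat.lt_succ_iff.1 (h r).2), Measure.real]
  congr 2
  ext ω
  simp [drawSeq]

variable {F : (ℕ → ℕ) → Ω → ℝ} {R : ℕ}

/-- The sample space is partitioned by the first `R` truncated draws. On each piece the draws are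
constant, and the piece is independent of the network, so the integral factors. -/
theorem IsIIDGeometric.integral_randomized (ha : a.IsTuned lmax l ρ τ) (hJ : IsIIDGeometric P J)
    (hXJ : IndepFun (fun ω k => X k ω) (fun ω k => J k ω) P)
    (hF : ∀ j, Measurable[MeasurableSpace.comap (fun ω k => X k ω) MeasurableSpace.pi] (F j))
    (hFi : ∀ j, Integrable (F j) P)
    (hR : ∀ j j' ω, (∀ r < R, a.clip (j r) = a.clip (j' r)) → F j ω = F j' ω) :
    Integrable (fun ω => F (fun k => J k ω) ω) P ∧
      ∫ ω, F (fun k => J k ω) ω ∂P = ∑ h : Fin R → Fin (a.maxDraw + 1),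
        (∏ r, truncWeight a.maxDraw (h r)) * ∫ ω, F (drawSeq h) ω ∂P := by
  set E : (Fin R → Fin (a.maxDraw + 1)) → Set Ω := fun h => {ω | ∀ r : Fin R, a.clip (J r ω) = h r}
    with hE_def
  have hE' : ∀ h, MeasurableSet[MeasurableSpace.comap (fun ω k => J k ω) MeasurableSpace.pi]
      (E h) := fun h => by
    refine ⟨{j | ∀ r : Fin R, a.clip (j r) = h r}, ?_, rfl⟩
    simp only [Set.ofPred_forall]
    exact MeasurableSet.iInter fun r => measurableSet_eq_fun
      ((measurable_of_countable a.clip).comp (measurable_pi_apply _)) measurable_const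
  have hJm : MeasurableSpace.comap (fun ω k => J k ω) MeasurableSpace.pi ≤ mΩ :=
    (measurable_pi_lambda _ hJ.measurable).comap_le
  have hE : ∀ h, MeasurableSet (E h) := fun h => hJm _ (hE' h)
  have hpt : ∀ ω, F (fun k => J k ω) ω =
      ∑ h : Fin R → Fin (a.maxDraw + 1), (E h).indicator 1 ω * F (drawSeq h) ω := by
    intro ω
    set h₀ : Fin R → Fin (a.maxDraw + 1) :=
      fun r => ⟨a.clip (J r ω), Nat.lt_succ_of_le (ha.clip_le _)⟩ with hh₀
    rw [Finset.sum_eq_single h₀]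
    · have : ω ∈ E h₀ := fun r => rfl
      rw [Set.indicator_of_mem this, Pi.one_apply, one_mul]
      refine hR _ _ ω fun r hr => ?_
      simp only [drawSeq, dif_pos hr, hh₀]
      rw [ha.clip_eq (ha.clip_le _)]
    · intro h _ hne
      have : ω ∉ E h := fun H => hne (funext fun r => Fin.ext (H r).symm)
      rw [Set.indicator_of_notMem this, zero_mul]
    · simp
  have hind : ∀ h, IndepFun ((E h).indicator (1 : Ω → ℝ)) (F (drawSeq h)) P := fun h => by
    refine (IndepFun_iff_Indep _ _ _).2 ?_
    refine indep_of_indep_of_le_left (indep_of_indep_of_le_right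
      ((IndepFun_iff_Indep _ _ _).1 hXJ.symm) (hF _).comap_le) ?_
    have h1 : Measurable[MeasurableSpace.comap (fun ω k => J k ω) MeasurableSpace.pi]
        ((E h).indicator (1 : Ω → ℝ)) := Measurable.indicator (@measurable_const _ _ _ (_) 1) (hE' h)
    exact h1.comap_le
  have hi1 : ∀ h, Integrable ((E h).indicator (1 : Ω → ℝ)) P := fun h =>
    (integrable_const (1 : ℝ)).indicator (hE h)
  have hi : ∀ h, Integrable (fun ω => (E h).indicator (1 : Ω → ℝ) ω * F (drawSeq h) ω) P :=
    fun h => (hind h).integrable_mul (hi1 h) (hFi _)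
  simp_rw [hpt]
  refine ⟨integrable_finsetSum _ fun h _ => hi h, ?_⟩
  rw [integral_finsetSum _ fun h _ => hi h]
  refine Finset.sum_congr rfl fun h _ => ?_
  have := (hind h).integral_mul_eq_mul_integral (hi1 h).aestronglyMeasurable
    (hFi _).aestronglyMeasurable
  refine this.trans ?_
  rw [integral_indicator_one (hE h), hJ.measureReal_forall_clip ha]

theorem prod_truncWeight_nonneg {K R : ℕ} (h : Fin R → Fin (K + 1)) :
    0 ≤ ∏ r, truncWeight K (h r) := Finset.prod_nonneg fun _ _ => truncWeight_nonneg _ _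

/-- A bound on the average over one more draw, valid for all values of the preceding draws, holds
for random draws. -/
theorem IsIIDGeometric.integral_succ_le {F' : (ℕ → ℕ) → Ω → ℝ} {q : ℝ}
    (ha : a.IsTuned lmax l ρ τ) (hJ : IsIIDGeometric P J)
    (hXJ : IndepFun (fun ω k => X k ω) (fun ω k => J k ω) P)
    (hF : ∀ j, Measurable[MeasurableSpace.comap (fun ω k => X k ω) MeasurableSpace.pi] (F j))
    (hFi : ∀ j, Integrable (F j) P)
    (hR : ∀ j j' ω, (∀ r < R + 1, a.clip (j r) = a.clip (j' r)) → F j ω = F j' ω)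
    (hF' : ∀ j, Measurable[MeasurableSpace.comap (fun ω k => X k ω) MeasurableSpace.pi] (F' j))
    (hFi' : ∀ j, Integrable (F' j) P)
    (hR' : ∀ j j' ω, (∀ r < R, a.clip (j r) = a.clip (j' r)) → F' j ω = F' j' ω)
    (hle : ∀ j, ∑ i ∈ Finset.range (a.maxDraw + 1), truncWeight a.maxDraw i *
      ∫ ω, F (Function.update j R i) ω ∂P ≤ q * ∫ ω, F' j ω ∂P) :
    ∫ ω, F (fun k => J k ω) ω ∂P ≤ q * ∫ ω, F' (fun k => J k ω) ω ∂P := by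
  rw [(hJ.integral_randomized ha hXJ hF hFi hR).2,
    (hJ.integral_randomized ha hXJ hF' hFi' hR').2,
    ← (Fin.snocEquiv fun _ => Fin (a.maxDraw + 1)).sum_comp, Fintype.sum_prod_type_right,
    Finset.mul_sum]
  refine Finset.sum_le_sum fun h _ => ?_
  -- The product weight splits into that of the first `R` draws and that of the last one.
  have e : ∀ i : Fin (a.maxDraw + 1),
      (∏ r, truncWeight a.maxDraw (Fin.snocEquiv (fun _ => Fin (a.maxDraw + 1)) (i, h) r)) *
        ∫ ω, F (drawSeq (Fin.snocEquiv (fun _ => Fin (a.maxDraw + 1)) (i, h))) ω ∂P =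
      (∏ r, truncWeight a.maxDraw (h r)) * (truncWeight a.maxDraw i *
        ∫ ω, F (Function.update (drawSeq h) R i) ω ∂P) := by
    intro i
    have e1 : Fin.snocEquiv (fun _ => Fin (a.maxDraw + 1)) (i, h) =
      (Fin.snoc h i : Fin (R + 1) → Fin (a.maxDraw + 1)) := rfl
    rw [e1, Fin.prod_univ_castSucc]
    simp only [Fin.snoc_castSucc, Fin.snoc_last]
    rw [mul_assoc]
    congr 3
    ext ω
    exact hR _ _ ω fun r hr => by rw [drawSeq_snoc h i r hr]
  simp_rw [e]
  rw [← Finset.mul_sum, mul_left_comm]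
  refine mul_le_mul_of_nonneg_left ?_ (prod_truncWeight_nonneg h)
  have := hle (drawSeq h)
  rwa [Finset.sum_range] at this

end Randomization

/-! ### Trajectories with given network and draws. -/

section Runs

variable {n m : ℕ} {a : ConsensusParams} {f : Fin n → Vec m → ℝ}

/-- The local gradients at the node variables. -/
def localGradients (f : Fin n → Vec m → ℝ) (y : Fin n → Vec m) : Fin n → Vec m :=
  fun i => gradient (f i) (y i)

/-- The state after `t` iterations of the consensus phase of iteration `k` of the decentralized
method, started from `g`. -/
def consensusPhase (a : ConsensusParams) (γ η : ℝ) (f : Fin n → Vec m → ℝ) (x₀ : Vec m) (T : ℕ)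
    (W : ℕ → Matrix (Fin n) (Fin n) ℝ) (J : ℕ → ℕ) (k : ℕ) (g : Fin n → Vec m) (t : ℕ) :
    ConsensusState n m :=
  consensusRun a W (fun r => J (k * T + r)) g (agdRun a γ η f x₀ T W J k).rounds t

/-- The averaged gradients produced at iteration `k` of the decentralized method. -/
def consensusOutput (a : ConsensusParams) (γ η : ℝ) (f : Fin n → Vec m → ℝ) (x₀ : Vec m) (T : ℕ)
    (W : ℕ → Matrix (Fin n) (Fin n) ℝ) (J : ℕ → ℕ) (k : ℕ) : Fin n → Vec m :=
  (consensusPhase a γ η f x₀ T W J k (localGradients f (agdRun a γ η f x₀ T W J k).y) T).x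

/-- The Lyapunov function along the deviations in a consensus phase. -/
def phaseLyapunov (Wt : Matrix (Fin n) (Fin n) ℝ) (l : ℝ) (a : ConsensusParams) (γ η : ℝ)
    (f : Fin n → Vec m → ℝ) (x₀ : Vec m) (T : ℕ)
    (W : ℕ → Matrix (Fin n) (Fin n) ℝ) (J : ℕ → ℕ) (k t : ℕ) : ℝ :=
  stateLyapunov Wt l (consensusPhase a γ η f x₀ T W J k
    (dev (localGradients f (agdRun a γ η f x₀ T W J k).y)) t)

theorem sum_dev (hn : 0 < n) (v : Fin n → Vec m) : ∑ i, dev v i = 0 := by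
  have h1 := nodeMean_dev hn v
  rw [nodeMean_apply] at h1
  exact (smul_eq_zero.1 h1).resolve_left (by positivity)

theorem consensusRun_time (W : ℕ → Matrix (Fin n) (Fin n) ℝ) (J : ℕ → ℕ) (v : Fin n → Vec m)
    (t k : ℕ) :
    (consensusRun a W J v t k).time = t + ∑ r ∈ Finset.range k, batchRounds a (J r) := by
  induction k with
  | zero => rfl
  | succ k ih => rw [Finset.sum_range_succ, ← add_assoc, ← ih]; rfl

/-- The network time depends on the draws alone, not on the network. For frozen draws it is
deterministic. -/
theorem agdRun_rounds {γ η : ℝ} {x₀ : Vec m} {T : ℕ} (W : ℕ → Matrix (Fin n) (Fin n) ℝ)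
    (J : ℕ → ℕ) (k : ℕ) :
    (agdRun a γ η f x₀ T W J k).rounds = ∑ r ∈ Finset.range (k * T), batchRounds a (J r) := by
  induction k with
  | zero => simp [agdRun]
  | succ k ih => rw [Nat.succ_mul, Finset.sum_range_add, ← ih]; exact consensusRun_time _ _ _ _ _

theorem agdRun_grads {γ η : ℝ} {x₀ : Vec m} {T : ℕ} (W : ℕ → Matrix (Fin n) (Fin n) ℝ)
    (J : ℕ → ℕ) (k : ℕ) : (agdRun a γ η f x₀ T W J k).grads = k := by
  induction k with
  | zero => rfl
  | succ k ih => exact congrArg (· + 1) ih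

theorem consensusPhase_congr (h2 : 2 ≤ a.M) {γ η : ℝ} {x₀ : Vec m} {T : ℕ}
    (W : ℕ → Matrix (Fin n) (Fin n) ℝ) {J J' : ℕ → ℕ} (k t : ℕ) (g : Fin n → Vec m)
    (h : ∀ r < k * T + t, a.clip (J r) = a.clip (J' r)) :
    consensusPhase a γ η f x₀ T W J k g t = consensusPhase a γ η f x₀ T W J' k g t := by
  rw [consensusPhase, consensusPhase, agdRun_congr h2 W k fun r hr => h r (by omega)]
  exact consensusRun_congr h2 W _ _ t fun r hr => h _ (by omega)

theorem consensusOutput_congr (h2 : 2 ≤ a.M) {γ η : ℝ} {x₀ : Vec m} {T : ℕ}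
    (W : ℕ → Matrix (Fin n) (Fin n) ℝ) {J J' : ℕ → ℕ} (k : ℕ)
    (h : ∀ r < (k + 1) * T, a.clip (J r) = a.clip (J' r)) :
    consensusOutput a γ η f x₀ T W J k = consensusOutput a γ η f x₀ T W J' k := by
  rw [Nat.succ_mul] at h
  rw [consensusOutput, consensusOutput, consensusPhase_congr h2 W k T _ h,
    agdRun_congr h2 W k fun r hr => h r (by omega)]

theorem phaseLyapunov_congr {Wt : Matrix (Fin n) (Fin n) ℝ} {l : ℝ} (h2 : 2 ≤ a.M) {γ η : ℝ}
    {x₀ : Vec m} {T : ℕ} (W : ℕ → Matrix (Fin n) (Fin n) ℝ) {J J' : ℕ → ℕ} (k t : ℕ)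
    (h : ∀ r < k * T + t, a.clip (J r) = a.clip (J' r)) :
    phaseLyapunov Wt l a γ η f x₀ T W J k t = phaseLyapunov Wt l a γ η f x₀ T W J' k t := by
  rw [phaseLyapunov, phaseLyapunov, consensusPhase_congr h2 W k t _ h,
    agdRun_congr h2 W k fun r hr => h r (by omega)]

end Runs

/-! ### Adaptedness of the runs for frozen draws. -/

section RandomRuns

variable {n m : ℕ} {S Ω : Type*} [mS : MeasurableSpace S] [mΩ : MeasurableSpace Ω]
  {Q : Kernel S S} [IsMarkovKernel Q] {π : Measure S} [IsProbabilityMeasure π]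
  {τ : ℕ} {G : S → SimpleGraph (Fin n)}
  {W : S → Matrix (Fin n) (Fin n) ℝ} {Wt : Matrix (Fin n) (Fin n) ℝ} {ρ : ℝ}
  {P : Measure Ω} [IsProbabilityMeasure P] {X : ℕ → Ω → S} {a : ConsensusParams}
  {f : Fin n → Vec m → ℝ} {γ η : ℝ} {x₀ : Vec m} {T : ℕ}

theorem measurable_localGradients (hf : ∀ i, Continuous (gradient (f i))) :
    Measurable (localGradients f) :=
  measurable_pi_lambda _ fun i => (hf i).measurable.comp (measurable_pi_apply i)

theorem measurable_dev : Measurable (dev : (Fin n → Vec m) → Fin n → Vec m) := by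
  refine measurable_pi_lambda _ fun i => ?_
  simp only [dev_apply, nodeMean_apply]
  exact (measurable_pi_apply i).fun_sub
    ((Finset.measurable_sum _ fun j _ => measurable_pi_apply j).fun_const_smul _)

theorem measurable_consensusRun (hW : ∀ i j, Measurable fun s => W s i j) (J : ℕ → ℕ)
    {v : Ω → Fin n → Vec m} {t : ℕ} (hv : Measurable[history X t] v) (k : ℕ) :
    (Measurable[history X (t + ∑ r ∈ Finset.range k, batchRounds a (J r))] fun ω =>
      (consensusRun a (fun k => W (X k ω)) J (v ω) t k).x) ∧
    Measurable[history X (t + ∑ r ∈ Finset.range k, batchRounds a (J r))] fun ω =>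
      (consensusRun a (fun k => W (X k ω)) J (v ω) t k).xf := by
  induction k with
  | zero => exact ⟨hv, hv⟩
  | succ k ih =>
    rw [Finset.sum_range_succ, ← add_assoc]
    set t' := t + ∑ r ∈ Finset.range k, batchRounds a (J r) with ht'
    have hm := history_mono X (Nat.le_add_right t' (batchRounds a (J k)))
    have h := measurable_consensusStep (a := a) (mΩ' := history X (t' + batchRounds a (J k)))
      (W := fun k ω => W (X k ω)) (t := t') (J := J k)
      (fun r hr i j => (hW i j).comp (measurable_history X hr))
      (ih.1.mono hm le_rfl) (ih.2.mono hm le_rfl)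
    have e : ∀ ω, consensusRun a (fun k => W (X k ω)) J (v ω) t (k + 1) =
        consensusStep a (fun k => W (X k ω)) (J k)
          ⟨(consensusRun a (fun k => W (X k ω)) J (v ω) t k).x,
            (consensusRun a (fun k => W (X k ω)) J (v ω) t k).xf, t'⟩ := fun ω => by
      rw [ht', ← consensusRun_time (a := a) (fun k => W (X k ω)) J (v ω) t k]
      rfl
    simp_rw [e]
    exact h

theorem measurable_agdRun (hW : ∀ i j, Measurable fun s => W s i j)
    (hf : ∀ i, Continuous (gradient (f i))) (J : ℕ → ℕ) (k : ℕ) :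
    (Measurable[history X (∑ r ∈ Finset.range (k * T), batchRounds a (J r))] fun ω =>
      (agdRun a γ η f x₀ T (fun k => W (X k ω)) J k).x) ∧
    Measurable[history X (∑ r ∈ Finset.range (k * T), batchRounds a (J r))] fun ω =>
      (agdRun a γ η f x₀ T (fun k => W (X k ω)) J k).y := by
  induction k with
  | zero => exact ⟨measurable_const, measurable_const⟩
  | succ k ih =>
    rw [Nat.succ_mul, Finset.sum_range_add]
    set t := ∑ r ∈ Finset.range (k * T), batchRounds a (J r) with ht
    have hv := (measurable_consensusRun (a := a) (X := X) hW (fun r => J (k * T + r))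
      ((measurable_localGradients hf).comp ih.2) T).1
    have hm := history_mono X (Nat.le_add_right t
      (∑ r ∈ Finset.range T, batchRounds a (J (k * T + r))))
    have e : ∀ ω, (agdRun a γ η f x₀ T (fun k => W (X k ω)) J (k + 1)).x =
        (agdRun a γ η f x₀ T (fun k => W (X k ω)) J k).y - γ •
          (consensusRun a (fun k => W (X k ω)) (fun r => J (k * T + r))
            (localGradients f (agdRun a γ η f x₀ T (fun k => W (X k ω)) J k).y) t T).x :=
      fun ω => by rw [ht, ← agdRun_rounds (a := a) (f := f) (γ := γ) (η := η) (x₀ := x₀)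
        (fun k => W (X k ω)) J k]; rfl
    have hx : Measurable[history X (t + ∑ r ∈ Finset.range T, batchRounds a (J (k * T + r)))]
        fun ω => (agdRun a γ η f x₀ T (fun k => W (X k ω)) J (k + 1)).x := by
      simp_rw [e]
      exact (ih.2.mono hm le_rfl).fun_sub (hv.fun_const_smul γ)
    exact ⟨hx, hx.fun_add ((hx.fun_sub (ih.1.mono hm le_rfl)).fun_const_smul η)⟩

theorem measurable_consensusPhase (hW : ∀ i j, Measurable fun s => W s i j)
    {J : ℕ → ℕ} {k : ℕ} {g : Ω → Fin n → Vec m}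
    (hg : Measurable[history X (∑ r ∈ Finset.range (k * T), batchRounds a (J r))] g) (t : ℕ) :
    (Measurable[history X (∑ r ∈ Finset.range (k * T + t), batchRounds a (J r))] fun ω =>
      (consensusPhase a γ η f x₀ T (fun k => W (X k ω)) J k (g ω) t).x) ∧
    Measurable[history X (∑ r ∈ Finset.range (k * T + t), batchRounds a (J r))] fun ω =>
      (consensusPhase a γ η f x₀ T (fun k => W (X k ω)) J k (g ω) t).xf := by
  rw [Finset.sum_range_add]
  simp only [consensusPhase, agdRun_rounds]
  exact measurable_consensusRun hW (fun r => J (k * T + r)) hg t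

end RandomRuns

/-! ### Contraction over a whole consensus phase. -/

section Contraction

variable {n m : ℕ} {S Ω : Type*} [mS : MeasurableSpace S] [mΩ : MeasurableSpace Ω]
  {Q : Kernel S S} [IsMarkovKernel Q] {π : Measure S} [IsProbabilityMeasure π]
  {τ : ℕ} {G : S → SimpleGraph (Fin n)}
  {W : S → Matrix (Fin n) (Fin n) ℝ} {Wt : Matrix (Fin n) (Fin n) ℝ} {ρ : ℝ}
  {P : Measure Ω} [IsProbabilityMeasure P] {X : ℕ → Ω → S} {J : ℕ → Ω → ℕ}
  {a : ConsensusParams} {f : Fin n → Vec m → ℝ} {γ η lmax l : ℝ} {x₀ : Vec m} {T : ℕ}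

/-- A bounded function of the network and of `R` truncated draws. -/
structure IsFiniteDraw (X : ℕ → Ω → S) (a : ConsensusParams) (R : ℕ) (F : (ℕ → ℕ) → Ω → ℝ) :
    Prop where
  measurable : ∀ j, Measurable[MeasurableSpace.comap (fun ω k => X k ω) MeasurableSpace.pi] (F j)
  bounded : ∃ C, ∀ j ω, |F j ω| ≤ C
  congr : ∀ j j' ω, (∀ r < R, a.clip (j r) = a.clip (j' r)) → F j ω = F j' ω

theorem IsFiniteDraw.integrable {R : ℕ} {F : (ℕ → ℕ) → Ω → ℝ} (hF : IsFiniteDraw X a R F)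
    (hX : ∀ k, Measurable (X k)) (j : ℕ → ℕ) : Integrable (F j) P := by
  obtain ⟨C, hC⟩ := hF.bounded
  exact Integrable.of_bound ((hF.measurable j).mono
    (measurable_pi_lambda _ hX).comap_le le_rfl).aestronglyMeasurable C
    (Filter.Eventually.of_forall fun ω => hC j ω)

theorem IsFiniteDraw.integrable_draw {R : ℕ} {F : (ℕ → ℕ) → Ω → ℝ} (hF : IsFiniteDraw X a R F)
    (hX : ∀ k, Measurable (X k)) (ha : a.IsTuned lmax l ρ τ) (hJ : IsIIDGeometric P J)
    (hXJ : IndepFun (fun ω k => X k ω) (fun ω k => J k ω) P) :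
    Integrable (fun ω => F (fun k => J k ω) ω) P :=
  (hJ.integral_randomized ha hXJ hF.measurable (hF.integrable hX) hF.congr).1

theorem NetworkAssumptions.isFiniteDraw_norm_sq_localGradients
    (hN : NetworkAssumptions Q π τ G W Wt ρ) (ha : a.IsTuned lmax l ρ τ)
    (hf : ∀ i, Continuous (gradient (f i))) (k : ℕ) :
    IsFiniteDraw X a (k * T) fun j ω => ‖stack (localGradients f
      (agdRun a γ η f x₀ T (fun k => W (X k ω)) j k).y)‖ ^ 2 := by
  have hM : 0 ≤ a.M := by linarith [ha.two_le_M]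
  have hw : 0 ≤ ‖Matrix.toEuclideanCLM (n := Fin n) (𝕜 := ℝ) Wt‖ + ρ :=
    add_nonneg (norm_nonneg _) hN.rho_nonneg
  refine ⟨fun j => ?_, ?_, fun j j' ω h => ?_⟩
  · have h := (measurable_localGradients hf).comp
      (measurable_agdRun (a := a) (γ := γ) (η := η) (x₀ := x₀) (T := T) (X := X)
        hN.measurable hf j k).2
    exact ((stronglyMeasurable_stack h).norm.measurable.pow_const 2).mono
      (history_le_comap X _) le_rfl
  · obtain ⟨D, hD⟩ := exists_bound_agdRun (a := a) hf hM hw γ η x₀ T k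
    obtain ⟨D', hD'⟩ := exists_bound_gradients hf D
    refine ⟨D' ^ 2, fun j ω => ?_⟩
    rw [abs_of_nonneg (sq_nonneg _)]
    have := hD' _ (hD _ (hN.boundedGossip fun k => X k ω) j).2
    gcongr
    exact this
  · rw [agdRun_congr ha.two_le_M _ k h]

theorem NetworkAssumptions.isFiniteDraw_norm_sq_dev_output
    (hN : NetworkAssumptions Q π τ G W Wt ρ) (ha : a.IsTuned lmax l ρ τ) (hn : 0 < n)
    (hf : ∀ i, Continuous (gradient (f i))) (k : ℕ) :
    IsFiniteDraw X a ((k + 1) * T) fun j ω => ‖stack (dev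
      (consensusOutput a γ η f x₀ T (fun k => W (X k ω)) j k))‖ ^ 2 := by
  have hM : 0 ≤ a.M := by linarith [ha.two_le_M]
  have hw : 0 ≤ ‖Matrix.toEuclideanCLM (n := Fin n) (𝕜 := ℝ) Wt‖ + ρ :=
    add_nonneg (norm_nonneg _) hN.rho_nonneg
  refine ⟨fun j => ?_, ?_, fun j j' ω h => ?_⟩
  · have h := (measurable_localGradients hf).comp
      (measurable_agdRun (a := a) (γ := γ) (η := η) (x₀ := x₀) (T := T) (X := X)
        hN.measurable hf j k).2
    have h2 := measurable_dev.comp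
      (measurable_consensusPhase (a := a) (γ := γ) (η := η) (x₀ := x₀) (f := f) hN.measurable h T).1
    exact ((stronglyMeasurable_stack h2).norm.measurable.pow_const 2).mono
      (history_le_comap X _) le_rfl
  · obtain ⟨D, hD⟩ := exists_bound_agdRun (a := a) hf hM hw γ η x₀ T k
    obtain ⟨D', hD'⟩ := exists_bound_gradients hf D
    obtain ⟨D₂, hD₂⟩ := exists_bound_consensusRun (a := a) n m hM hw D' T
    refine ⟨D₂ ^ 2, fun j ω => ?_⟩
    rw [abs_of_nonneg (sq_nonneg _)]
    have := (hD₂ _ (hN.boundedGossip fun k => X k ω) (fun r => j (k * T + r)) _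
      (agdRun a γ η f x₀ T (fun k => W (X k ω)) j k).rounds
      (hD' _ (hD _ (hN.boundedGossip fun k => X k ω) j).2)).1
    gcongr
    exact (norm_stack_dev_le hn _).trans this
  · rw [consensusOutput_congr ha.two_le_M _ k h]

theorem NetworkAssumptions.isFiniteDraw_comp_agdRun
    (hN : NetworkAssumptions Q π τ G W Wt ρ) (ha : a.IsTuned lmax l ρ τ)
    (hf : ∀ i, Continuous (gradient (f i))) {h : Vec m → ℝ} (hh : Continuous h) (k : ℕ)
    (i : Fin n) :
    IsFiniteDraw X a (k * T) fun j ω => h ((agdRun a γ η f x₀ T (fun k => W (X k ω)) j k).x i) := by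
  have hM : 0 ≤ a.M := by linarith [ha.two_le_M]
  have hw : 0 ≤ ‖Matrix.toEuclideanCLM (n := Fin n) (𝕜 := ℝ) Wt‖ + ρ :=
    add_nonneg (norm_nonneg _) hN.rho_nonneg
  refine ⟨fun j => ?_, ?_, fun j j' ω h => ?_⟩
  · have h := hh.measurable.comp ((measurable_pi_apply i).comp
      (measurable_agdRun (a := a) (γ := γ) (η := η) (x₀ := x₀) (T := T) (X := X)
        hN.measurable hf j k).1)
    exact h.mono (history_le_comap X _) le_rfl
  · obtain ⟨D, hD⟩ := exists_bound_agdRun (a := a) hf hM hw γ η x₀ T k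
    obtain ⟨C, hC⟩ := (isCompact_closedBall (0 : Vec m) D).exists_bound_of_continuousOn
      hh.continuousOn
    refine ⟨C, fun j ω => hC _ ?_⟩
    have := (hD _ (hN.boundedGossip fun k => X k ω) j).1
    simpa using (norm_apply_le_norm_stack _ i).trans this
  · rw [agdRun_congr ha.two_le_M _ k h]

theorem NetworkAssumptions.isFiniteDraw_phaseLyapunov
    (hN : NetworkAssumptions Q π τ G W Wt ρ) (ha : a.IsTuned (lambdaMax Wt) l ρ τ)
    (hn : 0 < n) (hf : ∀ i, Continuous (gradient (f i))) (k t : ℕ) :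
    IsFiniteDraw X a (k * T + t) fun j ω =>
      phaseLyapunov Wt l a γ η f x₀ T (fun k => W (X k ω)) j k t := by
  have hM : 0 ≤ a.M := by linarith [ha.two_le_M]
  have hw : 0 ≤ ‖Matrix.toEuclideanCLM (n := Fin n) (𝕜 := ℝ) Wt‖ + ρ :=
    add_nonneg (norm_nonneg _) hN.rho_nonneg
  refine ⟨fun j => ?_, ?_, fun j j' ω h => phaseLyapunov_congr ha.two_le_M _ k t h⟩
  · have h := measurable_dev.comp ((measurable_localGradients hf).comp
      (measurable_agdRun (a := a) (γ := γ) (η := η) (x₀ := x₀) (T := T) (X := X)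
        hN.measurable hf j k).2)
    have h2 := measurable_consensusPhase (a := a) (γ := γ) (η := η) (x₀ := x₀) (f := f)
      hN.measurable h t
    exact (stronglyMeasurable_consensusLyapunov (continuous_gossipMap Wt) l
      (stronglyMeasurable_stack h2.1) (stronglyMeasurable_stack h2.2)).measurable.mono
      (history_le_comap X _) le_rfl
  · obtain ⟨D, hD⟩ := exists_bound_agdRun (a := a) hf hM hw γ η x₀ T k
    obtain ⟨D', hD'⟩ := exists_bound_gradients hf D
    obtain ⟨D₂, hD₂⟩ := exists_bound_consensusRun (a := a) n m hM hw D' t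
    refine ⟨D₂ ^ 2 + 12 / l * (lambdaMax Wt * D₂ ^ 2), fun j ω => ?_⟩
    have hl := ha.l_pos
    have hm0 := ha.lmax_pos.le
    obtain ⟨h1, h2⟩ := hD₂ _ (hN.boundedGossip fun k => X k ω) (fun r => j (k * T + r)) _
      (agdRun a γ η f x₀ T (fun k => W (X k ω)) j k).rounds
      ((norm_stack_dev_le hn _).trans (hD' _ (hD _ (hN.boundedGossip fun k => X k ω) j).2))
    have h3 := inner_gossipMap_le (m := m) hN.mean_posSemidef.1
    rw [phaseLyapunov, stateLyapunov, abs_of_nonneg (consensusLyapunov_nonneg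
      (inner_gossipMap_nonneg hN.mean_posSemidef) hl _ _), consensusLyapunov]
    gcongr
    · exact h1
    · exact (h3 _).trans (by gcongr; exact h2)

/-- The one-step bound holds for every frozen past of draws, with only the current draw averaged;
`IsIIDGeometric.integral_succ_le` lifts it to random draws. -/
theorem NetworkAssumptions.integral_phaseLyapunov_succ_le (hn : 0 < n)
    (hN : NetworkAssumptions Q π τ G W Wt ρ) (hX : IsStationaryMarkovChain P Q π X)
    (ha : a.IsTuned (lambdaMax Wt) (lambdaMinPos Wt) ρ τ) (hJ : IsIIDGeometric P J)
    (hXJ : IndepFun (fun ω k => X k ω) (fun ω k => J k ω) P)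
    (hf : ∀ i, Continuous (gradient (f i))) (k t : ℕ) :
    ∫ ω, phaseLyapunov Wt (lambdaMinPos Wt) a γ η f x₀ T (fun k => W (X k ω))
        (fun k => J k ω) k (t + 1) ∂P ≤
      (1 - a.β / 8) * ∫ ω, phaseLyapunov Wt (lambdaMinPos Wt) a γ η f x₀ T
        (fun k => W (X k ω)) (fun k => J k ω) k t ∂P := by
  have hM : 0 ≤ a.M := by linarith [ha.two_le_M]
  have hw : 0 ≤ ‖Matrix.toEuclideanCLM (n := Fin n) (𝕜 := ℝ) Wt‖ + ρ :=
    add_nonneg (norm_nonneg _) hN.rho_nonneg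
  have h0 := hN.isFiniteDraw_phaseLyapunov (X := X) (γ := γ) (η := η) (x₀ := x₀) (T := T)
    ha hn hf k t
  have h1 := hN.isFiniteDraw_phaseLyapunov (X := X) (γ := γ) (η := η) (x₀ := x₀) (T := T)
    ha hn hf k (t + 1)
  refine hJ.integral_succ_le (R := k * T + t)
    (F := fun j ω => phaseLyapunov Wt (lambdaMinPos Wt) a γ η f x₀ T
      (fun k => W (X k ω)) j k (t + 1))
    (F' := fun j ω => phaseLyapunov Wt (lambdaMinPos Wt) a γ η f x₀ T
      (fun k => W (X k ω)) j k t)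
    ha hXJ h1.measurable (h1.integrable hX.measurable) h1.congr
    h0.measurable (h0.integrable hX.measurable) h0.congr fun j => ?_
  set g : Ω → Fin n → Vec m := fun ω => dev (localGradients f
    (agdRun a γ η f x₀ T (fun k => W (X k ω)) j k).y) with hg_def
  have hg : Measurable[history X (∑ r ∈ Finset.range (k * T), batchRounds a (j r))] g :=
    measurable_dev.comp ((measurable_localGradients hf).comp
      (measurable_agdRun (a := a) (γ := γ) (η := η) (x₀ := x₀) (T := T) (X := X)
        hN.measurable hf j k).2)
  have hm := measurable_consensusPhase (a := a) (γ := γ) (η := η) (x₀ := x₀) (f := f)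
    hN.measurable hg t
  obtain ⟨D, hD⟩ := exists_bound_agdRun (a := a) hf hM hw γ η x₀ T k
  obtain ⟨D', hD'⟩ := exists_bound_gradients hf D
  obtain ⟨D₂, hD₂⟩ := exists_bound_consensusRun (a := a) n m hM hw D' t
  have hb := fun ω => hD₂ _ (hN.boundedGossip fun k => X k ω) (fun r => j (k * T + r)) (g ω)
      (agdRun a γ η f x₀ T (fun k => W (X k ω)) j k).rounds
      ((norm_stack_dev_le hn _).trans (hD' _ (hD _ (hN.boundedGossip fun k => X k ω) j).2))
  have hz := fun ω => consensusRun_sum_eq_zero (a := a) (W := fun k => W (X k ω))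
    (fun k i => hN.colSum _ i) (fun r => j (k * T + r)) (sum_dev hn (localGradients f
    (agdRun a γ η f x₀ T (fun k => W (X k ω)) j k).y))
    (agdRun a γ η f x₀ T (fun k => W (X k ω)) j k).rounds t
  have hmain := hN.sum_integral_lyapunov_step_le hX ha hm.1 hm.2 (fun ω => (hb ω).1)
    (fun ω => (hb ω).2) (fun ω => (hz ω).1) (fun ω => (hz ω).2)
  refine le_trans (le_of_eq ?_) (hmain.trans (le_of_eq ?_))
  · refine Finset.sum_congr rfl fun i _ => ?_
    congr 2
    ext ω
    -- Changing the current draw does not affect the state before it.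
    have hc : ∀ r < k * T + t, a.clip (Function.update j (k * T + t) i r) = a.clip (j r) :=
      fun r hr => by rw [Function.update_of_ne hr.ne]
    have e1 : consensusPhase a γ η f x₀ T (fun k => W (X k ω)) (Function.update j (k * T + t) i) k
        (g ω) (t + 1) = consensusStep a (fun k => W (X k ω)) i
          (consensusPhase a γ η f x₀ T (fun k => W (X k ω)) j k (g ω) t) := by
      rw [← consensusPhase_congr ha.two_le_M _ k t _ hc]
      simp only [consensusPhase, consensusRun, Function.update_self]
    rw [phaseLyapunov, agdRun_congr ha.two_le_M _ k fun r hr => hc r (by omega)]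
    change stateLyapunov Wt _ (consensusPhase a γ η f x₀ T (fun k => W (X k ω))
      (Function.update j (k * T + t) i) k (g ω) (t + 1)) = _
    rw [e1]
    congr 2
    have ht : (consensusPhase a γ η f x₀ T (fun k => W (X k ω)) j k (g ω) t).time =
        ∑ r ∈ Finset.range (k * T + t), batchRounds a (j r) := by
      rw [consensusPhase, consensusRun_time, agdRun_rounds, Finset.sum_range_add]
    rw [← ht]
  · rfl

theorem NetworkAssumptions.integral_phaseLyapunov_le (hn : 0 < n)
    (hN : NetworkAssumptions Q π τ G W Wt ρ) (hX : IsStationaryMarkovChain P Q π X)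
    (ha : a.IsTuned (lambdaMax Wt) (lambdaMinPos Wt) ρ τ) (hJ : IsIIDGeometric P J)
    (hXJ : IndepFun (fun ω k => X k ω) (fun ω k => J k ω) P)
    (hf : ∀ i, Continuous (gradient (f i))) (k t : ℕ) :
    ∫ ω, phaseLyapunov Wt (lambdaMinPos Wt) a γ η f x₀ T (fun k => W (X k ω))
        (fun k => J k ω) k t ∂P ≤
      (1 - a.β / 8) ^ t * ∫ ω, phaseLyapunov Wt (lambdaMinPos Wt) a γ η f x₀ T
        (fun k => W (X k ω)) (fun k => J k ω) k 0 ∂P := by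
  induction t with
  | zero => simp
  | succ t ih =>
    rw [pow_succ', mul_assoc]
    refine (hN.integral_phaseLyapunov_succ_le hn hX ha hJ hXJ hf k t).trans ?_
    gcongr
    linarith [ha.β_le_one]

/-- The deviation of the output is the output of the run from the deviation, so the contraction
applies; the factor `1 + 12 * χ` compares the initial Lyapunov function with the squared norm. -/
theorem NetworkAssumptions.integral_norm_sq_dev_output_le (hn : 0 < n)
    (hN : NetworkAssumptions Q π τ G W Wt ρ) (hX : IsStationaryMarkovChain P Q π X)
    (ha : a.IsTuned (lambdaMax Wt) (lambdaMinPos Wt) ρ τ) (hJ : IsIIDGeometric P J)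
    (hXJ : IndepFun (fun ω k => X k ω) (fun ω k => J k ω) P)
    (hf : ∀ i, Continuous (gradient (f i))) (k : ℕ) :
    ∫ ω, ‖stack (dev (consensusOutput a γ η f x₀ T (fun k => W (X k ω))
        (fun k => J k ω) k))‖ ^ 2 ∂P ≤
      (1 + 12 * condNumber Wt) * (1 - a.β / 8) ^ T * ∫ ω, ‖stack (localGradients f
        (agdRun a γ η f x₀ T (fun k => W (X k ω)) (fun k => J k ω) k).y)‖ ^ 2 ∂P := by
  have hl := ha.l_pos
  have hm := ha.lmax_pos
  have hpos := inner_gossipMap_nonneg (m := m) hN.mean_posSemidef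
  have iV := fun t => (hN.isFiniteDraw_phaseLyapunov (X := X) (γ := γ) (η := η) (x₀ := x₀) (T := T)
    ha hn hf k t).integrable_draw hX.measurable ha hJ hXJ
  have ig := (hN.isFiniteDraw_norm_sq_localGradients (X := X) (γ := γ) (η := η) (x₀ := x₀) (T := T)
    ha hf k).integrable_draw hX.measurable ha hJ hXJ
  have h1 : ∫ ω, ‖stack (dev (consensusOutput a γ η f x₀ T (fun k => W (X k ω))
        (fun k => J k ω) k))‖ ^ 2 ∂P ≤
      ∫ ω, phaseLyapunov Wt (lambdaMinPos Wt) a γ η f x₀ T (fun k => W (X k ω))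
        (fun k => J k ω) k T ∂P := by
    refine integral_mono_of_nonneg (Filter.Eventually.of_forall fun ω => sq_nonneg _) (iV T)
      (Filter.Eventually.of_forall fun ω => ?_)
    simp only
    rw [consensusOutput, consensusPhase, (consensusRun_dev hn (G := fun k => G (X k ω))
      (fun k => hN.gossip _) (fun k => hN.colSum _) _ _ _ T).1]
    exact norm_sq_le_consensusLyapunov hpos hl _ _
  have h2 : ∫ ω, phaseLyapunov Wt (lambdaMinPos Wt) a γ η f x₀ T
        (fun k => W (X k ω)) (fun k => J k ω) k 0 ∂P ≤
      (1 + 12 * condNumber Wt) * ∫ ω, ‖stack (localGradients f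
        (agdRun a γ η f x₀ T (fun k => W (X k ω)) (fun k => J k ω) k).y)‖ ^ 2 ∂P := by
    rw [← integral_const_mul]
    refine integral_mono (iV 0) (ig.const_mul _) fun ω => ?_
    set g := localGradients f (agdRun a γ η f x₀ T (fun k => W (X k ω)) (fun k => J k ω) k).y
    change consensusLyapunov (gossipMap Wt) (lambdaMinPos Wt) (stack (dev g)) (stack (dev g)) ≤ _
    have h3 := inner_gossipMap_le (m := m) hN.mean_posSemidef.1 (stack (dev g))
    have h4 := norm_stack_dev_le hn g
    rw [consensusLyapunov, condNumber]
    calc _ ≤ ‖stack (dev g)‖ ^ 2 + 12 / lambdaMinPos Wt * (lambdaMax Wt * ‖stack (dev g)‖ ^ 2) := by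
          gcongr
      _ = (1 + 12 * (lambdaMax Wt / lambdaMinPos Wt)) * ‖stack (dev g)‖ ^ 2 := by ring
      _ ≤ _ := by gcongr
  refine h1.trans ((hN.integral_phaseLyapunov_le hn hX ha hJ hXJ hf k T).trans ?_)
  rw [mul_comm (1 + _), mul_assoc]
  have : 0 ≤ 1 - a.β / 8 := by linarith [ha.β_le_one]
  gcongr

end Contraction

/-! ### Expected communication per iteration. -/

section Rounds

variable {Ω : Type*} [mΩ : MeasurableSpace Ω] {P : Measure Ω} [IsProbabilityMeasure P]
  {J : ℕ → Ω → ℕ} {a : ConsensusParams} {lmax l ρ : ℝ} {τ : ℕ}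

/-- Level `i` costs `2 ^ i * B` rounds and has probability at most `2 ^ (-i)`, so each of the
`maxDraw + 1` levels contributes at most `B`. -/
theorem IsIIDGeometric.integral_batchRounds_le (ha : a.IsTuned lmax l ρ τ)
    (hJ : IsIIDGeometric P J) (r : ℕ) :
    Integrable (fun ω => (batchRounds a (J r ω) : ℝ)) P ∧
      ∫ ω, (batchRounds a (J r ω) : ℝ) ∂P ≤ (a.maxDraw + 1) * a.B := by
  have hm : Measurable fun ω => a.clip (J r ω) := (measurable_of_countable a.clip).comp
    (hJ.measurable r)
  set E : ℕ → Set Ω := fun i => {ω | a.clip (J r ω) = i} with hE_def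
  have hE : ∀ i, MeasurableSet (E i) := fun i => hm (measurableSet_singleton i)
  have hpt : ∀ ω, (batchRounds a (J r ω) : ℝ) =
      ∑ i ∈ Finset.range (a.maxDraw + 1), (E i).indicator 1 ω * ((2 : ℝ) ^ i * a.B) := by
    intro ω
    rw [Finset.sum_eq_single (a.clip (J r ω))]
    · have h1 : ω ∈ E (a.clip (J r ω)) := rfl
      rw [Set.indicator_of_mem h1, Pi.one_apply, one_mul, ← batchRounds_clip ha.two_le_M,
        batchRounds, if_pos ((ha.two_pow_le_iff _).2 (ha.clip_le _))]
      push_cast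
      rfl
    · intro i _ hne
      have h1 : ω ∉ E i := fun h => hne h.symm
      rw [Set.indicator_of_notMem h1, zero_mul]
    · intro h
      exact absurd (Finset.mem_range.2 (Nat.lt_succ_of_le (ha.clip_le _))) h
  have hi : ∀ i, Integrable (fun ω => (E i).indicator (1 : Ω → ℝ) ω * ((2 : ℝ) ^ i * a.B)) P :=
    fun i => ((integrable_const (1 : ℝ)).indicator (hE i)).mul_const _
  simp_rw [hpt]
  refine ⟨integrable_finsetSum _ fun i _ => hi i, ?_⟩
  rw [integral_finsetSum _ fun i _ => hi i]
  have hterm : ∀ i ∈ Finset.range (a.maxDraw + 1),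
      ∫ ω, (E i).indicator (1 : Ω → ℝ) ω * ((2 : ℝ) ^ i * a.B) ∂P ≤ a.B := by
    intro i hi
    rw [integral_mul_const, integral_indicator_one (hE i),
      hJ.measureReal_clip ha r i (Nat.lt_succ_iff.1 (Finset.mem_range.1 hi)), ← mul_assoc]
    refine mul_le_of_le_one_left (Nat.cast_nonneg _) ?_
    rw [truncWeight]
    split_ifs with h
    · rw [h, pow_zero, mul_one]
      exact pow_le_one₀ (by norm_num) (by norm_num)
    · rw [← mul_pow]; norm_num
  refine (Finset.sum_le_sum hterm).trans (le_of_eq ?_)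
  simp

end Rounds

/-! ### Coupling of the outer loop with the consensus errors. -/

section Expectation

variable {n m : ℕ} {S Ω : Type*} [mS : MeasurableSpace S] [mΩ : MeasurableSpace Ω]
  {Q : Kernel S S} [IsMarkovKernel Q] {π : Measure S} [IsProbabilityMeasure π]
  {τ : ℕ} {G : S → SimpleGraph (Fin n)}
  {W : S → Matrix (Fin n) (Fin n) ℝ} {Wt : Matrix (Fin n) (Fin n) ℝ} {ρ : ℝ}
  {P : Measure Ω} [IsProbabilityMeasure P] {X : ℕ → Ω → S} {J : ℕ → Ω → ℕ}
  {a : ConsensusParams} {f : Fin n → Vec m → ℝ} {μ L α η lmax l : ℝ} {x₀ xs : Vec m} {T : ℕ}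

theorem IsIIDGeometric.integral_rounds_le (ha : a.IsTuned lmax l ρ τ) (hJ : IsIIDGeometric P J)
    (W : Ω → ℕ → Matrix (Fin n) (Fin n) ℝ) (γ : ℝ) (N : ℕ) :
    Integrable (fun ω => ((agdRun a γ η f x₀ T (W ω) (fun k => J k ω) N).rounds : ℝ)) P ∧
      ∫ ω, ((agdRun a γ η f x₀ T (W ω) (fun k => J k ω) N).rounds : ℝ) ∂P ≤
        N * T * ((a.maxDraw + 1) * a.B) := by
  simp_rw [agdRun_rounds, Nat.cast_sum]
  have h := fun r => hJ.integral_batchRounds_le ha r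
  refine ⟨integrable_finsetSum _ fun r _ => (h r).1, ?_⟩
  rw [integral_finsetSum _ fun r _ => (h r).1]
  refine (Finset.sum_le_sum fun r _ => (h r).2).trans (le_of_eq ?_)
  simp

theorem continuous_gradient_component (hn : 0 < n) (hL : 0 < L)
    (hc : ∀ i, ConvexOn ℝ Set.univ (f i)) (hd : ∀ i, Differentiable ℝ (f i))
    (hs : IsSmooth L (globalObjective f)) (i : Fin n) : Continuous (gradient (f i)) := by
  refine (LipschitzWith.of_dist_le_mul (K := ⟨n * L, by positivity⟩) fun x y => ?_).continuous
  rw [dist_eq_norm, dist_eq_norm]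
  exact gradient_component_lipschitz hn hL hc hd hs i x y

theorem sq_sum_range_le (u : ℕ → ℝ) {k N : ℕ} (hk : k ≤ N) :
    (∑ j ∈ Finset.range k, u j) ^ 2 ≤ N * ∑ j ∈ Finset.range k, u j ^ 2 := by
  have h := sq_sum_le_card_mul_sum_sq (s := Finset.range k) (f := u)
  rw [Finset.card_range] at h
  refine h.trans ?_
  gcongr

section Pathwise

variable {x y v : ℕ → Fin n → Vec m}

/-- The feedback from consensus errors to consensus inputs. It is polynomial in the data, because
the Lyapunov bound prevents the errors from being amplified exponentially. -/
theorem norm_sq_localGradients_agd_le (hn : 0 < n) (hμ : 0 < μ) (hμL : μ ≤ L) (hα : 0 < α)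
    (hα1 : α ≤ 1) (hαL : α ^ 2 * L = μ) (hη : η = (1 - α) / (1 + α))
    (hc : ∀ i, ConvexOn ℝ Set.univ (f i)) (hd : ∀ i, Differentiable ℝ (f i))
    (hsc : IsStronglyConvex μ (globalObjective f)) (hs : IsSmooth L (globalObjective f))
    (hmin : ∀ x, globalObjective f xs ≤ globalObjective f x)
    (hx0 : x 0 = fun _ => x₀) (hy0 : y 0 = fun _ => x₀)
    (hx : ∀ k, x (k + 1) = y k - (1 / L) • v k)
    (hy : ∀ k, y (k + 1) = x (k + 1) + η • (x (k + 1) - x k))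
    (hv : ∀ k, nodeMean (v k) = nodeMean (localGradients f (y k))) {k N : ℕ} (hk : k < N) :
    ‖stack (localGradients f (y k))‖ ^ 2 ≤
      (2 * ∑ i, ‖gradient (f i) xs‖ ^ 2 +
        16 * n ^ 3 * L ^ 2 / μ * (globalObjective f x₀ - globalObjective f xs)) +
      36 * n ^ 4 * (L / μ) ^ 2 * N ^ 3 * ∑ j ∈ Finset.range k, ‖stack (dev (v j))‖ ^ 2 := by
  have hL : 0 < L := hμ.trans_le hμL
  have hη0 : 0 ≤ η := by rw [hη]; exact div_nonneg (by linarith) (by linarith)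
  have hη1 : η ≤ 1 := by rw [hη, div_le_one (by linarith)]; linarith
  have h1 := sum_gradient_sq_le hn hL hc hd hs (y k) xs
  have h2 := norm_dev_agd_extrapolated_le hn hL hη0 hη1 hx0 hy0 hx hy k
  have h3 := nesterovLyapunov_agd_le hn hμ hL hα hα1 hαL hη hc hd hsc hs hmin hx0 hy0 hx hy hv k
  have h4 := norm_sub_sq_le_nesterovLyapunov hμ hα hsc hmin (nodeMean (x k)) (nodeMean (y k))
  have h5 := sq_sum_range_le (fun j => ‖stack (dev (v j))‖) hk.le
  set s := ∑ j ∈ Finset.range k, ‖stack (dev (v j))‖ with hs_def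
  set Φ := nesterovLyapunov (globalObjective f) μ α xs (nodeMean (x k)) (nodeMean (y k))
  set gap := globalObjective f x₀ - globalObjective f xs with hgap
  set R := ∑ j ∈ Finset.range k, ‖stack (dev (v j))‖ ^ 2
  have hgap0 : 0 ≤ gap := sub_nonneg.2 (hmin x₀)
  have hs0 : 0 ≤ s := Finset.sum_nonneg fun _ _ => norm_nonneg _
  have hn1 : (1 : ℝ) ≤ n := by exact_mod_cast hn
  have hκ : 1 ≤ L / μ := (one_le_div hμ).2 hμL
  have hkN : (k : ℝ) + 1 ≤ N := by exact_mod_cast hk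
  have hΦ : Φ ≤ 2 * gap + 4 * n / μ * N ^ 2 * s ^ 2 := by
    refine h3.trans (add_le_add ?_ ?_)
    · refine mul_le_of_le_one_left (by positivity) (pow_le_one₀ (by linarith) (by linarith))
    · gcongr
  have hy' : ‖stack (dev (y k))‖ ^ 2 ≤ (N * s / L) ^ 2 := by
    have : (k + 1) * s / L ≤ N * s / L := by gcongr
    exact pow_le_pow_left₀ (norm_nonneg _) (h2.trans this) 2
  calc ‖stack (localGradients f (y k))‖ ^ 2
      ≤ 2 * ∑ i, ‖gradient (f i) xs‖ ^ 2 + 4 * n ^ 2 * L ^ 2 * (N * s / L) ^ 2 +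
        4 * n ^ 3 * L ^ 2 * (2 / μ * (2 * gap + 4 * n / μ * N ^ 2 * s ^ 2)) := by
        refine h1.trans ?_
        gcongr
        exact h4.trans (by gcongr)
    _ = 2 * ∑ i, ‖gradient (f i) xs‖ ^ 2 + 16 * n ^ 3 * L ^ 2 / μ * gap +
        (4 * n ^ 2 * 1 * N ^ 2 + 32 * n ^ 4 * (L / μ) ^ 2 * N ^ 2) * s ^ 2 := by
        field_simp; ring
    _ ≤ 2 * ∑ i, ‖gradient (f i) xs‖ ^ 2 + 16 * n ^ 3 * L ^ 2 / μ * gap +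
        (4 * n ^ 4 * (L / μ) ^ 2 * N ^ 2 + 32 * n ^ 4 * (L / μ) ^ 2 * N ^ 2) * (N * R) := by
        gcongr
        · norm_num
        · exact one_le_pow₀ hκ
    _ = _ := by ring

/-- Passes from the mean to a single node: smoothness bounds the loss by the squared deviation of
that node. -/
theorem globalObjective_agd_le (hn : 0 < n) (hμ : 0 < μ) (hμL : μ ≤ L) (hα : 0 < α)
    (hα1 : α ≤ 1) (hαL : α ^ 2 * L = μ) (hη : η = (1 - α) / (1 + α))
    (hc : ∀ i, ConvexOn ℝ Set.univ (f i)) (hd : ∀ i, Differentiable ℝ (f i))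
    (hsc : IsStronglyConvex μ (globalObjective f)) (hs : IsSmooth L (globalObjective f))
    (hmin : ∀ x, globalObjective f xs ≤ globalObjective f x)
    (hx0 : x 0 = fun _ => x₀) (hy0 : y 0 = fun _ => x₀)
    (hx : ∀ k, x (k + 1) = y k - (1 / L) • v k)
    (hy : ∀ k, y (k + 1) = x (k + 1) + η • (x (k + 1) - x k))
    (hv : ∀ k, nodeMean (v k) = nodeMean (localGradients f (y k))) (N : ℕ) (i : Fin n) :
    globalObjective f (x N i) - globalObjective f xs ≤
      4 * (1 - α / 2) ^ N * (globalObjective f x₀ - globalObjective f xs) +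
      9 * n / μ * N ^ 3 * ∑ j ∈ Finset.range N, ‖stack (dev (v j))‖ ^ 2 := by
  have hL : 0 < L := hμ.trans_le hμL
  have hη0 : 0 ≤ η := by rw [hη]; exact div_nonneg (by linarith) (by linarith)
  have hη1 : η ≤ 1 := by rw [hη, div_le_one (by linarith)]; linarith
  have h2 := (norm_dev_agd_le hn hL hη0 hη1 hx0 hy0 hx hy N).2
  have h3 := nesterovLyapunov_agd_le hn hμ hL hα hα1 hαL hη hc hd hsc hs hmin hx0 hy0 hx hy hv N
  have h4 := hs.sub_min_le hL hmin (x N i) (nodeMean (x N))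
  have h5 := sq_sum_range_le (fun j => ‖stack (dev (v j))‖) (le_refl N)
  have h6 : ‖x N i - nodeMean (x N)‖ ≤ ‖stack (dev (x N))‖ := by
    rw [← dev_apply]; exact norm_apply_le_norm_stack _ i
  have h7 : globalObjective f (nodeMean (x N)) - globalObjective f xs ≤
      nesterovLyapunov (globalObjective f) μ α xs (nodeMean (x N)) (nodeMean (y N)) :=
    le_add_of_nonneg_right (by positivity)
  set s := ∑ j ∈ Finset.range N, ‖stack (dev (v j))‖ with hs_def
  set gap := globalObjective f x₀ - globalObjective f xs with hgap
  set R := ∑ j ∈ Finset.range N, ‖stack (dev (v j))‖ ^ 2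
  have hs0 : 0 ≤ s := Finset.sum_nonneg fun _ _ => norm_nonneg _
  have hn1 : (1 : ℝ) ≤ n := by exact_mod_cast hn
  have hLμ : 1 / L ≤ n / μ := by gcongr
  calc globalObjective f (x N i) - globalObjective f xs
      ≤ 2 * ((1 - α / 2) ^ N * (2 * gap) + 4 * n / μ * N ^ 2 * s ^ 2) + L * (N * s / L) ^ 2 := by
        refine h4.trans (add_le_add ?_ ?_)
        · linarith
        · gcongr
          exact h6.trans h2
    _ = 4 * (1 - α / 2) ^ N * gap + (8 * (n / μ) * N ^ 2 + 1 / L * N ^ 2) * s ^ 2 := by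
        have e : L * (N * s / L) ^ 2 = 1 / L * N ^ 2 * s ^ 2 := by field_simp
        rw [e]; ring
    _ ≤ 4 * (1 - α / 2) ^ N * gap + (8 * (n / μ) * N ^ 2 + n / μ * N ^ 2) * (N * R) := by
        refine add_le_add le_rfl (mul_le_mul (add_le_add le_rfl ?_) h5 (sq_nonneg _) ?_)
        · exact mul_le_mul_of_nonneg_right hLμ (sq_nonneg _)
        · have : 0 ≤ n / μ := by positivity
          positivity
    _ = _ := by ring

end Pathwise

/-- A discrete Gronwall bound: if all earlier terms are at most `2 * q * A`, the feedback adds at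
most `q * A`. -/
theorem le_of_le_add_sum {u : ℕ → ℝ} {q A H : ℝ} {N : ℕ} (hq : 0 ≤ q) (hA : 0 ≤ A) (hH : 0 ≤ H)
    (hsmall : q * (H * N) ≤ 1 / 2)
    (hu : ∀ k < N, u k ≤ q * (A + H * ∑ j ∈ Finset.range k, u j)) (k : ℕ) (hk : k < N) :
    u k ≤ 2 * q * A := by
  induction k using Nat.strong_induction_on with
  | _ k ih =>
    have h1 : ∑ j ∈ Finset.range k, u j ≤ N * (2 * q * A) := by
      refine (Finset.sum_le_card_nsmul _ _ (2 * q * A) fun j hj => ih j (Finset.mem_range.1 hj)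
        ((Finset.mem_range.1 hj).trans hk)).trans ?_
      rw [Finset.card_range, nsmul_eq_mul]
      gcongr
    calc u k ≤ q * (A + H * ∑ j ∈ Finset.range k, u j) := hu k hk
      _ ≤ q * (A + H * (N * (2 * q * A))) := by gcongr
      _ = q * A + q * (H * N) * (2 * q * A) := by ring
      _ ≤ q * A + 1 / 2 * (2 * q * A) := by gcongr
      _ = _ := by ring

/-- The pathwise bounds are integrated; the expected squared deviations `u k` of the outputs satisfy
the hypothesis of `le_of_le_add_sum`, with `q` the contraction over a phase. -/
theorem NetworkAssumptions.integral_agdRun_le (hn : 0 < n) (hμ : 0 < μ) (hμL : μ ≤ L)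
    (hα : 0 < α) (hα1 : α ≤ 1) (hαL : α ^ 2 * L = μ) (hη : η = (1 - α) / (1 + α))
    (hc : ∀ i, ConvexOn ℝ Set.univ (f i)) (hd : ∀ i, Differentiable ℝ (f i))
    (hsc : IsStronglyConvex μ (globalObjective f)) (hs : IsSmooth L (globalObjective f))
    (hmin : ∀ x, globalObjective f xs ≤ globalObjective f x)
    (hN : NetworkAssumptions Q π τ G W Wt ρ) (hX : IsStationaryMarkovChain P Q π X)
    (ha : a.IsTuned (lambdaMax Wt) (lambdaMinPos Wt) ρ τ) (hJ : IsIIDGeometric P J)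
    (hXJ : IndepFun (fun ω k => X k ω) (fun ω k => J k ω) P) {N : ℕ} {q : ℝ}
    (hq : q = (1 + 12 * condNumber Wt) * (1 - a.β / 8) ^ T)
    (hsmall : q * (36 * n ^ 4 * (L / μ) ^ 2 * N ^ 3 * N) ≤ 1 / 2) (i : Fin n) :
    Integrable (fun ω => globalObjective f
      ((agdRun a (1 / L) η f x₀ T (fun k => W (X k ω)) (fun k => J k ω) N).x i)) P ∧
    ∫ ω, (globalObjective f ((agdRun a (1 / L) η f x₀ T (fun k => W (X k ω))
        (fun k => J k ω) N).x i) - globalObjective f xs) ∂P ≤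
      4 * (1 - α / 2) ^ N * (globalObjective f x₀ - globalObjective f xs) +
      9 * n / μ * N ^ 3 * (N * (2 * q * (2 * ∑ i, ‖gradient (f i) xs‖ ^ 2 +
        16 * n ^ 3 * L ^ 2 / μ * (globalObjective f x₀ - globalObjective f xs)))) := by
  have hL : 0 < L := hμ.trans_le hμL
  have hf := continuous_gradient_component hn hL hc hd hs
  have hgap0 : 0 ≤ globalObjective f x₀ - globalObjective f xs := sub_nonneg.2 (hmin x₀)
  set s : Ω → ℕ → AGDState n m := fun ω k =>
    agdRun a (1 / L) η f x₀ T (fun k => W (X k ω)) (fun k => J k ω) k with hs_def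
  set v : Ω → ℕ → Fin n → Vec m := fun ω k =>
    consensusOutput a (1 / L) η f x₀ T (fun k => W (X k ω)) (fun k => J k ω) k with hv_def
  set A := 2 * ∑ i, ‖gradient (f i) xs‖ ^ 2 +
        16 * n ^ 3 * L ^ 2 / μ * (globalObjective f x₀ - globalObjective f xs) with hA
  have hA0 : 0 ≤ A := by
    have : 0 ≤ ∑ i, ‖gradient (f i) xs‖ ^ 2 := Finset.sum_nonneg fun _ _ => sq_nonneg _
    positivity
  have hq0 : 0 ≤ q := by
    have h1 : 0 ≤ condNumber Wt := div_nonneg ha.lmax_pos.le ha.l_pos.le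
    have h2 : 0 ≤ 1 - a.β / 8 := by linarith [ha.β_le_one]
    rw [hq]; positivity
  have hv : ∀ ω k, nodeMean (v ω k) = nodeMean (localGradients f ((s ω k).y)) := fun ω k =>
    (consensusRun_dev hn (G := fun k => G (X k ω)) (fun k => hN.gossip _)
      (fun k => hN.colSum _) _ _ _ T).2
  have iv := fun k => (hN.isFiniteDraw_norm_sq_dev_output (X := X) (γ := 1 / L) (η := η)
    (x₀ := x₀) (T := T) ha hn hf k).integrable_draw hX.measurable ha hJ hXJ
  have ix := (hN.isFiniteDraw_comp_agdRun (X := X) (γ := 1 / L) (η := η)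
    (x₀ := x₀) (T := T) ha hf hs.1.continuous N i).integrable_draw hX.measurable ha hJ hXJ
  set u : ℕ → ℝ := fun k => ∫ ω, ‖stack (dev (v ω k))‖ ^ 2 ∂P with hu_def
  have iS : ∀ k, Integrable (fun ω => ∑ j ∈ Finset.range k, ‖stack (dev (v ω j))‖ ^ 2) P :=
    fun k => integrable_finsetSum _ fun j _ => iv j
  have eS : ∀ k, ∫ ω, ∑ j ∈ Finset.range k, ‖stack (dev (v ω j))‖ ^ 2 ∂P =
    ∑ j ∈ Finset.range k, u j := fun k => integral_finsetSum _ fun j _ => iv j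
  have hu : ∀ k < N, u k ≤ q * (A + 36 * n ^ 4 * (L / μ) ^ 2 * N ^ 3 *
      ∑ j ∈ Finset.range k, u j) := by
    intro k hk
    rw [hq]
    refine (hN.integral_norm_sq_dev_output_le hn hX ha hJ hXJ hf k).trans ?_
    rw [← hq]
    refine mul_le_mul_of_nonneg_left ?_ hq0
    rw [← eS, ← integral_const_mul]
    have e : A = ∫ _, A ∂P := by simp
    rw [e, ← integral_add (integrable_const A) ((iS k).const_mul _)]
    refine integral_mono_of_nonneg (Filter.Eventually.of_forall fun ω => sq_nonneg _)
      ((integrable_const A).add ((iS k).const_mul _)) (Filter.Eventually.of_forall fun ω => ?_)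
    exact norm_sq_localGradients_agd_le (x := fun k => (s ω k).x) (y := fun k => (s ω k).y)
      (v := v ω) hn hμ hμL hα hα1 hαL hη hc hd hsc hs hmin rfl rfl (fun k => rfl) (fun k => rfl)
      (hv ω) hk
  refine ⟨ix, ?_⟩
  have hpath : ∀ ω, globalObjective f ((s ω N).x i) - globalObjective f xs ≤
      4 * (1 - α / 2) ^ N * (globalObjective f x₀ - globalObjective f xs) +
      9 * n / μ * N ^ 3 * ∑ j ∈ Finset.range N, ‖stack (dev (v ω j))‖ ^ 2 := fun ω =>
    globalObjective_agd_le (x := fun k => (s ω k).x) (y := fun k => (s ω k).y)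
      (v := v ω) hn hμ hμL hα hα1 hαL hη hc hd hsc hs hmin rfl rfl (fun k => rfl) (fun k => rfl)
      (hv ω) N i
  refine (integral_mono (ix.sub (integrable_const _))
    ((integrable_const _).add ((iS N).const_mul _)) hpath).trans ?_
  rw [integral_add' (integrable_const _) ((iS N).const_mul _),
    integral_const_mul (9 * n / μ * N ^ 3), eS]
  refine add_le_add (le_of_eq (by simp)) ?_
  gcongr
  refine (Finset.sum_le_card_nsmul _ _ (2 * q * A) fun k hk => le_of_le_add_sum hq0 hA0
    (by positivity) hsmall hu k (Finset.mem_range.1 hk)).trans (le_of_eq ?_)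
  rw [Finset.card_range, nsmul_eq_mul]

end Expectation

/-! ### Numerical bounds for the parameters and iteration counts. -/

section Numerics

theorem consensusParams_inv_beta_le {c lmax l ρ : ℝ} (τ : ℕ) (hc : c = (1 / 2) ^ 40) (hl : 0 < l)
    (hm : 0 < lmax) :
    1 / (consensusParams c lmax l ρ τ).β ≤ 2 ^ 22 * (√(lmax / l) + ρ ^ 2 / l ^ 2) := by
  have hc0 : 0 < c := by rw [hc]; positivity
  have hβ2 := consensusParams_beta_sq ρ τ hc0 hl hm
  have hmax : 0 < max lmax (ρ ^ 4 / l ^ 3) := lt_max_of_lt_left hm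
  set D := √(lmax / l) + ρ ^ 2 / l ^ 2 with hD
  have h1 : max lmax (ρ ^ 4 / l ^ 3) ≤ l * D ^ 2 := by
    have h2 : 0 ≤ √(lmax / l) := Real.sqrt_nonneg _
    have h3 : 0 ≤ ρ ^ 2 / l ^ 2 := by positivity
    have h4 : √(lmax / l) ^ 2 = lmax / l := Real.sq_sqrt (by positivity)
    refine max_le ?_ ?_
    · calc lmax = l * √(lmax / l) ^ 2 := by rw [h4]; field_simp
        _ ≤ l * D ^ 2 := by gcongr; linarith
    · calc ρ ^ 4 / l ^ 3 = l * (ρ ^ 2 / l ^ 2) ^ 2 := by field_simp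
        _ ≤ l * D ^ 2 := by gcongr; linarith
  have hD0 : 0 ≤ D := by positivity
  have hβ0 : 0 ≤ (consensusParams c lmax l ρ τ).β := Real.sqrt_nonneg _
  refine le_of_sq_le_sq ?_ (by positivity)
  rw [div_pow, hβ2, one_pow, one_div_div, div_le_iff₀ (by positivity)]
  calc 12 * max lmax (ρ ^ 4 / l ^ 3) ≤ 12 * (l * D ^ 2) := by gcongr
    _ ≤ 16 * (l * D ^ 2) := by
      have : 0 ≤ l * D ^ 2 := by positivity
      linarith
    _ = _ := by rw [hc]; ring

theorem ConsensusParams.IsTuned.M_le {a : ConsensusParams} (hβ : 0 < a.β) (hβ1 : a.β ≤ 1)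
    (hM : a.M = max 2 (√(1 / 4 * (1 + 2 / a.β)))) : a.M ≤ 2 / a.β := by
  have h1 : 1 ≤ 1 / a.β := (one_le_div hβ).2 hβ1
  have h2 : 2 / a.β = 2 * (1 / a.β) := by ring
  rw [hM, h2]
  refine max_le (by linarith) (Real.sqrt_le_iff.2 ⟨by positivity, ?_⟩)
  nlinarith

theorem logb_two_le {M D U : ℝ} (hM : 0 < M) (hMD : M ≤ 2 ^ 23 * D) (hD : D ≤ U)
    (hU : Real.exp 1 ≤ U) : Real.logb 2 M ≤ 25 * Real.log U := by
  have hU0 : 0 < U := (Real.exp_pos 1).trans_le hU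
  have hΨ : 1 ≤ Real.log U := (Real.le_log_iff_exp_le hU0).2 hU
  have h2 : (0.5 : ℝ) ≤ Real.log 2 := by linarith [Real.log_two_gt_d9]
  have h3 : Real.log M ≤ 23 * Real.log 2 + Real.log U := by
    refine (Real.log_le_log hM (hMD.trans (mul_le_mul_of_nonneg_left hD (by positivity)))).trans
      (le_of_eq ?_)
    rw [Real.log_mul (by positivity) hU0.ne', Real.log_pow]
    norm_num
  rw [Real.logb, div_le_iff₀ (by linarith)]
  nlinarith

/-- The contraction over `T` consensus iterations dominates the polynomial factors of the
analysis. -/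
theorem mul_contraction_le {χ β U V Ψ Λ κ n N : ℝ} {T : ℕ} (hβ : 0 < β) (hβ1 : β ≤ 1) (hχ : 0 ≤ χ)
    (hn : 0 ≤ n) (hκ : 0 ≤ κ) (hN0 : 0 ≤ N) (hU : Real.exp 1 + n + χ + κ ≤ U) (hU4 : 4 ≤ U)
    (hV : Real.exp 1 ≤ V) (hΨ : Ψ = Real.log U) (hΛ : Λ = Real.log V)
    (hT : 8 / β * (27 * (Ψ * Λ)) ≤ T) (hN : N ≤ 9 * √κ * Λ) :
    (1 + 12 * χ) * (1 - β / 8) ^ T * (n ^ 4 * κ ^ 2 * N ^ 4) * V ≤ 1 / 576 := by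
  have he : (2 : ℝ) ≤ Real.exp 1 := by linarith [Real.exp_one_gt_d9]
  have hU0 : 0 < U := by linarith
  have hV0 : 0 < V := by linarith
  have hΨ1 : 1 ≤ Ψ := by rw [hΨ, Real.le_log_iff_exp_le hU0]; linarith
  have hΛ1 : 1 ≤ Λ := by rw [hΛ, Real.le_log_iff_exp_le hV0]; exact hV
  have hΛV : Λ ≤ V := by rw [hΛ]; linarith [Real.log_le_sub_one_of_pos hV0]
  -- The constant `27` in the choice of `T` is `22 + 5`, since `22 * Ψ + 5 * Λ ≤ 27 * (Ψ * Λ)` for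
  -- `Ψ` and `Λ` at least `1`.
  have h1 : (1 - β / 8) ^ T * (U ^ 22 * V ^ 5) ≤ 1 := by
    have e1 : (1 - β / 8) ^ T ≤ Real.exp (-(22 * Ψ + 5 * Λ)) := by
      have e2 : 1 - β / 8 ≤ Real.exp (-(β / 8)) := by linarith [Real.add_one_le_exp (-(β / 8))]
      refine (pow_le_pow_left₀ (by linarith) e2 T).trans ?_
      rw [← Real.exp_nat_mul, Real.exp_le_exp]
      have e3 : 27 * (Ψ * Λ) ≤ T * (β / 8) := by
        have := mul_le_mul_of_nonneg_right hT (by positivity : 0 ≤ β / 8)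
        refine le_trans (le_of_eq ?_) this
        field_simp
      nlinarith
    have e4 : U ^ 22 * V ^ 5 = Real.exp (22 * Ψ + 5 * Λ) := by
      have a1 : Real.exp (22 * Ψ) = U ^ 22 := by
        rw [show (22 : ℝ) * Ψ = ((22 : ℕ) : ℝ) * Ψ by norm_num, Real.exp_nat_mul, hΨ,
          Real.exp_log hU0]
      have a2 : Real.exp (5 * Λ) = V ^ 5 := by
        rw [show (5 : ℝ) * Λ = ((5 : ℕ) : ℝ) * Λ by norm_num, Real.exp_nat_mul, hΛ,
          Real.exp_log hV0]
      rw [Real.exp_add, a1, a2]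
    rw [e4]
    calc _ ≤ Real.exp (-(22 * Ψ + 5 * Λ)) * Real.exp (22 * Ψ + 5 * Λ) := by gcongr
      _ = 1 := by rw [← Real.exp_add]; simp
  have hN4 : N ^ 4 ≤ 6561 * κ ^ 2 * V ^ 4 := by
    calc N ^ 4 ≤ (9 * √κ * V) ^ 4 := by
          gcongr
          exact hN.trans (by gcongr)
      _ = 6561 * (√κ ^ 2) ^ 2 * V ^ 4 := by ring
      _ = _ := by rw [Real.sq_sqrt hκ]
  have hr : 0 ≤ (1 - β / 8) ^ T := pow_nonneg (by linarith) T
  have hnU : n ≤ U := by linarith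
  have hκU : κ ≤ U := by linarith
  have hχU : 1 + 12 * χ ≤ 12 * U := by linarith
  have hmain : (1 + 12 * χ) * (1 - β / 8) ^ T * (n ^ 4 * κ ^ 2 * N ^ 4) * V * U ^ 13 ≤ 78732 := by
    calc _ ≤ (12 * U) * (1 - β / 8) ^ T * (U ^ 4 * κ ^ 2 * (6561 * κ ^ 2 * V ^ 4)) * V * U ^ 13 := by
          gcongr
      _ = 78732 * ((1 - β / 8) ^ T * (U ^ 18 * κ ^ 4 * V ^ 5)) := by ring
      _ ≤ 78732 * ((1 - β / 8) ^ T * (U ^ 18 * U ^ 4 * V ^ 5)) := by gcongr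
      _ = 78732 * ((1 - β / 8) ^ T * (U ^ 22 * V ^ 5)) := by ring
      _ ≤ 78732 * 1 := by gcongr
      _ = _ := mul_one _
  -- Spare powers of `U ≥ 4` absorb the numerical factor `78732`.
  have hU13 : (4 : ℝ) ^ 13 ≤ U ^ 13 := by gcongr
  have hX : 0 ≤ (1 + 12 * χ) * (1 - β / 8) ^ T * (n ^ 4 * κ ^ 2 * N ^ 4) * V := by positivity
  have := (mul_le_mul_of_nonneg_left hU13 hX).trans hmain
  norm_num at this
  linarith

theorem mul_contraction_pow_le {α gap ε : ℝ} {N : ℕ} (hα : 0 < α) (hα1 : α ≤ 1) (hgap : 0 ≤ gap)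
    (hε : 0 < ε) (hN : 8 * α⁻¹ * Real.log (Real.exp 1 + gap / ε) ≤ N) :
    4 * (1 - α / 2) ^ N * gap ≤ ε / 2 := by
  have he : (2 : ℝ) ≤ Real.exp 1 := by linarith [Real.exp_one_gt_d9]
  set g := gap / ε with hg
  have hg0 : 0 ≤ g := by positivity
  have hgap' : gap = g * ε := by rw [hg]; field_simp
  have hE : 0 < Real.exp 1 + g := by linarith
  have h1 : (1 - α / 2) ^ N * (Real.exp 1 + g) ^ 4 ≤ 1 := by
    have e1 : (1 - α / 2) ^ N ≤ Real.exp (-(4 * Real.log (Real.exp 1 + g))) := by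
      have e2 : 1 - α / 2 ≤ Real.exp (-(α / 2)) := by linarith [Real.add_one_le_exp (-(α / 2))]
      refine (pow_le_pow_left₀ (by linarith) e2 N).trans ?_
      rw [← Real.exp_nat_mul, Real.exp_le_exp]
      have e3 : 4 * Real.log (Real.exp 1 + g) ≤ N * (α / 2) := by
        have := mul_le_mul_of_nonneg_right hN (by positivity : 0 ≤ α / 2)
        refine le_trans (le_of_eq ?_) this
        field_simp
        ring
      linarith
    have e4 : (Real.exp 1 + g) ^ 4 = Real.exp (4 * Real.log (Real.exp 1 + g)) := by
      rw [show (4 : ℝ) * Real.log (Real.exp 1 + g) = ((4 : ℕ) : ℝ) * Real.log (Real.exp 1 + g) by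
        norm_num, Real.exp_nat_mul, Real.exp_log hE]
    rw [e4]
    calc _ ≤ Real.exp (-(4 * Real.log (Real.exp 1 + g))) *
          Real.exp (4 * Real.log (Real.exp 1 + g)) := by gcongr
      _ = 1 := by rw [← Real.exp_add]; simp
  have hr : 0 ≤ (1 - α / 2) ^ N := pow_nonneg (by linarith) N
  have h2 : 8 * g ≤ (Real.exp 1 + g) ^ 4 := by
    have k1 : (2 : ℝ) ^ 3 ≤ (Real.exp 1 + g) ^ 3 := by gcongr; linarith
    calc 8 * g ≤ (Real.exp 1 + g) ^ 3 * (Real.exp 1 + g) := by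
          refine mul_le_mul (by linarith) (by linarith) hg0 (by positivity)
      _ = _ := by ring
  rw [hgap']
  have h3 := mul_le_mul_of_nonneg_left h2 hr
  nlinarith

/-- A nonminimal point is needed: on a one-point space the two constants are unrelated. -/
theorem strongConvexity_le_smoothness {m : ℕ} {μ L : ℝ} {h : Vec m → ℝ} {xs x₀ : Vec m}
    (hsc : IsStronglyConvex μ h) (hs : IsSmooth L h) (hmin : ∀ x, h xs ≤ h x)
    (hlt : h xs < h x₀) : μ ≤ L := by
  have h1 := hsc.sq_dist_le hmin x₀
  have h2 := hs.le_quadratic x₀ xs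
  rw [gradient_eq_zero_of_forall_le hmin, inner_zero_left] at h2
  have h3 : 0 < ‖x₀ - xs‖ ^ 2 := by
    have : x₀ ≠ xs := fun e => hlt.ne (by rw [e])
    have := norm_pos_iff.2 (sub_ne_zero.2 this)
    positivity
  have h4 : μ * ‖x₀ - xs‖ ^ 2 ≤ L * ‖x₀ - xs‖ ^ 2 := by linarith
  exact le_of_mul_le_mul_right h4 h3

end Numerics

/-! ### Accuracy for sufficiently large `N` and `T`. -/

section Complexity

variable {n m : ℕ} {S Ω : Type*} [mS : MeasurableSpace S] [mΩ : MeasurableSpace Ω]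
  {Q : Kernel S S} [IsMarkovKernel Q] {π : Measure S} [IsProbabilityMeasure π]
  {τ : ℕ} {G : S → SimpleGraph (Fin n)}
  {W : S → Matrix (Fin n) (Fin n) ℝ} {Wt : Matrix (Fin n) (Fin n) ℝ} {ρ : ℝ}
  {P : Measure Ω} [IsProbabilityMeasure P] {X : ℕ → Ω → S} {J : ℕ → Ω → ℕ}
  {a : ConsensusParams} {f : Fin n → Vec m → ℝ} {μ L ε : ℝ} {x₀ xs : Vec m} {T N : ℕ}

theorem sqrt_inv_ratio {μ L : ℝ} (hμ : 0 < μ) (hμL : μ ≤ L) :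
    0 < √(μ / L) ∧ √(μ / L) ≤ 1 ∧ √(μ / L) ^ 2 * L = μ ∧ (√(μ / L))⁻¹ = √(L / μ) ∧
      (√L - √μ) / (√L + √μ) = (1 - √(μ / L)) / (1 + √(μ / L)) := by
  have hL : 0 < L := hμ.trans_le hμL
  have h1 : 0 < √L := Real.sqrt_pos.2 hL
  have h2 : 0 < √μ := Real.sqrt_pos.2 hμ
  refine ⟨Real.sqrt_pos.2 (by positivity), ?_, ?_, ?_, ?_⟩
  · exact Real.sqrt_le_one.2 ((div_le_one hL).2 hμL)
  · rw [Real.sq_sqrt (by positivity)]; field_simp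
  · rw [← Real.sqrt_inv, inv_div]
  · rw [Real.sqrt_div hμ.le]
    field_simp

/-- Half of `ε` goes to the optimization error, which fixes `N` through `gap` alone, and half to the
consensus error, for which `T` also has to see the gradients at the optimum. -/
theorem NetworkAssumptions.integral_agdRun_le_of_large (hn : 2 ≤ n) (hμ : 0 < μ) (hμL : μ ≤ L)
    (hc : ∀ i, ConvexOn ℝ Set.univ (f i)) (hd : ∀ i, Differentiable ℝ (f i))
    (hsc : IsStronglyConvex μ (globalObjective f)) (hs : IsSmooth L (globalObjective f))
    (hmin : ∀ x, globalObjective f xs ≤ globalObjective f x)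
    (hN : NetworkAssumptions Q π τ G W Wt ρ) (hX : IsStationaryMarkovChain P Q π X)
    (ha : a.IsTuned (lambdaMax Wt) (lambdaMinPos Wt) ρ τ) (hJ : IsIIDGeometric P J)
    (hXJ : IndepFun (fun ω k => X k ω) (fun ω k => J k ω) P) (hε : 0 < ε)
    {gap grad Ψ Λ U V : ℝ} (hgap : gap = globalObjective f x₀ - globalObjective f xs)
    (hgrad : grad = (1 / (n : ℝ)) * ∑ i, ‖gradient (f i) xs‖ ^ 2)
    (hU : Real.exp 1 + n + condNumber Wt + L / μ ≤ U) (hΨ : Ψ = Real.log U)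
    (hV : V = Real.exp 1 + (gap + grad / μ) / ε) (hΛ : Λ = Real.log V)
    (hT : 8 / a.β * (27 * (Ψ * Λ)) ≤ T)
    (hN1 : 8 * √(L / μ) * Real.log (Real.exp 1 + gap / ε) ≤ N) (hN2 : N ≤ 9 * √(L / μ) * Λ)
    (i : Fin n) :
    Integrable (fun ω => globalObjective f ((agdRun a (1 / L) ((√L - √μ) / (√L + √μ)) f x₀ T
      (fun k => W (X k ω)) (fun k => J k ω) N).x i)) P ∧
    ∫ ω, (globalObjective f ((agdRun a (1 / L) ((√L - √μ) / (√L + √μ)) f x₀ T (fun k => W (X k ω))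
        (fun k => J k ω) N).x i) - globalObjective f xs) ∂P ≤ ε := by
  have hn0 : 0 < n := by omega
  have hn1 : (0 : ℝ) < n := by exact_mod_cast hn0
  have hn2 : (1 : ℝ) ≤ n := by exact_mod_cast hn0
  have hL : 0 < L := hμ.trans_le hμL
  obtain ⟨hα, hα1, hαL, hαi, hη⟩ := sqrt_inv_ratio hμ hμL
  rw [← hαi] at hN1
  have he : (2 : ℝ) ≤ Real.exp 1 := by linarith [Real.exp_one_gt_d9]
  have hχ : 0 ≤ condNumber Wt := div_nonneg ha.lmax_pos.le ha.l_pos.le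
  have hκ : 1 ≤ L / μ := (one_le_div hμ).2 hμL
  have hgap0 : 0 ≤ gap := by rw [hgap]; exact sub_nonneg.2 (hmin x₀)
  have hgsum : 0 ≤ ∑ i, ‖gradient (f i) xs‖ ^ 2 := Finset.sum_nonneg fun _ _ => sq_nonneg _
  have hgrad0 : 0 ≤ grad := by rw [hgrad]; positivity
  have hgrad' : ∑ i, ‖gradient (f i) xs‖ ^ 2 = n * grad := by rw [hgrad]; field_simp
  set r := (gap + grad / μ) / ε with hr
  have hr0 : 0 ≤ r := by positivity
  have hrε : gap + grad / μ = r * ε := by rw [hr]; field_simp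
  have hmain := mul_contraction_le (T := T) (N := N) (n := n) ha.β_pos ha.β_le_one hχ
    (Nat.cast_nonneg n) (zero_le_one.trans hκ) (Nat.cast_nonneg N) hU (by
      have : (2 : ℝ) ≤ n := by exact_mod_cast hn
      linarith) (hV ▸ le_add_of_nonneg_right hr0) hΨ hΛ hT hN2
  set q := (1 + 12 * condNumber Wt) * (1 - a.β / 8) ^ T with hq
  have hq0 : 0 ≤ q := by
    have h2 : 0 ≤ 1 - a.β / 8 := by linarith [ha.β_le_one]
    positivity
  set Y := q * (n ^ 4 * (L / μ) ^ 2 * N ^ 4) with hY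
  have hY0 : 0 ≤ Y := by positivity
  have hV1 : 1 ≤ V := by rw [hV]; linarith
  have hrV : r ≤ V := by rw [hV]; linarith
  have hYV : Y ≤ Y * V := le_mul_of_one_le_right hY0 hV1
  have hYr : Y * r ≤ Y * V := by gcongr
  have h1 := hN.integral_agdRun_le (x₀ := x₀) hn0 hμ hμL hα hα1 hαL hη hc hd hsc hs hmin hX ha hJ hXJ
    (N := N) hq (by
      calc _ = 36 * Y := by rw [hY]; ring
        _ ≤ 1 / 2 := by linarith) i
  refine ⟨h1.1, h1.2.trans ?_⟩
  rw [← hgap, hgrad']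
  have h2 := mul_contraction_pow_le hα hα1 hgap0 hε hN1
  have h3 : 9 * n / μ * N ^ 3 * (N * (2 * q * (2 * (n * grad) + 16 * n ^ 3 * L ^ 2 / μ * gap))) ≤
      ε / 2 := by
    calc 9 * n / μ * N ^ 3 * (N * (2 * q * (2 * (n * grad) + 16 * n ^ 3 * L ^ 2 / μ * gap)))
        = 18 * n * N ^ 4 * q * (2 * n * 1 * (grad / μ) + 16 * n ^ 3 * (L / μ) ^ 2 * gap) := by
          field_simp
          ring
      _ ≤ 18 * n * N ^ 4 * q * (16 * n ^ 3 * (L / μ) ^ 2 * (grad / μ) +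
          16 * n ^ 3 * (L / μ) ^ 2 * gap) := by
          have k1 : (n : ℝ) ≤ n ^ 3 := le_self_pow₀ hn2 (by norm_num)
          have k2 : 1 ≤ (L / μ) ^ 2 := one_le_pow₀ hκ
          gcongr
          norm_num
      _ = 288 * Y * (gap + grad / μ) := by rw [hY]; ring
      _ = 288 * (Y * r) * ε := by rw [hrε]; ring
      _ ≤ 1 / 2 * ε := by gcongr; linarith
      _ = ε / 2 := by ring
  linarith

end Complexity

/-! ### Resulting complexity bounds. -/

section Cost

/-- The three factors `Ψ` come from `T`, from the number of levels and from the base batch; the two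
factors `Λ` from `N` and `T`. -/
theorem cost_bounds {χ δ κ Ψ Λ lg β τ M U : ℝ} {B K N T : ℕ} (hχ : 1 ≤ χ) (hδ : 0 ≤ δ)
    (hκ : 1 ≤ κ) (hτ : 1 ≤ τ) (hU : Real.exp 1 + χ + δ ≤ U) (hΨ : Ψ = Real.log U)
    (hlg : 1 ≤ lg) (hΛ : lg ≤ Λ) (hβD : 1 / β ≤ 2 ^ 22 * (√χ + δ))
    (hM0 : 0 < M) (hM : M ≤ 2 / β) (hB : (B : ℝ) ≤ τ * Real.logb 2 M + 1)
    (hK : (K : ℝ) ≤ Real.logb 2 M) (hN : (N : ℝ) ≤ 8 * √κ * lg + 1)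
    (hT : (T : ℝ) ≤ 8 / β * (27 * (Ψ * Λ)) + 1) :
    (N : ℝ) ≤ 2 ^ 60 * √κ * lg ∧ (N : ℝ) ≤ 9 * √κ * Λ ∧
    (T : ℝ) ≤ 2 ^ 60 * (τ * (√χ + δ)) * Ψ ^ 3 * Λ ∧
    N * T * ((K + 1) * B) ≤ 2 ^ 60 * (τ * (√χ + δ)) * √κ * Ψ ^ 3 * Λ ^ 2 := by
  have he : (2 : ℝ) ≤ Real.exp 1 := by linarith [Real.exp_one_gt_d9]
  have hU0 : 0 < U := by linarith
  have hUe : Real.exp 1 ≤ U := by linarith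
  have hΨ1 : 1 ≤ Ψ := by rw [hΨ, Real.le_log_iff_exp_le hU0]; exact hUe
  have hΛ1 : 1 ≤ Λ := hlg.trans hΛ
  have hsκ : 1 ≤ √κ := Real.one_le_sqrt.2 hκ
  have hsχ : 1 ≤ √χ := Real.one_le_sqrt.2 hχ
  have hsχ' : √χ ≤ χ := by
    have h1 := Real.sq_sqrt (by linarith : 0 ≤ χ)
    nlinarith
  set D := √χ + δ with hD
  have hD1 : 1 ≤ D := by linarith
  have hlogM : Real.logb 2 M ≤ 25 * Ψ := by
    rw [hΨ]
    refine logb_two_le hM0 (D := D) (hM.trans ?_) (by linarith) hUe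
    have : 2 / β = 2 * (1 / β) := by ring
    rw [this]; linarith
  have hB' : (B : ℝ) ≤ 26 * (τ * Ψ) := by
    have h1 : τ * Real.logb 2 M ≤ τ * (25 * Ψ) := by gcongr
    have h2 : 1 ≤ τ * Ψ := one_le_mul_of_one_le_of_one_le hτ hΨ1
    linarith
  have hK' : (K : ℝ) + 1 ≤ 26 * Ψ := by linarith
  have hN' : (N : ℝ) ≤ 9 * √κ * lg := by
    have h2 : 1 ≤ √κ * lg := one_le_mul_of_one_le_of_one_le hsκ hlg
    linarith
  have hN9 : (N : ℝ) ≤ 9 * √κ * Λ := hN'.trans (by gcongr)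
  have hΨΛ : 1 ≤ Ψ * Λ := one_le_mul_of_one_le_of_one_le hΨ1 hΛ1
  have hT' : (T : ℝ) ≤ 2 ^ 30 * (D * (Ψ * Λ)) := by
    have h2 : 1 ≤ D * (Ψ * Λ) := one_le_mul_of_one_le_of_one_le hD1 hΨΛ
    have h3 : 8 / β * (27 * (Ψ * Λ)) ≤ 216 * (2 ^ 22 * D) * (Ψ * Λ) := by
      calc _ = 216 * (1 / β) * (Ψ * Λ) := by ring
        _ ≤ _ := by gcongr
    linarith
  refine ⟨hN'.trans ?_, hN9, hT'.trans ?_, ?_⟩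
  · gcongr; norm_num
  · have h2 : 1 * Ψ ^ 1 ≤ τ * Ψ ^ 3 := by
      gcongr
      norm_num
    calc (2 : ℝ) ^ 30 * (D * (Ψ * Λ)) = 2 ^ 30 * (D * Λ * (1 * Ψ ^ 1)) := by ring
      _ ≤ 2 ^ 60 * (D * Λ * (τ * Ψ ^ 3)) := by
        gcongr
        · norm_num
        · norm_num
      _ = _ := by ring
  · calc (N : ℝ) * T * ((K + 1) * B)
        ≤ (9 * √κ * Λ) * (2 ^ 30 * (D * (Ψ * Λ))) * ((26 * Ψ) * (26 * (τ * Ψ))) := by gcongr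
      _ = (9 * 2 ^ 30 * 26 * 26) * (τ * D * √κ * Ψ ^ 3 * Λ ^ 2) := by ring
      _ ≤ 2 ^ 60 * (τ * D * √κ * Ψ ^ 3 * Λ ^ 2) := by gcongr; norm_num
      _ = _ := by ring

end Cost

end MarkovGossip

end

/-! ### Choice of the constants and of `N` and `T`. -/

open MarkovGossip in
theorem mainTheorem3 :
    ∃ (c C : ℝ) (q : ℕ), 0 < c ∧ 0 < C ∧
      ∀ (n m : ℕ) (_ : 2 ≤ n) (f : Fin n → Vec m → ℝ) (μ L : ℝ) (x₀ xs : Vec m)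
        (S : Type*) [MeasurableSpace S] (Q : Kernel S S) [IsMarkovKernel Q]
        (π : Measure S) [IsProbabilityMeasure π] (τ : ℕ) (G : S → SimpleGraph (Fin n))
        (W : S → Matrix (Fin n) (Fin n) ℝ) (Wt : Matrix (Fin n) (Fin n) ℝ) (ρ ε : ℝ),
        (∀ i, ConvexOn ℝ Set.univ (f i)) → (∀ i, Differentiable ℝ (f i)) →
        0 < μ → 0 < L →
        IsStronglyConvex μ (globalObjective f) → IsSmooth L (globalObjective f) →
        (∀ x, globalObjective f xs ≤ globalObjective f x) →
        NetworkAssumptions Q π τ G W Wt ρ →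
        0 < ε →
        ∀ (lmax lmin χ gap grad Ψ Λ : ℝ),
          lmax = lambdaMax Wt → lmin = lambdaMinPos Wt → χ = condNumber Wt →
          gap = globalObjective f x₀ - globalObjective f xs →
          grad = (1 / (n : ℝ)) * ∑ i, ‖gradient (f i) xs‖ ^ 2 →
          Ψ = Real.log (Real.exp 1 + n + χ + ρ ^ 2 / lmin ^ 2 + L / μ) →
          Λ = Real.log (Real.exp 1 + (gap + grad / μ) / ε) →
          ∃ N T : ℕ,
            (T : ℝ) ≤ C * (τ * (√χ + ρ ^ 2 / lmin ^ 2)) * Ψ ^ q * Λ ∧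
            ∀ (Ω : Type*) [MeasurableSpace Ω] (P : Measure Ω) [IsProbabilityMeasure P]
              (X : ℕ → Ω → S) (J : ℕ → Ω → ℕ),
              IsStationaryMarkovChain P Q π X → IsIIDGeometric P J →
              IndepFun (fun ω k => X k ω) (fun ω k => J k ω) P →
              ∀ out : Ω → AGDState n m,
                (out = fun ω => agdRun (consensusParams c lmax lmin ρ τ) (1 / L)
                  ((√L - √μ) / (√L + √μ)) f x₀ T (fun k => W (X k ω)) (fun k => J k ω) N) →
                (∀ i, Integrable (fun ω => globalObjective f ((out ω).x i)) P ∧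
                  ∫ ω, (globalObjective f ((out ω).x i) - globalObjective f xs) ∂P ≤ ε) ∧
                (Integrable (fun ω => ((out ω).rounds : ℝ)) P ∧
                  ∫ ω, ((out ω).rounds : ℝ) ∂P ≤
                    C * (τ * (√χ + ρ ^ 2 / lmin ^ 2)) * √(L / μ) * Ψ ^ q * Λ ^ 2) ∧
                (∀ ω, ((out ω).grads : ℝ) ≤
                  C * √(L / μ) * Real.log (Real.exp 1 + gap / ε)) := by
  refine ⟨(1 / 2) ^ 40, 2 ^ 60, 3, by positivity, by positivity, ?_⟩
  intro n m hn f μ L x₀ xs S _ Q _ π _ τ G W Wt ρ ε hc hd hμ hL hsc hs hmin hN hε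
    lmax lmin χ gap grad Ψ Λ hlmax hlmin hχ hgap hgrad hΨ hΛ
  obtain ⟨Gt, -, hGt⟩ := hN.mean_gossip
  have hl : 0 < lmin := hlmin ▸ lambdaMinPos_pos hn hN.mean_posSemidef hGt
  have hlm : lmin ≤ lmax := by
    rw [hlmin, hlmax]; exact lambdaMinPos_le_lambdaMax hn hN.mean_posSemidef hGt
  have hχl : χ = lmax / lmin := by rw [hχ, hlmax, hlmin]; rfl
  have hχ1 : 1 ≤ χ := by rw [hχl]; exact (one_le_div hl).2 hlm
  have hτ1 : (1 : ℝ) ≤ τ := by exact_mod_cast hN.one_le_tau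
  have hδ : 0 ≤ ρ ^ 2 / lmin ^ 2 := by positivity
  have he : (2 : ℝ) ≤ Real.exp 1 := by linarith [Real.exp_one_gt_d9]
  have hκ0 : 0 < L / μ := by positivity
  have hn0 : (0 : ℝ) < n := by exact_mod_cast (by omega : 0 < n)
  have hgap0 : 0 ≤ gap := by rw [hgap]; exact sub_nonneg.2 (hmin x₀)
  have hgrad0 : 0 ≤ grad := by
    have : 0 ≤ ∑ i, ‖gradient (f i) xs‖ ^ 2 := Finset.sum_nonneg fun _ _ => sq_nonneg _
    rw [hgrad]; positivity
  have hΨ0 : 0 ≤ Ψ := by rw [hΨ]; exact Real.log_nonneg (by linarith)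
  have hr0 : 0 ≤ (gap + grad / μ) / ε := by positivity
  have hgr : gap / ε ≤ (gap + grad / μ) / ε := by
    gcongr
    exact le_add_of_nonneg_right (by positivity)
  have hg0 : 0 ≤ gap / ε := by positivity
  have hΛ0 : 0 ≤ Λ := by rw [hΛ]; exact Real.log_nonneg (by linarith)
  have hlg : 1 ≤ Real.log (Real.exp 1 + gap / ε) := by
    rw [Real.le_log_iff_exp_le (by linarith)]; linarith
  have hlgΛ : Real.log (Real.exp 1 + gap / ε) ≤ Λ := by
    rw [hΛ]; exact Real.log_le_log (by linarith) (by linarith)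
  -- If the starting point is already good enough, no iteration is made. Otherwise it is not a
  -- minimizer, which gives `μ ≤ L`.
  rcases le_or_gt gap ε with hsmall | hlarge
  · refine ⟨0, 0, by rw [Nat.cast_zero]; positivity, ?_⟩
    intro Ω _ P _ X J hX hJ hXJ out hout
    subst hout
    refine ⟨fun i => ⟨?_, ?_⟩, ⟨?_, ?_⟩, fun ω => ?_⟩
    · exact integrable_const (globalObjective f x₀)
    · simp only [agdRun]
      rw [← hgap]
      simpa using hsmall
    · simp [agdRun]
    · simp only [agdRun, Nat.cast_zero, integral_zero]
      positivity
    · simp only [agdRun, Nat.cast_zero]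
      positivity
  · have hμL : μ ≤ L := strongConvexity_le_smoothness hsc hs hmin
      (sub_pos.1 (hgap ▸ hε.trans hlarge))
    have hκ : 1 ≤ L / μ := (one_le_div hμ).2 hμL
    have ha : (consensusParams ((1 / 2) ^ 40) lmax lmin ρ τ).IsTuned (lambdaMax Wt)
        (lambdaMinPos Wt) ρ τ := by
      rw [← hlmax, ← hlmin]; exact consensusParams_isTuned τ rfl hl hlm
    have hβD := consensusParams_inv_beta_le (ρ := ρ) τ rfl hl (hl.trans_le hlm)
    have hM : (consensusParams ((1 / 2) ^ 40) lmax lmin ρ τ).M =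
      max 2 (√(1 / 4 * (1 + 2 / (consensusParams ((1 / 2) ^ 40) lmax lmin ρ τ).β))) := rfl
    have hB : (consensusParams ((1 / 2) ^ 40) lmax lmin ρ τ).B =
      ⌈(τ : ℝ) * Real.logb 2 (consensusParams ((1 / 2) ^ 40) lmax lmin ρ τ).M⌉₊ := rfl
    rw [← hχl] at hβD
    -- Only the tuning relations and the formulas for `M` and `B` are needed from here on.
    generalize consensusParams ((1 / 2) ^ 40) lmax lmin ρ τ = a at *
    have hM0 : 0 < a.M := by linarith [ha.two_le_M]
    have hBle : (a.B : ℝ) ≤ τ * Real.logb 2 a.M + 1 := by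
      rw [hB]
      exact (Nat.ceil_lt_add_one (mul_nonneg (by linarith) (Real.logb_nonneg one_lt_two
        (by linarith [ha.two_le_M])))).le
    have hβ := ha.β_pos
    set N := ⌈8 * √(L / μ) * Real.log (Real.exp 1 + gap / ε)⌉₊ with hN_def
    set T := ⌈8 / a.β * (27 * (Ψ * Λ))⌉₊ with hT_def
    obtain ⟨c1, c2, c3, c4⟩ := cost_bounds (K := a.maxDraw) (N := N) (T := T) hχ1 hδ hκ hτ1
      (U := Real.exp 1 + n + χ + ρ ^ 2 / lmin ^ 2 + L / μ) (by linarith) hΨ hlg hlgΛ hβD hM0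
      (ConsensusParams.IsTuned.M_le hβ ha.β_le_one hM) hBle ha.maxDraw_le
      (Nat.ceil_lt_add_one (by positivity)).le (Nat.ceil_lt_add_one (by positivity)).le
    refine ⟨N, T, c3, ?_⟩
    intro Ω _ P _ X J hX hJ hXJ out hout
    subst hout
    refine ⟨fun i => ?_, ?_, fun ω => ?_⟩
    · exact hN.integral_agdRun_le_of_large hn hμ hμL hc hd hsc hs hmin hX ha hJ hXJ hε hgap hgrad
        (U := Real.exp 1 + n + χ + ρ ^ 2 / lmin ^ 2 + L / μ) (by rw [← hχ]; linarith) hΨ rfl hΛ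
        (Nat.le_ceil _) (Nat.le_ceil _) c2 i
    · have h := hJ.integral_rounds_le (x₀ := x₀) (f := f) (T := T)
        (η := (√L - √μ) / (√L + √μ)) ha (fun ω k => W (X k ω)) (1 / L) N
      exact ⟨h.1, h.2.trans c4⟩
    · rw [agdRun_grads]
      exact c1
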